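/- **Theorem 2.1 (Upper bound).** Let $\mu>0$ and let $v:[0,\infty)\to[0,\infty]$ be measurable with $v(r)=0$ for $r>R_0$, for some $R_0<\infty$ (hard cores are allowed). For $N\ge 1$ and $L>0$ let $E_0(N,L)$ be the ground state energy, with periodic boundary conditions, of $$H^{(N)}=-\mu\sum_{i=1}^N\Delta_i+\sum_{1\le i<j\le N}v(|x_i-x_j|),$$ where $v(|\cdot|)$ is replaced by its periodic extension $\sum_{n\in\mathbb Z^2}v(|x+Ln|)$; that is, $E_0(N,L)$ is the infimum of $\langle\Psi,H^{(N)}\Psi\rangle/\langle\Psi,\Psi\rangle$, understood as quadratic forms on $[0,L]^{2N}$, over all nonzero totally symmetric $\Psi\in H^1_{\rm loc}(\mathbb R^{2N})$ that are $L$-periodic in each coordinate. Let $a$ be the two-dimensional scattering length of $v$, defined by $$\inf\Big\{\int_{|x|<R}\Big(\mu|\nabla\phi|^2+\tfrac12 v(|x|)|\phi|^2\Big)\,dx\ :\ \phi\in H^1(\{|x|<R\}),\ \phi=1\text{ on }|x|=R\Big\}=\frac{2\pi\mu}{\ln(R/a)}$$ for any $R>\max(R_0,0)$ (the value of $a$ does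 not depend on $R$), and assume $a>0$, i.e. $v$ does not vanish almost everywhere. Put $\rho=N/L^2$. Then, as $\rho a^2\to0$, $$\frac{E_0(N,L)}{N}\le\frac{4\pi\mu\rho}{|\ln(\rho a^2)|}\Big(1+O\big(|\ln(\rho a^2)|^{-1}\big)\Big),$$ with a universal error term: there are absolute constants $C,\delta>0$ such that for all $\mu,v,N,L$ as above with $\rho a^2<\delta$, $$\frac{E_0(N,L)}{N}\le\frac{4\pi\mu\rho}{|\ln(\rho a^2)|}\Big(1+\frac{C}{|\ln(\rho a^2)|}\Big).$$ -/

import Mathlib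

open MeasureTheory
open scoped ENNReal ContDiff

noncomputable section

namespace BoseGas

/-- The plane `ℝ²` with its Euclidean norm. -/
abbrev Plane : Type := EuclideanSpace ℝ (Fin 2)

/-- The configuration space `(ℝ²)^N` of `N` particles in the plane, with Lebesgue measure. -/
abbrev Config (N : ℕ) : Type := Fin N → Plane

/-- The `k`-th standard basis vector of the plane. -/
def unitVec (k : Fin 2) : Plane := EuclideanSpace.single k 1

/-- `g` is the weak (distributional) derivative of `f` in the direction `e`, on the whole space. -/
def HasWeakDeriv {E F : Type*} [NormedAddCommGroup E] [NormedSpace ℝ E] [MeasureSpace E]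
    [NormedAddCommGroup F] [NormedSpace ℝ F] (f g : E → F) (e : E) : Prop :=
  LocallyIntegrable f ∧ LocallyIntegrable g ∧
    ∀ η : E → ℝ, ContDiff ℝ ∞ η → HasCompactSupport η →
      ∫ x, (fderiv ℝ η x e) • f x = -∫ x, η x • g x

/-! ### The scattering length -/

/-- `φ` belongs to `H¹(B_R)`, with weak gradient `G`, and equals `1` on the circle `|x| = R`.
The boundary condition (in the sense of traces) is expressed by saying that the extension of `φ`
by `1` to the outside of the disc `B_R` is still weakly differentiable on the plane. -/
structure IsScatteringTrial (R : ℝ) (φ : Plane → ℝ) (G : Fin 2 → Plane → ℝ) : Prop where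
  eq_one : ∀ x : Plane, R ≤ ‖x‖ → φ x = 1
  weakDeriv : ∀ k, HasWeakDeriv φ (G k) (unitVec k)
  memLp : MemLp φ 2 (volume.restrict (Metric.ball 0 R))
  memLp_grad : ∀ k, MemLp (G k) 2 (volume.restrict (Metric.ball 0 R))

/-- The two-body functional `∫_{B_R} μ |∇φ|² + ½ v(|x|) |φ|²`. -/
def scatteringFunctional (μ : ℝ) (v : ℝ → ℝ≥0∞) (R : ℝ) (φ : Plane → ℝ)
    (G : Fin 2 → Plane → ℝ) : ℝ≥0∞ :=
  ∫⁻ x in Metric.ball (0 : Plane) R,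
    (ENNReal.ofReal μ * ∑ k, ‖G k x‖ₑ ^ 2 + v ‖x‖ / 2 * ‖φ x‖ₑ ^ 2)

/-- The infimum of the two-body functional over all `φ ∈ H¹(B_R)` with `φ = 1` on `|x| = R`. -/
def scatteringEnergy (μ : ℝ) (v : ℝ → ℝ≥0∞) (R : ℝ) : ℝ≥0∞ :=
  sInf {e | ∃ (φ : Plane → ℝ) (G : Fin 2 → Plane → ℝ),
    IsScatteringTrial R φ G ∧ e = scatteringFunctional μ v R φ G}

open Classical in
/-- The two-dimensional scattering length `a` of `v`: the solution of
`scatteringEnergy μ v R = 2πμ / ln (R / a)`, with `a = 0` if the energy vanishes.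
For `R` larger than the range of `v` it does not depend on `R`. -/
def scatteringLength (μ : ℝ) (v : ℝ → ℝ≥0∞) (R : ℝ) : ℝ :=
  if scatteringEnergy μ v R = 0 then 0
  else R * Real.exp (-(2 * Real.pi * μ / (scatteringEnergy μ v R).toReal))

/-! ### The many-body ground state energy with periodic boundary conditions -/

/-- The box `[0, L)²` for each of the `N` particles. -/
def box (N : ℕ) (L : ℝ) : Set (Config N) := {x | ∀ i k, x i k ∈ Set.Ico 0 L}

/-- The `L`-periodic extension `∑_{n ∈ ℤ²} v(|x + L n|)` of the interaction potential. -/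
def periodicPotential (v : ℝ → ℝ≥0∞) (L : ℝ) (x : Plane) : ℝ≥0∞ :=
  ∑' n : Fin 2 → ℤ, v ‖x + WithLp.toLp 2 (fun k => L * (n k : ℝ))‖

/-- `Ψ` is a totally symmetric wave function of `N` particles in the form domain `H¹` of the
Laplacian with periodic boundary conditions on the box of side length `L`; `G i k` is its weak
derivative with respect to the `k`-th coordinate of the `i`-th particle. Wave functions on the
periodic box are identified with periodic functions on the whole configuration space. -/
structure IsPeriodicBoseFunction (N : ℕ) (L : ℝ) (Ψ : Config N → ℂ)
    (G : Fin N → Fin 2 → Config N → ℂ) : Prop where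
  symm : ∀ (σ : Equiv.Perm (Fin N)) (x : Config N), Ψ (fun i => x (σ i)) = Ψ x
  periodic : ∀ (i : Fin N) (k : Fin 2) (x : Config N),
    Ψ (x + Pi.single i (L • unitVec k)) = Ψ x
  weakDeriv : ∀ i k, HasWeakDeriv Ψ (G i k) (Pi.single i (unitVec k))
  memLp : MemLp Ψ 2 (volume.restrict (box N L))
  memLp_grad : ∀ i k, MemLp (G i k) 2 (volume.restrict (box N L))

/-- The squared norm `⟨Ψ, Ψ⟩` on the box. -/
def normSq (N : ℕ) (L : ℝ) (Ψ : Config N → ℂ) : ℝ≥0∞ :=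
  ∫⁻ x in box N L, ‖Ψ x‖ₑ ^ 2

/-- The quadratic form `⟨Ψ, H Ψ⟩` of the Hamiltonian
`H = -μ ∑ᵢ Δᵢ + ∑_{i<j} v(|xᵢ - xⱼ|)`, with the periodic extension of `v`. -/
def energyForm (μ : ℝ) (v : ℝ → ℝ≥0∞) (N : ℕ) (L : ℝ) (Ψ : Config N → ℂ)
    (G : Fin N → Fin 2 → Config N → ℂ) : ℝ≥0∞ :=
  ∫⁻ x in box N L,
    (ENNReal.ofReal μ * ∑ i, ∑ k, ‖G i k x‖ₑ ^ 2
      + (∑ i, ∑ j ∈ Finset.Ioi i, periodicPotential v L (x i - x j)) * ‖Ψ x‖ₑ ^ 2)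

/-- The ground state energy `E₀(N, L)`: the infimum of `⟨Ψ, H Ψ⟩ / ⟨Ψ, Ψ⟩` over all nonzero
symmetric wave functions with periodic boundary conditions. -/
def groundStateEnergy (μ : ℝ) (v : ℝ → ℝ≥0∞) (N : ℕ) (L : ℝ) : ℝ≥0∞ :=
  sInf {e | ∃ (Ψ : Config N → ℂ) (G : Fin N → Fin 2 → Config N → ℂ),
    IsPeriodicBoseFunction N L Ψ G ∧ normSq N L Ψ ≠ 0 ∧
      e = energyForm μ v N L Ψ G / normSq N L Ψ}

end BoseGas

end

noncomputable section

namespace BoseGas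

open Set Filter Topology

/-! The trial state is the product of `F (x i - x j)` over all pairs. Here `F` is a two-body
zero-energy profile in the distance to the nearest periodic image, normalised to equal 1 beyond a
cutoff radius b. If such a profile has two-body energy 2πμ/ℓ with ℓ ≈ ln (b/a), the N(N-1)/2 pairs
contribute about 2πμρ/ℓ per particle. For b = ρ^(-1/2) one has ln (b/a) = |ln (ρa²)|/2, and this is
the leading term 4πμρ/|ln (ρa²)|. The remaining effects are relatively of order 1/ℓ: the loss of
norm caused by the correlations (I = ∫ (1 - F²) ≤ 4πb²/ℓ, hence ρI ≤ 4π/ℓ) and the three-body cross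
terms of the gradient (K = ∫ F|∇F| ≤ 2πb/ℓ, hence (ρK)² ≤ 4π²ρ/ℓ²).

The profile: in the variable t = log r a radial function has energy 2πμ ∫ (U'² + w U²) dt with w =
e^(2t) v/(2μ), and the definition of a says that the optimal value up to log R is 1/ln (R/a).
Averaging a scattering trial function over circles does not increase its energy
(`angularMean_energy_le`), and a small modification makes the average nondecreasing and zero near
the origin (`exists_slope_of_primitive`). The resulting one-dimensional problem has a minimizer g
(`exists_minimizing_slope`). Rescaling g' on the two sides of a point gives the Euler–Lagrange
identity `euler_lagrange`, and this identity shows that g is Lipschitz with the energy as constant.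
Therefore g can be truncated at any radius b, even inside the range of v, with Lipschitz constant
and energy at most 1/ℓ for ℓ = ln (b/a) - 1 (`exists_scatteringProfile_of_scatteringLength`). No
relation between b, the range of v and L is used, and this makes the error universal.

The many-body estimate: removing one particle changes the squared norm by a factor between 1 and
1/t, with t = 1 - NI/L² (`mul_weightIntegral_le_insert`). In each term of the energy one or two
particles are removed from the weight; their coordinates are then integrated freely, and the
particles are put back at a cost of 1/t each (`groundStateEnergy_div_le`). -/

/-! ### The radial variational problem in logarithmic coordinates -/

/-- `h` is the derivative of a nondecreasing profile on `[t₀, T]` rising from `0` to `1`. -/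
structure IsSlope (t₀ T : ℝ) (h : ℝ → ℝ) : Prop where
  le : t₀ ≤ T
  meas : Measurable h
  nonneg : ∀ t, 0 ≤ h t
  integrable : IntervalIntegrable h volume t₀ T
  integral_eq : ∫ s in t₀..T, h s = 1

/-- The profile with slope `h` starting from `0` at `t₀`. -/
def profile (t₀ : ℝ) (h : ℝ → ℝ) (t : ℝ) : ℝ := ∫ s in t₀..t, h s

/-- The energy of a slope for the radial weight `w`. -/
def profileEnergy (w : ℝ → ℝ≥0∞) (t₀ T : ℝ) (h : ℝ → ℝ) : ℝ≥0∞ :=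
  ∫⁻ t in Ioc t₀ T, (ENNReal.ofReal (h t ^ 2) + w t * ENNReal.ofReal (profile t₀ h t ^ 2))

namespace IsSlope

variable {t₀ T : ℝ} {h : ℝ → ℝ} {w : ℝ → ℝ≥0∞}

lemma intervalIntegrable (H : IsSlope t₀ T h) {s t : ℝ} (hs : s ∈ Icc t₀ T) (ht : t ∈ Icc t₀ T) :
    IntervalIntegrable h volume s t := by
  refine H.integrable.mono_set ?_
  rw [uIcc_of_le H.le]
  exact uIcc_subset_Icc hs ht

lemma profile_sub (H : IsSlope t₀ T h) {s t : ℝ} (hs : s ∈ Icc t₀ T) (ht : t ∈ Icc t₀ T) :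
    profile t₀ h t - profile t₀ h s = ∫ r in s..t, h r := by
  have h0 : t₀ ∈ Icc t₀ T := left_mem_Icc.2 H.le
  exact intervalIntegral.integral_interval_sub_left (H.intervalIntegrable h0 ht)
    (H.intervalIntegrable h0 hs)

lemma profile_mono (H : IsSlope t₀ T h) {s t : ℝ} (hs : s ∈ Icc t₀ T) (ht : t ∈ Icc t₀ T)
    (hst : s ≤ t) : profile t₀ h s ≤ profile t₀ h t := by
  have := H.profile_sub hs ht
  have h2 : 0 ≤ ∫ r in s..t, h r := intervalIntegral.integral_nonneg hst fun u _ => H.nonneg u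
  linarith

lemma profile_left : profile t₀ h t₀ = 0 := by simp [profile]

lemma profile_right (H : IsSlope t₀ T h) : profile t₀ h T = 1 := H.integral_eq

lemma profile_nonneg (H : IsSlope t₀ T h) {t : ℝ} (ht : t ∈ Icc t₀ T) : 0 ≤ profile t₀ h t := by
  simpa [profile_left] using H.profile_mono (left_mem_Icc.2 H.le) ht ht.1

lemma profile_le_one (H : IsSlope t₀ T h) {t : ℝ} (ht : t ∈ Icc t₀ T) : profile t₀ h t ≤ 1 := by
  simpa [H.profile_right] using H.profile_mono ht (right_mem_Icc.2 H.le) ht.2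

lemma profile_continuousOn (H : IsSlope t₀ T h) : ContinuousOn (profile t₀ h) (Icc t₀ T) := by
  have := intervalIntegral.continuousOn_primitive_interval (f := h) (μ := volume) (a := t₀) (b := T)
    ((intervalIntegrable_iff' (by simp)).1 H.integrable)
  rwa [uIcc_of_le H.le] at this

lemma profile_aemeasurable (H : IsSlope t₀ T h) {s t : ℝ} (hs : t₀ ≤ s) (ht : t ≤ T) :
    AEMeasurable (profile t₀ h) (volume.restrict (Ioc s t)) :=
  ((H.profile_continuousOn.mono (Ioc_subset_Icc_self.trans (Icc_subset_Icc hs ht))).aemeasurable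
    measurableSet_Ioc)

end IsSlope

lemma setLIntegral_Ioc_split {s t u : ℝ} (hst : s ≤ t) (htu : t ≤ u) (F : ℝ → ℝ≥0∞) :
    ∫⁻ x in Ioc s u, F x = (∫⁻ x in Ioc s t, F x) + ∫⁻ x in Ioc t u, F x := by
  rw [← Ioc_union_Ioc_eq_Ioc hst htu, lintegral_union measurableSet_Ioc]
  exact Ioc_disjoint_Ioc_of_le le_rfl

/-- A quadratic polynomial with a local minimum at the origin has vanishing linear part. -/
lemma linear_part_eq_zero_of_quadratic_nonneg {p q ε : ℝ} (hε : 0 < ε)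
    (H : ∀ x, |x| < ε → 0 ≤ p * x ^ 2 + q * x) : q = 0 := by
  by_contra hq
  have hp : 0 < |p| + 1 := by positivity
  have hq' : 0 < |q| := abs_pos.2 hq
  set y := min (ε / 2) (|q| / (2 * (|p| + 1))) with hy
  have hy0 : 0 < y := by positivity
  have hy1 : y < ε := (min_le_left _ _).trans_lt (by linarith)
  have hy2 : y * (|p| + 1) ≤ |q| / 2 := by
    have : y ≤ |q| / (2 * (|p| + 1)) := min_le_right _ _
    calc y * (|p| + 1) ≤ |q| / (2 * (|p| + 1)) * (|p| + 1) := by gcongr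
      _ = |q| / 2 := by field_simp
  have key : p * y < |q| := by nlinarith [le_abs_self p]
  rcases lt_or_gt_of_ne hq with h | h
  · have := H y (by rwa [abs_of_pos hy0])
    rw [abs_of_neg h] at key
    nlinarith
  · have := H (-y) (by rwa [abs_neg, abs_of_pos hy0])
    rw [abs_of_pos h] at key
    nlinarith

namespace IsSlope

variable {t₀ T : ℝ} {h : ℝ → ℝ} {w : ℝ → ℝ≥0∞}

/-- Rescaling a slope by `β` to the left of `t₁` and by `α` to its right. -/
lemma rescale (H : IsSlope t₀ T h) {t₁ α β : ℝ} (ht₁ : t₁ ∈ Icc t₀ T) (hα : 0 ≤ α) (hβ : 0 ≤ β)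
    (hαβ : β * profile t₀ h t₁ = 1 - α * (1 - profile t₀ h t₁)) :
    IsSlope t₀ T (fun t => if t ≤ t₁ then β * h t else α * h t) ∧
    (∀ t ∈ Icc t₀ t₁, profile t₀ (fun t => if t ≤ t₁ then β * h t else α * h t) t
      = β * profile t₀ h t) ∧
    (∀ t ∈ Icc t₁ T, profile t₀ (fun t => if t ≤ t₁ then β * h t else α * h t) t
      = 1 - α * (1 - profile t₀ h t)) := by
  set k : ℝ → ℝ := fun t => if t ≤ t₁ then β * h t else α * h t with hk
  have h0 : t₀ ∈ Icc t₀ T := left_mem_Icc.2 H.le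
  have hm : Measurable k :=
    Measurable.ite measurableSet_Iic (H.meas.const_mul β) (H.meas.const_mul α)
  have eL : ∀ t ∈ Icc t₀ t₁, EqOn (fun s => β * h s) k (uIoc t₀ t) := by
    intro t ht s hs
    rw [uIoc_of_le ht.1] at hs
    simp [hk, hs.2.trans ht.2]
  have eR : ∀ t ∈ Icc t₁ T, EqOn (fun s => α * h s) k (uIoc t₁ t) := by
    intro t ht s hs
    rw [uIoc_of_le ht.1] at hs
    simp [hk, not_le.2 hs.1]
  have iL : ∀ t ∈ Icc t₀ t₁, IntervalIntegrable k volume t₀ t := fun t ht =>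
    ((H.intervalIntegrable h0 ⟨ht.1, ht.2.trans ht₁.2⟩).const_mul β).congr (eL t ht)
  have iR : ∀ t ∈ Icc t₁ T, IntervalIntegrable k volume t₁ t := fun t ht =>
    ((H.intervalIntegrable ht₁ ⟨ht₁.1.trans ht.1, ht.2⟩).const_mul α).congr (eR t ht)
  have pL : ∀ t ∈ Icc t₀ t₁, profile t₀ k t = β * profile t₀ h t := by
    intro t ht
    rw [profile, profile, ← intervalIntegral.integral_const_mul]
    exact (intervalIntegral.integral_congr_ae (Eventually.of_forall (eL t ht))).symm
  have pR : ∀ t ∈ Icc t₁ T, profile t₀ k t = 1 - α * (1 - profile t₀ h t) := by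
    intro t ht
    have e1 : profile t₀ k t = profile t₀ k t₁ + ∫ s in t₁..t, k s :=
      (intervalIntegral.integral_add_adjacent_intervals (iL t₁ ⟨ht₁.1, le_rfl⟩) (iR t ht)).symm
    have e2 : ∫ s in t₁..t, k s = α * ∫ s in t₁..t, h s := by
      rw [← intervalIntegral.integral_const_mul]
      exact (intervalIntegral.integral_congr_ae (Eventually.of_forall (eR t ht))).symm
    rw [e1, e2, pL t₁ ⟨ht₁.1, le_rfl⟩, hαβ, ← H.profile_sub ht₁ ⟨ht₁.1.trans ht.1, ht.2⟩]
    ring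
  refine ⟨⟨H.le, hm, fun t => ?_, (iL t₁ ⟨ht₁.1, le_rfl⟩).trans (iR T ⟨ht₁.2, le_rfl⟩), ?_⟩, pL, pR⟩
  · simp only [hk]
    split_ifs
    · exact mul_nonneg hβ (H.nonneg t)
    · exact mul_nonneg hα (H.nonneg t)
  · have := pR T ⟨ht₁.2, le_rfl⟩
    rw [H.profile_right] at this
    simpa [profile] using this

/-- The Euler–Lagrange identity for a minimizing slope, in integrated form. -/
lemma euler_lagrange (H : IsSlope t₀ T h) (hw : Measurable w) (hfin : profileEnergy w t₀ T h ≠ ⊤)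
    (hmin : ∀ k, IsSlope t₀ T k → profileEnergy w t₀ T h ≤ profileEnergy w t₀ T k)
    {t₁ : ℝ} (ht₁ : t₁ ∈ Icc t₀ T) (hc : 0 < profile t₀ h t₁) :
    (∫⁻ t in Ioc t₀ t₁, (ENNReal.ofReal (h t ^ 2) + w t * ENNReal.ofReal (profile t₀ h t ^ 2)))
      + ENNReal.ofReal (profile t₀ h t₁) * ∫⁻ t in Ioc t₁ T, w t * ENNReal.ofReal (profile t₀ h t)
      = ENNReal.ofReal (profile t₀ h t₁) * profileEnergy w t₀ T h := by
  set g := profile t₀ h with hg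
  set c := g t₁ with hcdef
  set ν := volume.restrict (Ioc t₁ T) with hν
  have hsplit := setLIntegral_Ioc_split ht₁.1 ht₁.2
    (fun t => ENNReal.ofReal (h t ^ 2) + w t * ENNReal.ofReal (g t ^ 2))
  set X := ∫⁻ t in Ioc t₀ t₁, (ENNReal.ofReal (h t ^ 2) + w t * ENNReal.ofReal (g t ^ 2)) with hX
  have hh2 : Measurable fun t => ENNReal.ofReal (h t ^ 2) := (H.meas.pow_const 2).ennreal_ofReal
  have hsplit2 : ∫⁻ t in Ioc t₁ T, (ENNReal.ofReal (h t ^ 2) + w t * ENNReal.ofReal (g t ^ 2))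
      = (∫⁻ t, ENNReal.ofReal (h t ^ 2) ∂ν) + ∫⁻ t, w t * ENNReal.ofReal (g t ^ 2) ∂ν :=
    lintegral_add_left hh2 _
  set A := ∫⁻ t, ENNReal.ofReal (h t ^ 2) ∂ν with hA
  have hE : profileEnergy w t₀ T h = X + (A + ∫⁻ t, w t * ENNReal.ofReal (g t ^ 2) ∂ν) := by
    rw [← hsplit2]; exact hsplit
  have hgm : AEMeasurable g ν := H.profile_aemeasurable ht₁.1 le_rfl
  have hgc : ∀ᵐ t ∂ν, c ≤ g t ∧ g t ≤ 1 := by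
    refine (ae_restrict_mem measurableSet_Ioc).mono fun t ht => ?_
    have htI : t ∈ Icc t₀ T := ⟨ht₁.1.trans ht.1.le, ht.2⟩
    exact ⟨H.profile_mono ht₁ htI ht.1.le, H.profile_le_one htI⟩
  have hW2 : ∫⁻ t, w t * ENNReal.ofReal (g t ^ 2) ∂ν ≠ ⊤ := by
    intro hcon; rw [hE, hcon] at hfin; simp at hfin
  have hXf : X ≠ ⊤ := by intro hcon; rw [hE, hcon] at hfin; simp at hfin
  have hAf : A ≠ ⊤ := by intro hcon; rw [hE, hcon] at hfin; simp at hfin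
  -- Since g ≥ c > 0 to the right of t₁, finite energy makes w integrable there, and real-valued
  -- integrals become available. To the left of t₁ the weight may be infinite, but there the
  -- competitor only multiplies g by a constant, so X can stay an extended number until its
  -- finiteness is used.
  have hW0 : ∫⁻ t, w t ∂ν ≠ ⊤ := by
    have : ENNReal.ofReal (c ^ 2) * ∫⁻ t, w t ∂ν ≤ ∫⁻ t, w t * ENNReal.ofReal (g t ^ 2) ∂ν := by
      rw [← lintegral_const_mul _ hw]
      refine lintegral_mono_ae (hgc.mono fun t ht => ?_)
      rw [mul_comm]
      gcongr
      exact ht.1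
    intro hcon
    rw [hcon, ENNReal.mul_top (ENNReal.ofReal_pos.2 (by positivity)).ne'] at this
    exact hW2 (top_le_iff.1 this)
  have hwfin : ∀ᵐ t ∂ν, w t < ⊤ := ae_lt_top hw hW0
  set r : ℝ → ℝ := fun t => (w t).toReal with hr
  have hri : Integrable r ν := integrable_toReal_of_lintegral_ne_top hw.aemeasurable hW0
  have hgi : Integrable (fun t => r t * g t) ν := by
    refine hri.mul_bdd (c := 1) hgm.aestronglyMeasurable (hgc.mono fun t ht => ?_)
    rw [Real.norm_eq_abs, abs_of_nonneg (hc.le.trans ht.1)]; exact ht.2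
  have hg2i : Integrable (fun t => r t * g t ^ 2) ν := by
    refine hri.mul_bdd (c := 1) (hgm.pow_const 2).aestronglyMeasurable (hgc.mono fun t ht => ?_)
    rw [Real.norm_eq_abs, abs_of_nonneg (sq_nonneg _)]
    have := hc.le.trans ht.1
    nlinarith [ht.2]
  -- conversion of weighted lower integrals into Bochner integrals
  have conv : ∀ q : ℝ → ℝ, (∀ᵐ t ∂ν, 0 ≤ q t) → Integrable (fun t => r t * q t) ν →
      ∫⁻ t, w t * ENNReal.ofReal (q t) ∂ν = ENNReal.ofReal (∫ t, r t * q t ∂ν) := by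
    intro q hq hqi
    rw [ofReal_integral_eq_lintegral_ofReal hqi]
    · refine lintegral_congr_ae ?_
      filter_upwards [hwfin] with t ht
      rw [ENNReal.ofReal_mul ENNReal.toReal_nonneg, ENNReal.ofReal_toReal ht.ne]
    · filter_upwards [hq] with t ht
      exact mul_nonneg ENNReal.toReal_nonneg ht
  set W0 := ∫ t, r t ∂ν with hW0d
  set W1 := ∫ t, r t * g t ∂ν with hW1d
  set W2 := ∫ t, r t * g t ^ 2 ∂ν with hW2d
  have eW2 : ∫⁻ t, w t * ENNReal.ofReal (g t ^ 2) ∂ν = ENNReal.ofReal W2 :=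
    conv (fun t => g t ^ 2) (Eventually.of_forall fun t => sq_nonneg _) hg2i
  have eW1 : ∫⁻ t, w t * ENNReal.ofReal (g t) ∂ν = ENNReal.ofReal W1 :=
    conv g (hgc.mono fun t ht => hc.le.trans ht.1) hgi
  have hW1n : 0 ≤ W1 := integral_nonneg_of_ae (hgc.mono fun t ht =>
    mul_nonneg ENNReal.toReal_nonneg (hc.le.trans ht.1))
  have hW2n : 0 ≤ W2 := integral_nonneg fun t => mul_nonneg ENNReal.toReal_nonneg (sq_nonneg _)
  -- the quadratic inequality
  have quad : ∀ x : ℝ, |x| < min c 1 → 0 ≤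
      (((1 - c) / c) ^ 2 * X.toReal + A.toReal + W0 - 2 * W1 + W2) * x ^ 2
        + (2 * (A.toReal + W2 - W1 - (1 - c) / c * X.toReal)) * x := by
    intro x hx
    have hx1 := abs_lt.1 (hx.trans_le (min_le_left _ _))
    have hx2 := abs_lt.1 (hx.trans_le (min_le_right _ _))
    have hc1 : c ≤ 1 := H.profile_le_one ht₁
    -- The variation x is the relative change of slope to the right of t₁; β is then forced by the
    -- total rise, βc + (1 + x)(1 - c) = 1. The bound |x| < min c 1 keeps both factors nonnegative,
    -- so that the competitor is still a slope.
    obtain ⟨β, hβ⟩ : ∃ β, β = 1 - (1 - c) / c * x := ⟨_, rfl⟩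
    have hβc : β * c = 1 - (1 + x) * (1 - c) := by rw [hβ]; field_simp; ring
    have hβn : 0 ≤ β := by
      have : 0 ≤ β * c := by rw [hβc]; nlinarith
      exact nonneg_of_mul_nonneg_left this hc
    obtain ⟨K, KL, KR⟩ := H.rescale ht₁ (by linarith : (0 : ℝ) ≤ 1 + x) hβn hβc
    have hle := hmin _ K
    set k : ℝ → ℝ := fun t => if t ≤ t₁ then β * h t else (1 + x) * h t with hk
    have hkE : profileEnergy w t₀ T k = ENNReal.ofReal (β ^ 2) * X
        + (ENNReal.ofReal ((1 + x) ^ 2) * A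
          + ENNReal.ofReal (∫ t, r t * (1 - (1 + x) * (1 - g t)) ^ 2 ∂ν)) := by
      rw [profileEnergy, setLIntegral_Ioc_split ht₁.1 ht₁.2]
      congr 1
      · rw [hX, ← lintegral_const_mul' _ _ ENNReal.ofReal_ne_top]
        refine setLIntegral_congr_fun measurableSet_Ioc fun t ht => ?_
        rw [KL t ⟨ht.1.le, ht.2⟩]
        simp only [hk, ht.2, if_true, mul_pow]
        rw [ENNReal.ofReal_mul (sq_nonneg _), ENNReal.ofReal_mul (sq_nonneg _)]
        ring
      · rw [lintegral_add_left' (((K.meas.pow_const 2).ennreal_ofReal).aemeasurable)]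
        congr 1
        · rw [hA, hν, ← lintegral_const_mul' _ _ ENNReal.ofReal_ne_top]
          refine setLIntegral_congr_fun measurableSet_Ioc fun t ht => ?_
          simp only [hk, not_le.2 ht.1, if_false, mul_pow]
          rw [ENNReal.ofReal_mul (sq_nonneg _)]
        · rw [← conv _ (Eventually.of_forall fun t => sq_nonneg _)]
          · refine setLIntegral_congr_fun measurableSet_Ioc fun t ht => ?_
            rw [KR t ⟨ht.1.le, ht.2⟩]
          · have : (fun t => r t * (1 - (1 + x) * (1 - g t)) ^ 2) = fun t =>
                x ^ 2 * r t + (-2 * x * (1 + x)) * (r t * g t) + (1 + x) ^ 2 * (r t * g t ^ 2) := by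
              funext t; ring
            rw [this]
            exact ((hri.const_mul _).add (hgi.const_mul _)).add (hg2i.const_mul _)
    have hInt : ∫ t, r t * (1 - (1 + x) * (1 - g t)) ^ 2 ∂ν
        = x ^ 2 * W0 + (-2 * x * (1 + x)) * W1 + (1 + x) ^ 2 * W2 := by
      have : (fun t => r t * (1 - (1 + x) * (1 - g t)) ^ 2) = fun t =>
          x ^ 2 * r t + (-2 * x * (1 + x)) * (r t * g t) + (1 + x) ^ 2 * (r t * g t ^ 2) := by
        funext t; ring
      have i12 : Integrable (fun t => x ^ 2 * r t + (-2 * x * (1 + x)) * (r t * g t)) ν :=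
        (hri.const_mul _).add (hgi.const_mul _)
      rw [this, integral_add i12 (hg2i.const_mul _),
        integral_add (hri.const_mul _) (hgi.const_mul _), integral_const_mul, integral_const_mul,
        integral_const_mul]
    have hIntn : 0 ≤ ∫ t, r t * (1 - (1 + x) * (1 - g t)) ^ 2 ∂ν :=
      integral_nonneg fun t => mul_nonneg ENNReal.toReal_nonneg (sq_nonneg _)
    rw [hkE, hE, eW2] at hle
    rw [← ENNReal.ofReal_toReal hXf, ← ENNReal.ofReal_toReal hAf,
      ← ENNReal.ofReal_mul (sq_nonneg _), ← ENNReal.ofReal_mul (sq_nonneg _),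
      ← ENNReal.ofReal_add ENNReal.toReal_nonneg hW2n,
      ← ENNReal.ofReal_add ENNReal.toReal_nonneg (by positivity),
      ← ENNReal.ofReal_add (by positivity) hIntn,
      ← ENNReal.ofReal_add (by positivity) (by positivity),
      ENNReal.ofReal_le_ofReal_iff (by positivity), hInt, hβ] at hle
    linear_combination hle
  -- The linear coefficient is the first variation. Its vanishing, multiplied by c, is X + c W1 = c
  -- (X + A + W2), and the last bracket is the energy.
  have hlin := linear_part_eq_zero_of_quadratic_nonneg (by positivity) quad
  have hfinal : X.toReal + c * W1 = c * (X.toReal + (A.toReal + W2)) := by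
    have : A.toReal + W2 - W1 = (1 - c) / c * X.toReal := by linarith
    have h3 : c * ((1 - c) / c * X.toReal) = (1 - c) * X.toReal := by field_simp
    linear_combination -c * this - h3
  rw [hE, eW2, eW1, ← ENNReal.ofReal_toReal hXf, ← ENNReal.ofReal_toReal hAf,
    ← ENNReal.ofReal_add ENNReal.toReal_nonneg hW2n,
    ← ENNReal.ofReal_add ENNReal.toReal_nonneg (by positivity),
    ← ENNReal.ofReal_mul hc.le, ← ENNReal.ofReal_mul hc.le,
    ← ENNReal.ofReal_add ENNReal.toReal_nonneg (by positivity), hfinal]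

end IsSlope

namespace IsSlope

variable {t₀ T : ℝ} {h k : ℝ → ℝ} {w : ℝ → ℝ≥0∞}

lemma lintegral_eq (H : IsSlope t₀ T h) {s t : ℝ} (hs : s ∈ Icc t₀ T) (ht : t ∈ Icc t₀ T)
    (hst : s ≤ t) :
    ∫⁻ r in Ioc s t, ENNReal.ofReal (h r) = ENNReal.ofReal (profile t₀ h t - profile t₀ h s) := by
  rw [H.profile_sub hs ht, intervalIntegral.integral_of_le hst,
    ofReal_integral_eq_lintegral_ofReal]
  · exact (intervalIntegrable_iff_integrableOn_Ioc_of_le hst).1 (H.intervalIntegrable hs ht)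
  · exact Eventually.of_forall H.nonneg

/-- AM–GM, from (a - e)² ≥ 0. The weights are such that, once the integral of h² is bounded by e
times the rise, exactly half of the rise is absorbed. -/
lemma ofReal_le_of_sq {a e : ℝ} (he : 0 < e) :
    ENNReal.ofReal a ≤ ENNReal.ofReal (1 / (2 * e)) * ENNReal.ofReal (a ^ 2)
      + ENNReal.ofReal (e / 2) := by
  rw [← ENNReal.ofReal_mul (by positivity), ← ENNReal.ofReal_add (by positivity) (by positivity)]
  apply ENNReal.ofReal_le_ofReal
  have : 1 / (2 * e) * a ^ 2 + e / 2 - a = (a - e) ^ 2 / (2 * e) := by field_simp; ring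
  have h2 : 0 ≤ (a - e) ^ 2 / (2 * e) := by positivity
  linarith

/-- The profile of a minimizing slope has increments bounded by the energy, away from its zeros. -/
lemma profile_sub_le_of_pos (H : IsSlope t₀ T h) (hw : Measurable w) {e : ℝ} (he : 0 < e)
    (hE : profileEnergy w t₀ T h ≤ ENNReal.ofReal e)
    (hmin : ∀ k, IsSlope t₀ T k → profileEnergy w t₀ T h ≤ profileEnergy w t₀ T k)
    {t₁ t₂ : ℝ} (ht₁ : t₁ ∈ Icc t₀ T) (ht₂ : t₂ ∈ Icc t₀ T) (h12 : t₁ ≤ t₂)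
    (hc : 0 < profile t₀ h t₁) :
    profile t₀ h t₂ - profile t₀ h t₁ ≤ e * (t₂ - t₁) := by
  have hfin : profileEnergy w t₀ T h ≠ ⊤ := (hE.trans_lt ENNReal.ofReal_lt_top).ne
  have hmono := H.profile_mono ht₁ ht₂ h12
  have E1 := H.euler_lagrange hw hfin hmin ht₁ hc
  have E2 := H.euler_lagrange hw hfin hmin ht₂ (hc.trans_le hmono)
  rw [setLIntegral_Ioc_split h12 ht₂.2] at E1
  rw [setLIntegral_Ioc_split ht₁.1 h12, lintegral_add_left ((H.meas.pow_const 2).ennreal_ofReal)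
    (fun t => w t * ENNReal.ofReal (profile t₀ h t ^ 2)) (μ := volume.restrict (Ioc t₁ t₂))] at E2
  set g := profile t₀ h
  set E := profileEnergy w t₀ T h
  set X := ∫⁻ t in Ioc t₀ t₁, (ENNReal.ofReal (h t ^ 2) + w t * ENNReal.ofReal (g t ^ 2))
  set A := ∫⁻ t in Ioc t₁ t₂, ENNReal.ofReal (h t ^ 2)
  set V := ∫⁻ t in Ioc t₁ t₂, w t * ENNReal.ofReal (g t)
  set W := ∫⁻ t in Ioc t₂ T, w t * ENNReal.ofReal (g t)
  have hV : ENNReal.ofReal (g t₁) * V ≤ ∫⁻ t in Ioc t₁ t₂, w t * ENNReal.ofReal (g t ^ 2) := by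
    rw [← lintegral_const_mul' _ _ ENNReal.ofReal_ne_top]
    refine lintegral_mono_ae ((ae_restrict_mem measurableSet_Ioc).mono fun t ht => ?_)
    have htI : t ∈ Icc t₀ T := ⟨ht₁.1.trans ht.1.le, ht.2.trans ht₂.2⟩
    have hgt := H.profile_mono ht₁ htI ht.1.le
    rw [mul_left_comm, pow_two, ENNReal.ofReal_mul (H.profile_nonneg htI)]
    gcongr
  -- Comparing the Euler–Lagrange identities at t₁ and t₂: the potential terms on (t₁, t₂] have a
  -- favourable sign because g ≥ g(t₁) there, and what remains is ∫ h² ≤ (g(t₂) - g(t₁)) E.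
  have key : A + ENNReal.ofReal (g t₁) * E ≤ ENNReal.ofReal (g t₂) * E := by
    rw [← E1, ← E2]
    calc A + (X + ENNReal.ofReal (g t₁) * (V + W))
        = X + (A + ENNReal.ofReal (g t₁) * V) + ENNReal.ofReal (g t₁) * W := by ring
      _ ≤ _ := by gcongr
  have hA : A ≤ ENNReal.ofReal (g t₂ - g t₁) * ENNReal.ofReal e := by
    have h3 : ENNReal.ofReal (g t₂) = ENNReal.ofReal (g t₁) + ENNReal.ofReal (g t₂ - g t₁) := by
      rw [← ENNReal.ofReal_add hc.le (by linarith)]; congr 1; ring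
    rw [h3, add_mul, add_comm] at key
    have h4 : A ≤ ENNReal.ofReal (g t₂ - g t₁) * E :=
      (ENNReal.add_le_add_iff_left (ENNReal.mul_ne_top ENNReal.ofReal_ne_top hfin)).1 key
    exact h4.trans (by gcongr)
  have h5 : ENNReal.ofReal (g t₂ - g t₁) ≤ ENNReal.ofReal (1 / (2 * e)) * A
      + ENNReal.ofReal (e / 2) * ENNReal.ofReal (t₂ - t₁) := by
    rw [← H.lintegral_eq ht₁ ht₂ h12, ← lintegral_const_mul' _ _ ENNReal.ofReal_ne_top,
      ← Real.volume_Ioc, ← setLIntegral_const, ← lintegral_add_right _ measurable_const]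
    exact lintegral_mono fun t => ofReal_le_of_sq he
  have h6 := h5.trans (add_le_add_left (mul_le_mul_right hA _) _)
  rw [← ENNReal.ofReal_mul (by linarith), ← ENNReal.ofReal_mul (by positivity),
    ← ENNReal.ofReal_mul (by positivity), ← ENNReal.ofReal_add
      (mul_nonneg (by positivity) (mul_nonneg (by linarith) he.le))
      (mul_nonneg (by positivity) (by linarith)), ENNReal.ofReal_le_ofReal_iff
      (add_nonneg (mul_nonneg (by positivity) (mul_nonneg (by linarith) he.le))
      (mul_nonneg (by positivity) (by linarith)))] at h6
  have h7 : 1 / (2 * e) * ((g t₂ - g t₁) * e) = (g t₂ - g t₁) / 2 := by field_simp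
  linarith

/-- The profile of a minimizing slope is Lipschitz, with the energy as constant. -/
lemma profile_sub_le (H : IsSlope t₀ T h) (hw : Measurable w) {e : ℝ} (he : 0 < e)
    (hE : profileEnergy w t₀ T h ≤ ENNReal.ofReal e)
    (hmin : ∀ k, IsSlope t₀ T k → profileEnergy w t₀ T h ≤ profileEnergy w t₀ T k)
    {t₁ t₂ : ℝ} (ht₁ : t₁ ∈ Icc t₀ T) (ht₂ : t₂ ∈ Icc t₀ T) (h12 : t₁ ≤ t₂) :
    profile t₀ h t₂ - profile t₀ h t₁ ≤ e * (t₂ - t₁) := by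
  rcases (H.profile_nonneg ht₁).lt_or_eq with hc | hc
  · exact H.profile_sub_le_of_pos hw he hE hmin ht₁ ht₂ h12 hc
  rw [← hc, sub_zero]
  -- The Euler–Lagrange identity needs a positive value at the left end. The estimate is therefore
  -- started at a point where the profile equals ε, and ε tends to 0.
  refine le_of_forall_pos_le_add fun ε hε => ?_
  rcases le_or_gt (profile t₀ h t₂) ε with h1 | h1
  · have : 0 ≤ e * (t₂ - t₁) := mul_nonneg he.le (by linarith)
    linarith
  obtain ⟨s, hs, hsε⟩ := intermediate_value_Icc h12
    (H.profile_continuousOn.mono (Icc_subset_Icc ht₁.1 ht₂.2)) ⟨hc ▸ hε.le, h1.le⟩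
  have := H.profile_sub_le_of_pos hw he hE hmin (t₁ := s) ⟨ht₁.1.trans hs.1, hs.2.trans ht₂.2⟩ ht₂
    hs.2 (by rw [hsε]; exact hε)
  rw [hsε] at this
  nlinarith [hs.1]

/-- Energy bound for the truncation of a minimizing profile. -/
lemma truncated_energy_le (H : IsSlope t₀ T h) (hw : Measurable w)
    (hfin : profileEnergy w t₀ T h ≠ ⊤)
    (hmin : ∀ k, IsSlope t₀ T k → profileEnergy w t₀ T h ≤ profileEnergy w t₀ T k)
    {t₁ : ℝ} (ht₁ : t₁ ∈ Icc t₀ T) (hc : 0 < profile t₀ h t₁) :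
    (∫⁻ t in Ioc t₀ t₁, (ENNReal.ofReal (h t ^ 2) + w t * ENNReal.ofReal (profile t₀ h t ^ 2)))
      + ENNReal.ofReal (profile t₀ h t₁ ^ 2) * ∫⁻ t in Ioc t₁ T, w t
      ≤ ENNReal.ofReal (profile t₀ h t₁) * profileEnergy w t₀ T h := by
  -- To the right of t₁ the identity carries c·w·g, and g ≥ c there, so lowering g to c leaves the
  -- energy of the profile capped at height c.
  rw [← H.euler_lagrange hw hfin hmin ht₁ hc, pow_two, ENNReal.ofReal_mul hc.le, mul_assoc]
  gcongr
  rw [← lintegral_const_mul' _ _ ENNReal.ofReal_ne_top]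
  refine lintegral_mono_ae ((ae_restrict_mem measurableSet_Ioc).mono fun t ht => ?_)
  rw [mul_comm]
  gcongr
  exact H.profile_mono ht₁ ⟨ht₁.1.trans ht.1.le, ht.2⟩ ht.1.le

/-! ### Existence of a minimizer by the direct method -/

lemma midpoint (H : IsSlope t₀ T h) (K : IsSlope t₀ T k) :
    IsSlope t₀ T (fun t => (h t + k t) / 2) ∧
    ∀ t ∈ Icc t₀ T, profile t₀ (fun t => (h t + k t) / 2) t
      = (profile t₀ h t + profile t₀ k t) / 2 := by
  have h0 : t₀ ∈ Icc t₀ T := left_mem_Icc.2 H.le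
  have hp : ∀ t ∈ Icc t₀ T, profile t₀ (fun t => (h t + k t) / 2) t
      = (profile t₀ h t + profile t₀ k t) / 2 := fun t ht => by
    simp only [profile]
    rw [intervalIntegral.integral_div, intervalIntegral.integral_add
      (H.intervalIntegrable h0 ht) (K.intervalIntegrable h0 ht)]
  refine ⟨⟨H.le, (H.meas.add K.meas).div_const 2, fun t => ?_,
    (H.integrable.add K.integrable).div_const 2, ?_⟩, hp⟩
  · have := H.nonneg t; have := K.nonneg t; positivity
  · have := hp T (right_mem_Icc.2 H.le)
    rw [H.profile_right, K.profile_right] at this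
    simpa [profile] using this

lemma energy_aemeasurable (H : IsSlope t₀ T h) (hw : Measurable w) :
    AEMeasurable (fun t => ENNReal.ofReal (h t ^ 2) + w t * ENNReal.ofReal (profile t₀ h t ^ 2))
      (volume.restrict (Ioc t₀ T)) :=
  (H.meas.pow_const 2).ennreal_ofReal.aemeasurable.add
    (hw.aemeasurable.mul ((H.profile_aemeasurable le_rfl le_rfl).pow_const 2).ennreal_ofReal)

/-- Parallelogram identity for the slopes, convexity of the square for the weighted term. The
surplus on the left is what makes a minimizing sequence Cauchy in L². -/
lemma energy_midpoint_add_le (H : IsSlope t₀ T h) (K : IsSlope t₀ T k) (hw : Measurable w) :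
    2 * profileEnergy w t₀ T (fun t => (h t + k t) / 2)
      + 2 * ∫⁻ t in Ioc t₀ T, ENNReal.ofReal (((h t - k t) / 2) ^ 2)
      ≤ profileEnergy w t₀ T h + profileEnergy w t₀ T k := by
  have hd : Measurable fun t => ENNReal.ofReal (((h t - k t) / 2) ^ 2) :=
    (((H.meas.sub K.meas).div_const 2).pow_const 2).ennreal_ofReal
  rw [← mul_add, profileEnergy, ← lintegral_add_right _ hd,
    ← lintegral_const_mul' _ _ (by norm_num), profileEnergy, profileEnergy,
    ← lintegral_add_left' (H.energy_aemeasurable hw)]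
  refine lintegral_mono_ae ((ae_restrict_mem measurableSet_Ioc).mono fun t ht => ?_)
  have htI : t ∈ Icc t₀ T := ⟨ht.1.le, ht.2⟩
  rw [(H.midpoint K).2 t htI]
  set a := profile t₀ h t
  set b := profile t₀ k t
  have e1 : 2 * (ENNReal.ofReal (((h t + k t) / 2) ^ 2) + ENNReal.ofReal (((h t - k t) / 2) ^ 2))
      = ENNReal.ofReal (h t ^ 2) + ENNReal.ofReal (k t ^ 2) := by
    rw [← ENNReal.ofReal_add (sq_nonneg _) (sq_nonneg _),
      ← ENNReal.ofReal_add (sq_nonneg _) (sq_nonneg _),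
      show (2 : ℝ≥0∞) = ENNReal.ofReal 2 by simp, ← ENNReal.ofReal_mul (by norm_num)]
    congr 1; ring
  have e2 : 2 * ENNReal.ofReal (((a + b) / 2) ^ 2)
      ≤ ENNReal.ofReal (a ^ 2) + ENNReal.ofReal (b ^ 2) := by
    rw [← ENNReal.ofReal_add (sq_nonneg _) (sq_nonneg _),
      show (2 : ℝ≥0∞) = ENNReal.ofReal 2 by simp, ← ENNReal.ofReal_mul (by norm_num)]
    apply ENNReal.ofReal_le_ofReal
    nlinarith [sq_nonneg (a - b)]
  calc 2 * (ENNReal.ofReal (((h t + k t) / 2) ^ 2) + w t * ENNReal.ofReal (((a + b) / 2) ^ 2)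
        + ENNReal.ofReal (((h t - k t) / 2) ^ 2))
      = 2 * (ENNReal.ofReal (((h t + k t) / 2) ^ 2) + ENNReal.ofReal (((h t - k t) / 2) ^ 2))
        + w t * (2 * ENNReal.ofReal (((a + b) / 2) ^ 2)) := by ring
    _ ≤ (ENNReal.ofReal (h t ^ 2) + ENNReal.ofReal (k t ^ 2))
        + w t * (ENNReal.ofReal (a ^ 2) + ENNReal.ofReal (b ^ 2)) := by rw [e1]; gcongr
    _ = _ := by ring

lemma memLp_of_energy_ne_top (H : IsSlope t₀ T h) (hfin : profileEnergy w t₀ T h ≠ ⊤) :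
    MemLp h 2 (volume.restrict (Ioc t₀ T)) := by
  rw [memLp_two_iff_integrable_sq H.meas.aestronglyMeasurable]
  refine ⟨(H.meas.pow_const 2).aestronglyMeasurable, ?_⟩
  rw [hasFiniteIntegral_iff_ofReal (Eventually.of_forall fun t => sq_nonneg _)]
  refine lt_of_le_of_lt ?_ hfin.lt_top
  exact lintegral_mono fun t => le_self_add

end IsSlope

lemma eLpNorm_two_sq {α : Type*} [MeasurableSpace α] {ν : Measure α} (f : α → ℝ) :
    eLpNorm f 2 ν ^ 2 = ∫⁻ t, ENNReal.ofReal (f t ^ 2) ∂ν := by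
  have := eLpNorm_nnreal_pow_eq_lintegral (f := f) (μ := ν) (p := 2) (by norm_num)
  simp only [NNReal.coe_ofNat, ENNReal.coe_ofNat] at this
  rw [← ENNReal.rpow_two, this]
  refine lintegral_congr fun t => ?_
  rw [ENNReal.rpow_two, Real.enorm_eq_ofReal_abs, ← ENNReal.ofReal_pow (abs_nonneg _), sq_abs]

/-- The coefficient is a value of the weight and may be infinite. Multiplication is then
discontinuous at (∞, 0), but for y₀ = 0 the product in the limit is 0 and lower semicontinuity
survives. -/
lemma add_mul_le_liminf {x y : ℕ → ℝ≥0∞} {x₀ y₀ a : ℝ≥0∞} (hx : Tendsto x atTop (𝓝 x₀))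
    (hy : Tendsto y atTop (𝓝 y₀)) : x₀ + a * y₀ ≤ liminf (fun i => x i + a * y i) atTop := by
  rcases eq_or_ne y₀ 0 with h0 | h0
  · rw [h0, mul_zero, add_zero, ← hx.liminf_eq]
    exact liminf_le_liminf (Eventually.of_forall fun i => le_self_add)
  · exact ((hx.add (ENNReal.Tendsto.const_mul hy (Or.inl h0))).liminf_eq).ge

/-- The radial variational problem has a minimizer. -/
lemma exists_minimizing_slope {t₀ T : ℝ} {w : ℝ → ℝ≥0∞} (hw : Measurable w)
    (hex : ∃ k, IsSlope t₀ T k ∧ profileEnergy w t₀ T k ≠ ⊤) :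
    ∃ h, IsSlope t₀ T h ∧
      ∀ k, IsSlope t₀ T k → profileEnergy w t₀ T h ≤ profileEnergy w t₀ T k := by
  obtain ⟨k₀, K₀, hk₀⟩ := hex
  set S : Set ℝ≥0∞ := {e | ∃ k, IsSlope t₀ T k ∧ e = profileEnergy w t₀ T k} with hS
  set e := sInf S with he
  have hle : ∀ k, IsSlope t₀ T k → e ≤ profileEnergy w t₀ T k := fun k K => sInf_le ⟨k, K, rfl⟩
  have hefin : e ≠ ⊤ := ne_top_of_le_ne_top hk₀ (hle k₀ K₀)
  have hseq : ∀ n : ℕ, ∃ k, IsSlope t₀ T k ∧ profileEnergy w t₀ T k ≤ e + ((n : ℝ≥0∞) + 1)⁻¹ := by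
    intro n
    have : e < e + ((n : ℝ≥0∞) + 1)⁻¹ :=
      ENNReal.lt_add_right hefin (ENNReal.inv_ne_zero.2 (by simp))
    obtain ⟨_, ⟨k, K, rfl⟩, hk⟩ := sInf_lt_iff.1 this
    exact ⟨k, K, hk.le⟩
  choose k K hkE using hseq
  set ν := volume.restrict (Ioc t₀ T) with hν
  have hkfin : ∀ n, profileEnergy w t₀ T (k n) ≠ ⊤ := fun n =>
    ne_top_of_le_ne_top (by simp [hefin]) (hkE n)
  have hkL : ∀ n, MemLp (k n) 2 ν := fun n => (K n).memLp_of_energy_ne_top (hkfin n)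
  -- the minimizing sequence is Cauchy
  have hdiff : ∀ n m : ℕ, eLpNorm (k n - k m) 2 ν ^ 2
      ≤ 2 * (((n : ℝ≥0∞) + 1)⁻¹ + ((m : ℝ≥0∞) + 1)⁻¹) := by
    intro n m
    have h1 := (K n).energy_midpoint_add_le (K m) hw
    have h2 := hle _ ((K n).midpoint (K m)).1
    set D := ∫⁻ t in Ioc t₀ T, ENNReal.ofReal (((k n t - k m t) / 2) ^ 2) with hD
    have h3 : eLpNorm (k n - k m) 2 ν ^ 2 = 4 * D := by
      rw [eLpNorm_two_sq, hD, ← lintegral_const_mul' _ _ (by norm_num)]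
      refine lintegral_congr fun t => ?_
      rw [show (4 : ℝ≥0∞) = ENNReal.ofReal 4 by simp, ← ENNReal.ofReal_mul (by norm_num)]
      congr 1
      simp only [Pi.sub_apply]
      ring
    have h4 : 2 * e + 2 * D ≤ 2 * e + (((n : ℝ≥0∞) + 1)⁻¹ + ((m : ℝ≥0∞) + 1)⁻¹) := by
      calc 2 * e + 2 * D ≤ _ := by gcongr
        _ ≤ _ := h1
        _ ≤ _ := add_le_add (hkE n) (hkE m)
        _ = _ := by ring
    have h5 := (ENNReal.add_le_add_iff_left (ENNReal.mul_ne_top (by norm_num) hefin)).1 h4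
    calc eLpNorm (k n - k m) 2 ν ^ 2 = 2 * (2 * D) := by rw [h3]; ring
      _ ≤ _ := by gcongr
  have hinv : Tendsto (fun n : ℕ => ((n : ℝ≥0∞) + 1)⁻¹) atTop (𝓝 0) := by
    have := (tendsto_add_atTop_iff_nat 1).2 ENNReal.tendsto_inv_nat_nhds_zero
    simpa using this
  have hC : CauchySeq fun n => (hkL n).toLp (k n) := by
    rw [Lp.cauchySeq_Lp_iff_cauchySeq_eLpNorm]
    have hb : Tendsto (fun p : ℕ × ℕ =>
        (2 * (((p.1 : ℝ≥0∞) + 1)⁻¹ + ((p.2 : ℝ≥0∞) + 1)⁻¹)) ^ (1 / 2 : ℝ)) atTop (𝓝 0) := by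
      have h1 : Tendsto (fun p : ℕ × ℕ =>
          2 * (((p.1 : ℝ≥0∞) + 1)⁻¹ + ((p.2 : ℝ≥0∞) + 1)⁻¹)) atTop (𝓝 (2 * (0 + 0))) := by
        refine ENNReal.Tendsto.const_mul (Tendsto.add ?_ ?_) (Or.inr (by norm_num))
        · exact hinv.comp (by rw [← prod_atTop_atTop_eq]; exact tendsto_fst)
        · exact hinv.comp (by rw [← prod_atTop_atTop_eq]; exact tendsto_snd)
      have h2 := h1.ennrpow_const (1 / 2 : ℝ)
      simpa using h2
    refine tendsto_of_tendsto_of_tendsto_of_le_of_le tendsto_const_nhds hb (fun _ => zero_le) ?_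
    intro p
    have h1 : eLpNorm (⇑((hkL p.1).toLp (k p.1)) - ⇑((hkL p.2).toLp (k p.2))) 2 ν
        = eLpNorm (k p.1 - k p.2) 2 ν :=
      eLpNorm_congr_ae ((hkL p.1).coeFn_toLp.sub (hkL p.2).coeFn_toLp)
    refine h1.trans_le ?_
    have h2 := ENNReal.rpow_le_rpow (hdiff p.1 p.2) (by norm_num : (0 : ℝ) ≤ 1 / 2)
    rwa [← ENNReal.rpow_natCast, ← ENNReal.rpow_mul, show ((2 : ℕ) : ℝ) * (1 / 2) = 1 by norm_num,
      ENNReal.rpow_one] at h2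
  obtain ⟨F, hF⟩ := cauchySeq_tendsto_of_complete hC
  rw [Lp.tendsto_Lp_iff_tendsto_eLpNorm'] at hF
  have hF' : Tendsto (fun n => eLpNorm (k n - ⇑F) 2 ν) atTop (𝓝 0) := by
    refine hF.congr fun n => eLpNorm_congr_ae ((hkL n).coeFn_toLp.sub (ae_eq_refl _))
  -- the limit, made nonnegative
  set h : ℝ → ℝ := fun t => max (F t) 0 with hh
  have hhm : Measurable h := (Lp.stronglyMeasurable F).measurable.max measurable_const
  have hlim : Tendsto (fun n => eLpNorm (k n - h) 2 ν) atTop (𝓝 0) := by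
    refine tendsto_of_tendsto_of_tendsto_of_le_of_le tendsto_const_nhds hF' (fun _ => zero_le) ?_
    intro n
    refine eLpNorm_mono fun t => ?_
    simp only [Pi.sub_apply, hh, Real.norm_eq_abs]
    have hk := (K n).nonneg t
    rcases le_total (F t) 0 with h0 | h0
    · rw [max_eq_right h0, abs_of_nonneg (by linarith), abs_of_nonneg (by linarith)]; linarith
    · rw [max_eq_left h0]
  have hhL : MemLp h 2 ν := (Lp.memLp F).pos_part
  have hhi : Integrable h ν := hhL.integrable (by norm_num)
  have hki : ∀ n, Integrable (k n) ν := fun n => (hkL n).integrable (by norm_num)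
  -- On a bounded interval L² convergence implies L¹ convergence; this gives pointwise convergence
  -- of the profiles and preserves the constraint that the total rise is 1.
  have hlim1 : Tendsto (fun n => eLpNorm (k n - h) 1 ν) atTop (𝓝 0) := by
    have h1 : ∀ n, eLpNorm (k n - h) 1 ν ≤ eLpNorm (k n - h) 2 ν * ν univ ^ (1 / 2 : ℝ) := by
      intro n
      have := eLpNorm_le_eLpNorm_mul_rpow_measure_univ (μ := ν) (p := 1) (q := 2) (by norm_num)
        ((hki n).sub hhi).aestronglyMeasurable
      convert this using 3
      norm_num
    have h2 : Tendsto (fun n => eLpNorm (k n - h) 2 ν * ν univ ^ (1 / 2 : ℝ)) atTop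
        (𝓝 (0 * ν univ ^ (1 / 2 : ℝ))) :=
      ENNReal.Tendsto.mul_const hlim (Or.inr (ENNReal.rpow_ne_top_of_nonneg (by norm_num)
        (measure_ne_top _ _)))
    rw [zero_mul] at h2
    exact tendsto_of_tendsto_of_tendsto_of_le_of_le tendsto_const_nhds h2 (fun _ => zero_le) h1
  have hprof : ∀ t ∈ Icc t₀ T, Tendsto (fun n => profile t₀ (k n) t) atTop (𝓝 (profile t₀ h t)) := by
    intro t ht
    have := tendsto_setIntegral_of_L1' h hhi.aestronglyMeasurable (Eventually.of_forall hki) hlim1 (Ioc t₀ t)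
    simp only [profile, intervalIntegral.integral_of_le ht.1]
    rwa [hν, Measure.restrict_restrict measurableSet_Ioc,
      inter_eq_left.2 (Ioc_subset_Ioc_right ht.2)] at this
  have H : IsSlope t₀ T h := by
    refine ⟨K₀.le, hhm, fun t => le_max_right _ _,
      (intervalIntegrable_iff_integrableOn_Ioc_of_le K₀.le).2 hhi, ?_⟩
    refine tendsto_nhds_unique (hprof T (right_mem_Icc.2 K₀.le)) ?_
    simp only [(K _).profile_right]
    exact tendsto_const_nhds
  refine ⟨h, H, fun q Q => le_trans ?_ (hle q Q)⟩
  obtain ⟨ns, hns, hae⟩ := (tendstoInMeasure_of_tendsto_eLpNorm (by norm_num)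
    (fun n => (K n).meas.aestronglyMeasurable) hhm.aestronglyMeasurable hlim).exists_seq_tendsto_ae
  -- Fatou's lemma along a subsequence whose slopes converge almost everywhere.
  have hE : profileEnergy w t₀ T h ≤ liminf (fun i => profileEnergy w t₀ T (k (ns i))) atTop := by
    refine le_trans (lintegral_mono_ae ?_)
      (lintegral_liminf_le' fun i => (K (ns i)).energy_aemeasurable hw)
    filter_upwards [hae, ae_restrict_mem measurableSet_Ioc] with t h1 ht
    have h2 := (hprof t ⟨ht.1.le, ht.2⟩).comp hns.tendsto_atTop
    exact add_mul_le_liminf ((ENNReal.continuous_ofReal.tendsto _).comp (h1.pow 2))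
      ((ENNReal.continuous_ofReal.tendsto _).comp (h2.pow 2))
  refine hE.trans ?_
  have hub : Tendsto (fun i => e + ((ns i : ℝ≥0∞) + 1)⁻¹) atTop (𝓝 (e + 0)) :=
    tendsto_const_nhds.add (hinv.comp hns.tendsto_atTop)
  rw [add_zero] at hub
  rw [← hub.liminf_eq]
  exact liminf_le_liminf (Eventually.of_forall fun i => hkE (ns i))

/-! ### Truncating and extending the minimizer -/

/-- A monotone profile in the logarithmic variable, reaching `1` at `t₁`, with Lipschitz constant
and energy at most `1 / ℓ`. -/
structure IsScatteringProfile (w : ℝ → ℝ≥0∞) (t₁ ℓ : ℝ) (U : ℝ → ℝ) : Prop where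
  mono : Monotone U
  nonneg : ∀ t, 0 ≤ U t
  le_one : ∀ t, U t ≤ 1
  exists_eq_zero : ∃ t₀, ∀ t ≤ t₀, U t = 0
  eq_one : ∀ t, t₁ ≤ t → U t = 1
  sub_le : ∀ s t, s ≤ t → U t - U s ≤ (t - s) / ℓ
  energy_le : ∫⁻ t, (ENNReal.ofReal (deriv U t ^ 2) + w t * ENNReal.ofReal (U t ^ 2))
    ≤ ENNReal.ofReal (1 / ℓ)

/-- The minimizer g is cut at height c = g(t₁) and divided by c. The Lipschitz bound between t₁ and
T gives c ≥ 1 - e(T - t₁) = eℓ. The capped profile costs at most c·e by `truncated_energy_le`, hence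
e/c ≤ 1/ℓ after division by c², and the same quotient bounds the Lipschitz constant. The point t₁
may lie inside the support of w: the part of w beyond t₁, where U = 1, is included in the cost. -/
lemma exists_scatteringProfile {t₀ T t₁ e ℓ : ℝ} {w : ℝ → ℝ≥0∞} {k : ℝ → ℝ} (hw : Measurable w)
    (hwT : ∀ t, T < t → w t = 0) (he : 0 < e) (K : IsSlope t₀ T k)
    (hkE : profileEnergy w t₀ T k ≤ ENNReal.ofReal e) (ht₁T : t₁ ≤ T) (hℓ : 0 < ℓ)
    (hℓe : ℓ = 1 / e - (T - t₁)) : ∃ U, IsScatteringProfile w t₁ ℓ U := by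
  obtain ⟨h, H, hmin⟩ := exists_minimizing_slope hw
    ⟨k, K, (hkE.trans_lt ENNReal.ofReal_lt_top).ne⟩
  have hE : profileEnergy w t₀ T h ≤ ENNReal.ofReal e := (hmin k K).trans hkE
  have hfin : profileEnergy w t₀ T h ≠ ⊤ := (hE.trans_lt ENNReal.ofReal_lt_top).ne
  have hlip : ∀ {s t : ℝ}, s ∈ Icc t₀ T → t ∈ Icc t₀ T → s ≤ t →
      profile t₀ h t - profile t₀ h s ≤ e * (t - s) :=
    fun hs ht hst => H.profile_sub_le hw he hE hmin hs ht hst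
  set g := profile t₀ h with hg
  have heℓ : e * ℓ = 1 - e * (T - t₁) := by rw [hℓe]; field_simp
  have hg0 : g t₀ = 0 := IsSlope.profile_left
  -- The whole rise 1 is at most e(T - t₀), while e(T - t₁) = 1 - eℓ < 1.
  have ht₀₁ : t₀ ≤ t₁ := by
    have h1 := hlip (left_mem_Icc.2 H.le) (right_mem_Icc.2 H.le) H.le
    rw [hg0, hg, H.profile_right] at h1
    by_contra hcon
    nlinarith [mul_pos he hℓ]
  have ht₁ : t₁ ∈ Icc t₀ T := ⟨ht₀₁, ht₁T⟩
  set c := g t₁ with hc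
  have hceℓ : e * ℓ ≤ c := by
    have h1 := hlip ht₁ (right_mem_Icc.2 H.le) ht₁T
    rw [hg, H.profile_right] at h1
    rw [heℓ]; linarith
  have hc0 : 0 < c := (mul_pos he hℓ).trans_le hceℓ
  have hec : e / c ≤ 1 / ℓ := by
    rw [div_le_div_iff₀ hc0 hℓ]; linarith
  set p : ℝ → ℝ := fun t => max t₀ (min t t₁) with hp
  have hpI : ∀ t, p t ∈ Icc t₀ T := fun t =>
    ⟨le_max_left _ _, max_le H.le ((min_le_right _ _).trans ht₁T)⟩
  have hpmono : Monotone p := fun s t hst => max_le_max le_rfl (min_le_min hst le_rfl)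
  have hplip : ∀ s t, s ≤ t → p t - p s ≤ t - s := by
    intro s t hst
    simp only [hp]
    rcases le_total t t₁ with h1 | h1 <;> rcases le_total s t₁ with h2 | h2 <;>
    simp only [h1, h2, min_eq_left, min_eq_right] <;>
    rcases max_cases t₀ t with h3 | h3 <;> rcases max_cases t₀ s with h4 | h4 <;>
    rcases max_cases t₀ t₁ with h5 | h5 <;> linarith
  have pL : ∀ t, t ≤ t₀ → p t = t₀ := fun t ht => by
    simp only [hp]; rw [min_eq_left (ht.trans ht₀₁), max_eq_left ht]
  have pM : ∀ t ∈ Icc t₀ t₁, p t = t := fun t ht => by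
    simp only [hp]; rw [min_eq_left ht.2, max_eq_right ht.1]
  have pR : ∀ t, t₁ ≤ t → p t = t₁ := fun t ht => by
    simp only [hp]; rw [min_eq_right ht, max_eq_right ht₀₁]
  set U : ℝ → ℝ := fun t => g (p t) / c with hU
  have UL : ∀ t, t ≤ t₀ → U t = 0 := fun t ht => by simp only [hU, pL t ht, hg0, zero_div]
  have UM : ∀ t ∈ Icc t₀ t₁, U t = g t / c := fun t ht => by simp only [hU, pM t ht]
  have UR : ∀ t, t₁ ≤ t → U t = 1 := fun t ht => by
    simp only [hU, pR t ht]; exact div_self hc0.ne'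
  have Umono : Monotone U := fun s t hst =>
    div_le_div_of_nonneg_right (H.profile_mono (hpI s) (hpI t) (hpmono hst)) hc0.le
  refine ⟨U, Umono, fun t => div_nonneg (H.profile_nonneg (hpI t)) hc0.le, fun t => ?_,
    ⟨t₀, UL⟩, UR, fun s t hst => ?_, ?_⟩
  · rw [← UR (max t t₁) (le_max_right _ _)]; exact Umono (le_max_left _ _)
  · have h1 := hlip (hpI s) (hpI t) (hpmono hst)
    have h2 : e * (p t - p s) ≤ e * (t - s) := mul_le_mul_of_nonneg_left (hplip s t hst) he.le
    calc U t - U s = (g (p t) - g (p s)) / c := by simp only [hU]; ring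
      _ ≤ e * (t - s) / c := by gcongr; linarith
      _ = e / c * (t - s) := by ring
      _ ≤ 1 / ℓ * (t - s) := mul_le_mul_of_nonneg_right hec (by linarith)
      _ = _ := by ring
  -- the energy
  have hae : ∀ᵐ t, ENNReal.ofReal (deriv U t ^ 2) + w t * ENNReal.ofReal (U t ^ 2)
      ≤ (Ioc t₀ t₁).indicator (fun t => ENNReal.ofReal (1 / c ^ 2) *
          (ENNReal.ofReal (h t ^ 2) + w t * ENNReal.ofReal (g t ^ 2))) t
        + (Ioc t₁ T).indicator w t := by
    have hne0 : ∀ᵐ t : ℝ, t ≠ t₀ := by simp [ae_iff]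
    have hne1 : ∀ᵐ t : ℝ, t ≠ t₁ := by simp [ae_iff]
    filter_upwards [H.integrable.ae_hasDerivAt_integral, hne0, hne1] with t hder h0 h1
    rcases lt_or_gt_of_ne h0 with h0 | h0
    · have hd : deriv U t = 0 := by
        have : U =ᶠ[𝓝 t] fun _ => 0 := by
          filter_upwards [Iio_mem_nhds h0] with s hs using UL s (le_of_lt hs)
        rw [this.deriv_eq]; simp
      simp [hd, UL t h0.le]
    rcases lt_or_gt_of_ne h1 with h1 | h1
    · have hd : deriv U t = h t / c := by
        have : U =ᶠ[𝓝 t] fun s => g s / c := by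
          filter_upwards [Ioo_mem_nhds h0 h1] with s hs using UM s ⟨hs.1.le, hs.2.le⟩
        rw [this.deriv_eq]
        have := hder (by rw [uIcc_of_le H.le]; exact ⟨h0.le, h1.le.trans ht₁T⟩) t₀ (by simp)
        exact (this.div_const c).deriv
      rw [indicator_of_mem (by exact ⟨h0, h1.le⟩), hd, UM t ⟨h0.le, h1.le⟩]
      refine le_trans (le_of_eq ?_) le_self_add
      rw [div_pow, div_pow, div_eq_mul_one_div (h t ^ 2), div_eq_mul_one_div (g t ^ 2),
        ENNReal.ofReal_mul (sq_nonneg _), ENNReal.ofReal_mul (sq_nonneg _)]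
      ring
    · have hd : deriv U t = 0 := by
        have : U =ᶠ[𝓝 t] fun _ => 1 := by
          filter_upwards [Ioi_mem_nhds h1] with s hs using UR s (le_of_lt hs)
        rw [this.deriv_eq]; simp
      rw [hd, UR t h1.le]
      refine le_trans ?_ le_add_self
      simp only [ne_eq, OfNat.ofNat_ne_zero, not_false_eq_true, zero_pow, ENNReal.ofReal_zero,
        one_pow, ENNReal.ofReal_one, mul_one, zero_add]
      rcases le_or_gt t T with h2 | h2
      · rw [indicator_of_mem (by exact ⟨h1, h2⟩)]
      · simp [hwT t h2]
  refine (lintegral_mono_ae hae).trans ?_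
  rw [lintegral_add_right _ (hw.indicator measurableSet_Ioc), lintegral_indicator measurableSet_Ioc,
    lintegral_indicator measurableSet_Ioc, lintegral_const_mul' _ _ ENNReal.ofReal_ne_top]
  have htr := H.truncated_energy_le hw hfin hmin ht₁ hc0
  have h1 : ENNReal.ofReal (1 / c ^ 2) * ENNReal.ofReal (c ^ 2) = 1 := by
    rw [← ENNReal.ofReal_mul (by positivity), one_div_mul_cancel (by positivity), ENNReal.ofReal_one]
  calc _ = ENNReal.ofReal (1 / c ^ 2) * ((∫⁻ t in Ioc t₀ t₁, (ENNReal.ofReal (h t ^ 2)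
          + w t * ENNReal.ofReal (g t ^ 2))) + ENNReal.ofReal (c ^ 2) * ∫⁻ t in Ioc t₁ T, w t) := by
        rw [mul_add, ← mul_assoc, h1, one_mul]
    _ ≤ ENNReal.ofReal (1 / c ^ 2) * (ENNReal.ofReal c * ENNReal.ofReal e) := by
        gcongr; exact htr.trans (by gcongr)
    _ = ENNReal.ofReal (e / c) := by
        rw [← ENNReal.ofReal_mul hc0.le, ← ENNReal.ofReal_mul (by positivity)]
        congr 1; field_simp
    _ ≤ _ := ENNReal.ofReal_le_ofReal hec

/-- Extension of a slope by a constant beyond the range of the weight. -/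
lemma exists_extended_slope {t₀ T T' q : ℝ} {w : ℝ → ℝ≥0∞} {k : ℝ → ℝ} (K : IsSlope t₀ T k)
    (hwT : ∀ t, T < t → w t = 0) (hq : 0 < q) (hTT' : T ≤ T')
    (hkE : profileEnergy w t₀ T k ≤ ENNReal.ofReal (1 / q)) :
    ∃ h, IsSlope t₀ T' h ∧ profileEnergy w t₀ T' h ≤ ENNReal.ofReal (1 / (q + (T' - T))) := by
  set M := T' - T with hM
  have hM0 : 0 ≤ M := by rw [hM]; linarith
  have hqM : 0 < q + M := by linarith
  -- Reciprocal energies add like resistances in series: q for the old interval and M for the new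
  -- one. The rise is shared in the ratio q : M, and β²/q + M/(q + M)² = 1/(q + M).
  obtain ⟨β, hβ⟩ : ∃ β, β = q / (q + M) := ⟨_, rfl⟩
  have hβ0 : 0 ≤ β := by rw [hβ]; positivity
  set h : ℝ → ℝ := fun t => if t ≤ T then β * k t else 1 / (q + M) with hh
  have eL : ∀ t ∈ Icc t₀ T, EqOn (fun s => β * k s) h (uIoc t₀ t) := by
    intro t ht s hs
    rw [uIoc_of_le ht.1] at hs
    simp [hh, hs.2.trans ht.2]
  have eR : EqOn (fun s => 1 / (q + M)) h (uIoc T T') := by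
    intro s hs
    rw [uIoc_of_le hTT'] at hs
    simp [hh, not_le.2 hs.1]
  have h0 : t₀ ∈ Icc t₀ T := left_mem_Icc.2 K.le
  have iL : IntervalIntegrable h volume t₀ T :=
    (K.integrable.const_mul β).congr (eL T (right_mem_Icc.2 K.le))
  have iR : IntervalIntegrable h volume T T' := intervalIntegrable_const.congr eR
  have pL : ∀ t ∈ Icc t₀ T, profile t₀ h t = β * profile t₀ k t := by
    intro t ht
    rw [profile, profile, ← intervalIntegral.integral_const_mul]
    exact (intervalIntegral.integral_congr_ae (Eventually.of_forall (eL t ht))).symm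
  have hI : ∫ s in t₀..T', h s = 1 := by
    rw [← intervalIntegral.integral_add_adjacent_intervals iL iR,
      ← intervalIntegral.integral_congr_ae (Eventually.of_forall eR),
      intervalIntegral.integral_const]
    have := pL T (right_mem_Icc.2 K.le)
    rw [profile, K.profile_right] at this
    rw [this, hβ, smul_eq_mul, ← hM]
    field_simp
  refine ⟨h, ⟨K.le.trans hTT', Measurable.ite measurableSet_Iic (K.meas.const_mul β)
    measurable_const, fun t => ?_, iL.trans iR, hI⟩, ?_⟩
  · simp only [hh]
    split_ifs
    · exact mul_nonneg hβ0 (K.nonneg t)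
    · positivity
  · rw [profileEnergy, setLIntegral_Ioc_split K.le hTT']
    have e1 : ∫⁻ t in Ioc t₀ T, (ENNReal.ofReal (h t ^ 2) + w t * ENNReal.ofReal (profile t₀ h t ^ 2))
        = ENNReal.ofReal (β ^ 2) * profileEnergy w t₀ T k := by
      rw [profileEnergy, ← lintegral_const_mul' _ _ ENNReal.ofReal_ne_top]
      refine setLIntegral_congr_fun measurableSet_Ioc fun t ht => ?_
      rw [pL t ⟨ht.1.le, ht.2⟩]
      simp only [hh, ht.2, if_true, mul_pow]
      rw [ENNReal.ofReal_mul (sq_nonneg _), ENNReal.ofReal_mul (sq_nonneg _)]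
      ring
    have e2 : ∫⁻ t in Ioc T T', (ENNReal.ofReal (h t ^ 2) + w t * ENNReal.ofReal (profile t₀ h t ^ 2))
        = ENNReal.ofReal ((1 / (q + M)) ^ 2) * ENNReal.ofReal M := by
      rw [hM, ← Real.volume_Ioc, ← setLIntegral_const]
      refine setLIntegral_congr_fun measurableSet_Ioc fun t ht => ?_
      simp only [hh, not_le.2 ht.1, if_false, hwT t ht.1, zero_mul, add_zero, ← hM]
    rw [e1, e2]
    calc _ ≤ ENNReal.ofReal (β ^ 2) * ENNReal.ofReal (1 / q)
          + ENNReal.ofReal ((1 / (q + M)) ^ 2) * ENNReal.ofReal M := by gcongr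
      _ = ENNReal.ofReal (1 / (q + M)) := by
        rw [← ENNReal.ofReal_mul (by positivity), ← ENNReal.ofReal_mul (by positivity),
          ← ENNReal.ofReal_add (by positivity) (by positivity), hβ]
        congr 1
        field_simp

/-- The constant slope on an interval where the weight vanishes. -/
lemma exists_constant_slope {T T' : ℝ} {w : ℝ → ℝ≥0∞} (hwT : ∀ t, T < t → w t = 0) (hTT' : T < T') :
    ∃ h, IsSlope T T' h ∧ profileEnergy w T T' h ≤ ENNReal.ofReal (1 / (T' - T)) := by
  have hM : 0 < T' - T := by linarith
  refine ⟨fun _ => 1 / (T' - T), ⟨hTT'.le, measurable_const, fun _ => by positivity,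
    intervalIntegrable_const, ?_⟩, ?_⟩
  · rw [intervalIntegral.integral_const, smul_eq_mul]; field_simp
  · have : ∀ t ∈ Ioc T T', ENNReal.ofReal ((1 / (T' - T)) ^ 2)
        + w t * ENNReal.ofReal (profile T (fun _ => 1 / (T' - T)) t ^ 2)
        = ENNReal.ofReal ((1 / (T' - T)) ^ 2) := fun t ht => by simp [hwT t ht.1]
    rw [profileEnergy, setLIntegral_congr_fun measurableSet_Ioc this, setLIntegral_const,
      Real.volume_Ioc, ← ENNReal.ofReal_mul (by positivity)]
    apply ENNReal.ofReal_le_ofReal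
    apply le_of_eq
    field_simp

/-! ### Weak derivatives on the line -/

lemma exists_support_subset_Ioc {χ : ℝ → ℝ} (hχ : HasCompactSupport χ) :
    ∃ M > 0, ∀ t, M ≤ |t| → χ t = 0 := by
  obtain ⟨M, hM⟩ := hχ.isCompact.isBounded.subset_closedBall 0
  refine ⟨|M| + 1, by positivity, fun t ht => ?_⟩
  by_contra hne
  have := hM (subset_tsupport _ hne)
  rw [Metric.mem_closedBall, dist_zero_right, Real.norm_eq_abs] at this
  linarith [le_abs_self M]

lemma integral_eq_intervalIntegral_of_eq_zero {F : ℝ → ℝ} {M : ℝ}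
    (hF : ∀ t, M ≤ |t| → F t = 0) : ∫ t, F t = ∫ t in (-M)..M, F t := by
  symm
  refine intervalIntegral.integral_eq_integral_of_support_subset fun t ht => ?_
  have : |t| < M := by
    by_contra hcon
    exact ht (hF t (not_lt.1 hcon))
  exact ⟨(abs_lt.1 this).1, (abs_lt.1 this).2.le⟩

lemma deriv_eq_zero_of_le_abs {χ : ℝ → ℝ} {M : ℝ} (hχ : ∀ t, M ≤ |t| → χ t = 0) :
    ∀ t, M + 1 ≤ |t| → deriv χ t = 0 := by
  intro t ht
  have : χ =ᶠ[𝓝 t] fun _ => 0 := by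
    have h1 : {s : ℝ | M < |s|} ∈ 𝓝 t :=
      (isOpen_lt continuous_const continuous_abs).mem_nhds (by simp only [mem_ofPred_eq]; linarith)
    filter_upwards [h1] with s hs using hχ s (le_of_lt hs)
  rw [this.deriv_eq]; simp

lemma integral_deriv_mul_primitive {g χ : ℝ → ℝ} (hg : LocallyIntegrable g)
    (hχ : ContDiff ℝ ∞ χ) (hχc : HasCompactSupport χ) :
    ∫ s, deriv χ s * ∫ r in (0 : ℝ)..s, g r = -∫ s, χ s * g s := by
  obtain ⟨M, hM, hχM⟩ := exists_support_subset_Ioc hχc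
  have hgi : ∀ a b : ℝ, IntervalIntegrable g volume a b := fun a b =>
    (hg.integrableOn_isCompact isCompact_uIcc).intervalIntegrable
  have hM1 : 0 < M + 1 := by linarith
  -- The interval is enlarged from M to M + 1 because χ is only known to vanish for |t| ≥ M, and its
  -- derivative is shown to vanish one unit further out. The rest is integration by parts for
  -- absolutely continuous functions, without boundary terms.
  rw [integral_eq_intervalIntegral_of_eq_zero (F := fun s => deriv χ s * ∫ r in (0 : ℝ)..s, g r) (M := M + 1)
      (fun t ht => by simp [deriv_eq_zero_of_le_abs hχM t ht]),
    integral_eq_intervalIntegral_of_eq_zero (F := fun s => χ s * g s) (M := M + 1)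
      (fun t ht => by simp [hχM t (by linarith)])]
  have hac1 : AbsolutelyContinuousOnInterval χ (-(M + 1)) (M + 1) :=
    (hχ.of_le (by exact_mod_cast le_top)).contDiffOn.absolutelyContinuousOnInterval
  have hac2 : AbsolutelyContinuousOnInterval (fun s => ∫ r in (0 : ℝ)..s, g r) (-(M + 1)) (M + 1) :=
    (hgi _ _).absolutelyContinuousOnInterval_intervalIntegral
      (by rw [uIcc_of_le (by linarith)]; constructor <;> linarith)
  have hparts := hac1.integral_mul_deriv_eq_deriv_mul hac2
  rw [hχM (M + 1) (by rw [abs_of_pos hM1]; linarith),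
    hχM (-(M + 1)) (by rw [abs_neg, abs_of_pos hM1]; linarith)] at hparts
  have hd : ∫ s in (-(M + 1))..(M + 1), χ s * deriv (fun s => ∫ r in (0 : ℝ)..s, g r) s
      = ∫ s in (-(M + 1))..(M + 1), χ s * g s := by
    refine intervalIntegral.integral_congr_ae ?_
    filter_upwards [_root_.LocallyIntegrable.ae_hasDerivAt_integral hg] with s hs _
    rw [(hs 0).deriv]
  rw [hd] at hparts
  linarith

/-- A function on the line all of whose derivatives against test functions vanish is constant. -/
lemma ae_eq_const_of_integral_deriv_eq_zero {F : ℝ → ℝ} (hF : LocallyIntegrable F)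
    (H : ∀ χ : ℝ → ℝ, ContDiff ℝ ∞ χ → HasCompactSupport χ → ∫ s, deriv χ s * F s = 0) :
    ∃ C, ∀ᵐ s, F s = C := by
  let b : ContDiffBump (0 : ℝ) := ⟨1, 2, by norm_num, by norm_num⟩
  set ψ₀ : ℝ → ℝ := b.normed volume with hψ₀
  have hψ₀s : ContDiff ℝ ∞ ψ₀ := b.contDiff_normed
  have hψ₀c : HasCompactSupport ψ₀ := b.hasCompactSupport_normed
  have hψ₀1 : ∫ s, ψ₀ s = 1 := b.integral_normed
  set C := ∫ s, ψ₀ s * F s with hC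
  refine ⟨C, ?_⟩
  have hz : ∀ᵐ s, F s - C = 0 := by
    refine ae_eq_zero_of_integral_contDiff_smul_eq_zero
      (hF.sub (locallyIntegrable_const C)) fun ψ hψ hψc => ?_
    obtain ⟨M₁, hM₁, hψM⟩ := exists_support_subset_Ioc hψc
    obtain ⟨M₂, hM₂, hψ₀M⟩ := exists_support_subset_Ioc hψ₀c
    set M := max M₁ M₂ with hMdef
    have hM : 0 < M := lt_max_of_lt_left hM₁
    set c := ∫ s, ψ s with hc
    -- The du Bois-Reymond argument: ψ minus its mass times a fixed normalised bump has integral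
    -- zero, so its primitive is again a compactly supported test function.
    set ξ : ℝ → ℝ := fun s => ψ s - c * ψ₀ s with hξ
    have hξs : ContDiff ℝ ∞ ξ := hψ.sub (contDiff_const.mul hψ₀s)
    have hξM : ∀ t, M ≤ |t| → ξ t = 0 := fun t ht => by
      simp [hξ, hψM t ((le_max_left _ _).trans ht), hψ₀M t ((le_max_right _ _).trans ht)]
    have hψi : Integrable ψ := hψ.continuous.integrable_of_hasCompactSupport hψc
    have hψ₀i : Integrable ψ₀ := hψ₀s.continuous.integrable_of_hasCompactSupport hψ₀c
    have hξint : ∫ s, ξ s = 0 := by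
      simp only [hξ]
      rw [integral_sub hψi (hψ₀i.const_mul c), integral_const_mul, hψ₀1, mul_one, sub_self]
    set χ : ℝ → ℝ := fun t => ∫ s in (-M)..t, ξ s with hχ
    have hder : ∀ t, HasDerivAt χ (ξ t) t := fun t =>
      intervalIntegral.integral_hasDerivAt_right (hξs.continuous.intervalIntegrable _ _)
        (hξs.continuous.stronglyMeasurableAtFilter _ _) hξs.continuous.continuousAt
    have hdχ : deriv χ = ξ := funext fun t => (hder t).deriv
    have hχs : ContDiff ℝ ∞ χ := by
      rw [contDiff_infty_iff_deriv, hdχ]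
      exact ⟨fun t => (hder t).differentiableAt, hξs⟩
    have hχM : ∀ t, t ∉ Icc (-M) M → χ t = 0 := by
      intro t ht
      rcases lt_or_ge t (-M) with h1 | h1
      · simp only [hχ]
        rw [intervalIntegral.integral_symm, neg_eq_zero]
        refine (intervalIntegral.integral_congr fun s hs => ?_).trans
          (intervalIntegral.integral_zero)
        rw [uIcc_of_le h1.le] at hs
        exact hξM s (by rw [abs_of_nonpos (by linarith [hs.2])]; linarith [hs.2])
      · have h2 : M < t := by
          by_contra hcon; exact ht ⟨h1, not_lt.1 hcon⟩
        simp only [hχ]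
        rw [← intervalIntegral.integral_add_adjacent_intervals
          (hξs.continuous.intervalIntegrable (-M) M) (hξs.continuous.intervalIntegrable M t),
          ← integral_eq_intervalIntegral_of_eq_zero hξM, hξint, zero_add]
        refine (intervalIntegral.integral_congr fun s hs => ?_).trans
          (intervalIntegral.integral_zero)
        rw [uIcc_of_le h2.le] at hs
        exact hξM s (by rw [abs_of_nonneg (by linarith [hs.1])]; linarith [hs.1])
    have hχc : HasCompactSupport χ := HasCompactSupport.intro isCompact_Icc hχM
    have h0 := H χ hχs hχc
    rw [hdχ] at h0
    have i1 : Integrable fun s => ψ s * F s := by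
      simpa using hF.integrable_smul_left_of_hasCompactSupport hψ.continuous hψc
    have i2 : Integrable fun s => ψ₀ s * F s := by
      simpa using hF.integrable_smul_left_of_hasCompactSupport hψ₀s.continuous hψ₀c
    have e1 : ∫ s, ξ s * F s = (∫ s, ψ s * F s) - c * C := by
      have : (fun s => ξ s * F s) = fun s => ψ s * F s - c * (ψ₀ s * F s) := by
        funext s; simp only [hξ]; ring
      rw [this, integral_sub i1 (i2.const_mul c), integral_const_mul]
    have e2 : ∫ s, ψ s • (F s - C) = (∫ s, ψ s * F s) - c * C := by
      have : (fun s => ψ s • (F s - C)) = fun s => ψ s * F s - ψ s * C := by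
        funext s; simp only [smul_eq_mul]; ring
      rw [this, integral_sub i1 (hψi.mul_const C), integral_mul_const]
    exact e2.trans (e1.symm.trans h0)
  exact hz.mono fun s hs => by linarith

/-- A weakly differentiable function on the line is a primitive of its weak derivative. -/
lemma ae_eq_primitive_of_weakDeriv {f g : ℝ → ℝ} (hf : LocallyIntegrable f)
    (hg : LocallyIntegrable g)
    (H : ∀ χ : ℝ → ℝ, ContDiff ℝ ∞ χ → HasCompactSupport χ →
      ∫ s, deriv χ s * f s = -∫ s, χ s * g s) :
    ∃ C, ∀ᵐ s, f s = C + ∫ r in (0 : ℝ)..s, g r := by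
  have hgi : ∀ a b : ℝ, IntervalIntegrable g volume a b := fun a b =>
    (hg.integrableOn_isCompact isCompact_uIcc).intervalIntegrable
  have hPc : Continuous fun s => ∫ r in (0 : ℝ)..s, g r :=
    intervalIntegral.continuous_primitive hgi 0
  obtain ⟨C, hC⟩ := ae_eq_const_of_integral_deriv_eq_zero (F := fun s => f s - ∫ r in (0 : ℝ)..s, g r)
    (hf.sub hPc.locallyIntegrable) fun χ hχ hχc => by
      have hdc : Continuous (deriv χ) := hχ.continuous_deriv (by exact_mod_cast le_top)
      have i1 : Integrable fun s => deriv χ s * f s := by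
        simpa using hf.integrable_smul_left_of_hasCompactSupport hdc hχc.deriv
      have i2 : Integrable fun s => deriv χ s * ∫ r in (0 : ℝ)..s, g r := by
        simpa using hPc.locallyIntegrable.integrable_smul_left_of_hasCompactSupport hdc hχc.deriv
      have h1 := H χ hχ hχc
      have h2 := integral_deriv_mul_primitive hg hχ hχc
      simp only [mul_sub]
      rw [integral_sub i1 i2, h1, h2, sub_self]
  exact ⟨C, hC.mono fun s hs => by linarith⟩

/-! ### Logarithmic polar coordinates -/

/-- The point of the plane with logarithmic polar coordinates `(t, θ)`. -/
def logPolar (p : ℝ × ℝ) : Plane :=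
  WithLp.toLp 2 ![Real.exp p.1 * Real.cos p.2, Real.exp p.1 * Real.sin p.2]

/-- The uniform measure on the cylinder of logarithmic polar coordinates. -/
def cylinderMeasure : Measure (ℝ × ℝ) :=
  (volume : Measure ℝ).prod (volume.restrict (Ioo (-Real.pi) Real.pi))

lemma continuous_logPolar : Continuous logPolar := by
  unfold logPolar
  refine (PiLp.continuous_toLp 2 _).comp (continuous_pi fun i => ?_)
  fin_cases i
  · simp only [Fin.zero_eta, Matrix.cons_val_zero]; fun_prop
  · simp only [Fin.mk_one, Matrix.cons_val_one, Matrix.cons_val_zero]; fun_prop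

lemma norm_logPolar (p : ℝ × ℝ) : ‖logPolar p‖ = Real.exp p.1 := by
  rw [EuclideanSpace.norm_eq, logPolar, Fin.sum_univ_two]
  simp only [Matrix.cons_val_zero, Matrix.cons_val_one, Real.norm_eq_abs, sq_abs]
  rw [Real.sqrt_eq_iff_mul_self_eq (by positivity) (by positivity)]
  linear_combination Real.exp p.1 ^ 2 * Real.sin_sq_add_cos_sq p.2

lemma lintegral_exp_substitution (q : ℝ → ℝ≥0∞) :
    ∫⁻ r in Ioi (0 : ℝ), q r = ∫⁻ t, ENNReal.ofReal (Real.exp t) * q (Real.exp t) := by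
  have := lintegral_image_eq_lintegral_abs_deriv_mul (s := univ) (f := Real.exp) (f' := Real.exp)
    MeasurableSet.univ (fun x _ => (Real.hasDerivAt_exp x).hasDerivWithinAt)
    Real.exp_injective.injOn q
  rw [image_univ, Real.range_exp] at this
  simpa [abs_of_pos (Real.exp_pos _)] using this

/-- Change of variables to logarithmic polar coordinates. -/
lemma lintegral_logPolar {f : Plane → ℝ≥0∞} (hf : Measurable f) :
    ∫⁻ x, f x = ∫⁻ t, ∫⁻ θ in Ioo (-Real.pi) Real.pi,
      ENNReal.ofReal (Real.exp (2 * t)) * f (logPolar (t, θ)) := by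
  rw [← (PiLp.volume_preserving_toLp (Fin 2)).lintegral_comp hf,
    ← ((volume_preserving_finTwoArrow ℝ).symm).lintegral_comp_emb
      (MeasurableEquiv.measurableEmbedding _), ← lintegral_comp_polarCoord_symm]
  rw [polarCoord_target, Measure.volume_eq_prod, ← Measure.prod_restrict, lintegral_prod,
    lintegral_exp_substitution]
  · refine lintegral_congr fun t => ?_
    rw [← lintegral_const_mul' _ _ ENNReal.ofReal_ne_top]
    refine lintegral_congr fun θ => ?_
    rw [smul_eq_mul, ← mul_assoc, ← ENNReal.ofReal_mul (Real.exp_pos _).le, ← Real.exp_add, ← two_mul]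
    rfl
  · refine Measurable.aemeasurable (Measurable.smul
      (ENNReal.measurable_ofReal.comp measurable_fst) ?_)
    refine hf.comp (Measurable.comp (PiLp.continuous_toLp 2 _).measurable ?_)
    exact (MeasurableEquiv.measurable _).comp continuous_polarCoord_symm.measurable

lemma map_logPolar : Measure.map logPolar
    (cylinderMeasure.withDensity fun p => ENNReal.ofReal (Real.exp (2 * p.1))) = volume := by
  refine Measure.ext_of_lintegral _ fun f hf => ?_
  have hX := continuous_logPolar.measurable
  rw [lintegral_map hf hX,
    lintegral_withDensity_eq_lintegral_mul _ (by fun_prop) (g := fun p => f (logPolar p))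
      (hf.comp hX), lintegral_logPolar hf, cylinderMeasure, lintegral_prod]
  · rfl
  · exact (Measurable.mul (by fun_prop) (hf.comp hX)).aemeasurable

lemma lintegral_radial {q : ℝ → ℝ≥0∞} (hq : Measurable q) :
    ∫⁻ x : Plane, q ‖x‖
      = ENNReal.ofReal (2 * Real.pi) * ∫⁻ t, ENNReal.ofReal (Real.exp (2 * t)) * q (Real.exp t) := by
  rw [lintegral_logPolar (f := fun x => q ‖x‖) (hq.comp measurable_norm),
    ← lintegral_const_mul' _ _ ENNReal.ofReal_ne_top]
  refine lintegral_congr fun t => ?_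
  simp only [norm_logPolar]
  rw [setLIntegral_const, Real.volume_Ioo, mul_comm]
  congr 2; ring

/-! ### Radial test fields -/

/-- The component `k` of the radial test field `χ(log |x|) x / |x|²`. -/
def radialTest (χ : ℝ → ℝ) (k : Fin 2) (x : Plane) : ℝ :=
  χ (Real.log (‖x‖ ^ 2) / 2) * (x k * (‖x‖ ^ 2)⁻¹)

lemma log_sq_div_two (r : ℝ) : Real.log (r ^ 2) / 2 = Real.log r := by
  rw [Real.log_pow]; push_cast; ring

lemma logCutoff_eq_zero_near {χ : ℝ → ℝ} {M : ℝ} (hχ : ∀ t, M ≤ |t| → χ t = 0) {x : Plane}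
    (hx0 : x ≠ 0) (hx : ‖x‖ < Real.exp (-M)) : χ (Real.log (‖x‖ ^ 2) / 2) = 0 := by
  rw [log_sq_div_two]
  refine hχ _ ?_
  have := Real.log_lt_log (norm_pos_iff.2 hx0) hx
  rw [Real.log_exp] at this
  exact le_trans (by linarith) (neg_le_abs _)

lemma logCutoff_eq_zero_far {χ : ℝ → ℝ} {M : ℝ} (hχ : ∀ t, M ≤ |t| → χ t = 0) {x : Plane}
    (hx : Real.exp M ≤ ‖x‖) : χ (Real.log (‖x‖ ^ 2) / 2) = 0 := by
  rw [log_sq_div_two]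
  refine hχ _ (le_trans ?_ (le_abs_self _))
  rw [← Real.log_exp M]
  exact Real.log_le_log (Real.exp_pos _) hx

lemma radialTest_hasCompactSupport {χ : ℝ → ℝ} (hχc : HasCompactSupport χ) (k : Fin 2) :
    HasCompactSupport (radialTest χ k) := by
  obtain ⟨M, -, hM⟩ := exists_support_subset_Ioc hχc
  refine HasCompactSupport.intro (isCompact_closedBall (0 : Plane) (Real.exp M)) fun x hx => ?_
  rw [Metric.mem_closedBall, dist_zero_right, not_le] at hx
  rw [radialTest, logCutoff_eq_zero_far hM hx.le, zero_mul]

/-- The logarithmic cutoff makes the field vanish near the origin. Elsewhere the field is a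
composition of smooth functions; log |x| enters through |x|², which is smooth on the whole plane. -/
lemma radialTest_contDiff {χ : ℝ → ℝ} (hχ : ContDiff ℝ ∞ χ) (hχc : HasCompactSupport χ)
    (k : Fin 2) : ContDiff ℝ ∞ (radialTest χ k) := by
  obtain ⟨M, -, hM⟩ := exists_support_subset_Ioc hχc
  rw [contDiff_iff_contDiffAt]
  intro x
  rcases eq_or_ne x 0 with rfl | hx
  · have : radialTest χ k =ᶠ[𝓝 0] fun _ => 0 := by
      filter_upwards [Metric.ball_mem_nhds (0 : Plane) (Real.exp_pos (-M))] with y hy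
      rw [Metric.mem_ball, dist_zero_right] at hy
      rcases eq_or_ne y 0 with rfl | hy0
      · simp [radialTest]
      · rw [radialTest, logCutoff_eq_zero_near hM hy0 hy, zero_mul]
    exact contDiffAt_const.congr_of_eventuallyEq this
  · have h1 : ‖x‖ ^ 2 ≠ 0 := pow_ne_zero 2 (norm_ne_zero_iff.2 hx)
    have hn : ContDiffAt ℝ ∞ (fun y : Plane => ‖y‖ ^ 2) x := (contDiff_norm_sq ℝ).contDiffAt
    have hp : ContDiffAt ℝ ∞ (fun y : Plane => y k) x :=
      (EuclideanSpace.proj k : Plane →L[ℝ] ℝ).contDiff.contDiffAt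
    exact (hχ.contDiffAt.comp x ((hn.log h1).div_const 2)).mul (hp.mul (hn.inv h1))

lemma radialTest_fderiv {χ : ℝ → ℝ} (hχ : ContDiff ℝ ∞ χ) (hχc : HasCompactSupport χ)
    (k : Fin 2) {x : Plane} (hx : x ≠ 0) :
    fderiv ℝ (radialTest χ k) x (unitVec k)
      = deriv χ (Real.log (‖x‖ ^ 2) / 2) * (x k ^ 2 * ((‖x‖ ^ 2)⁻¹) ^ 2)
        + χ (Real.log (‖x‖ ^ 2) / 2) * ((‖x‖ ^ 2)⁻¹ - 2 * x k ^ 2 * ((‖x‖ ^ 2)⁻¹) ^ 2) := by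
  have h1 : ‖x‖ ^ 2 ≠ 0 := pow_ne_zero 2 (norm_ne_zero_iff.2 hx)
  have hd : DifferentiableAt ℝ (radialTest χ k) x :=
    (radialTest_contDiff hχ hχc k).differentiable (by simp) x
  rw [← hd.lineDeriv_eq_fderiv, lineDeriv]
  have hline : HasDerivAt (fun s : ℝ => x + s • unitVec k) (unitVec k) 0 := by
    simpa using ((hasDerivAt_id (0 : ℝ)).smul_const (unitVec k)).const_add x
  have hN : HasDerivAt (fun s : ℝ => ‖x + s • unitVec k‖ ^ 2) (2 * x k) 0 := by
    have := hline.norm_sq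
    simpa [unitVec, EuclideanSpace.inner_single_right] using this
  have hc : HasDerivAt (fun s : ℝ => (x + s • unitVec k) k) 1 0 := by
    have : (fun s : ℝ => (x + s • unitVec k) k) = fun s => x k + s := by
      funext s; simp [unitVec]
    rw [this]
    exact (hasDerivAt_id (0 : ℝ)).const_add (x k)
  have hx0 : x + (0 : ℝ) • unitVec k = x := by simp
  have hlog := (hN.log (by rw [hx0]; exact h1)).div_const 2
  have hinv := hN.inv (by rw [hx0]; exact h1)
  have hχd : HasDerivAt χ (deriv χ (Real.log (‖x + (0 : ℝ) • unitVec k‖ ^ 2) / 2))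
      (Real.log (‖x + (0 : ℝ) • unitVec k‖ ^ 2) / 2) :=
    (hχ.differentiable (by simp) _).hasDerivAt
  have htot := (hχd.comp (0 : ℝ) hlog).mul (hc.mul hinv)
  have := htot.deriv
  refine Eq.trans ?_ (this.trans ?_)
  · rfl
  · simp only [Function.comp, hx0, Pi.inv_apply, Pi.mul_apply]
    field_simp
    ring

lemma norm_sq_plane (x : Plane) : ‖x‖ ^ 2 = x 0 ^ 2 + x 1 ^ 2 := by
  rw [EuclideanSpace.norm_sq_eq, Fin.sum_univ_two]; simp

/-- In two dimensions x/|x|² is divergence-free away from the origin, so only the derivative of the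
cutoff contributes. -/
lemma radialTest_divergence {χ : ℝ → ℝ} (hχ : ContDiff ℝ ∞ χ) (hχc : HasCompactSupport χ)
    {x : Plane} (hx : x ≠ 0) :
    ∑ k, fderiv ℝ (radialTest χ k) x (unitVec k)
      = deriv χ (Real.log (‖x‖ ^ 2) / 2) * (‖x‖ ^ 2)⁻¹ := by
  have h1 : ‖x‖ ^ 2 ≠ 0 := pow_ne_zero 2 (norm_ne_zero_iff.2 hx)
  rw [Fin.sum_univ_two, radialTest_fderiv hχ hχc 0 hx, radialTest_fderiv hχ hχc 1 hx]
  set χ' := deriv χ (Real.log (‖x‖ ^ 2) / 2)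
  set χ₀ := χ (Real.log (‖x‖ ^ 2) / 2)
  have h2 := norm_sq_plane x
  set n := ‖x‖ ^ 2
  have h3 : n * n⁻¹ ^ 2 = n⁻¹ := by field_simp
  linear_combination (χ' - 2 * χ₀) * h3 - (χ' - 2 * χ₀) * n⁻¹ ^ 2 * h2

/-! ### Angular means -/

/-- The mean of `f` over the circle of radius `exp t`. -/
def angularMean (f : Plane → ℝ) (t : ℝ) : ℝ :=
  (2 * Real.pi)⁻¹ * ∫ θ in Ioo (-Real.pi) Real.pi, f (logPolar (t, θ))

lemma continuous_logCutoff {χ : ℝ → ℝ} (hχ : Continuous χ) (hχc : HasCompactSupport χ) :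
    Continuous (fun x : Plane => if x = 0 then 0 else χ (Real.log (‖x‖ ^ 2) / 2) * (‖x‖ ^ 2)⁻¹) ∧
    HasCompactSupport
      (fun x : Plane => if x = 0 then 0 else χ (Real.log (‖x‖ ^ 2) / 2) * (‖x‖ ^ 2)⁻¹) := by
  obtain ⟨M, -, hM⟩ := exists_support_subset_Ioc hχc
  set F := fun x : Plane => if x = 0 then 0 else χ (Real.log (‖x‖ ^ 2) / 2) * (‖x‖ ^ 2)⁻¹ with hF
  constructor
  · rw [continuous_iff_continuousAt]
    intro x
    rcases eq_or_ne x 0 with rfl | hx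
    · have : F =ᶠ[𝓝 0] fun _ => 0 := by
        filter_upwards [Metric.ball_mem_nhds (0 : Plane) (Real.exp_pos (-M))] with y hy
        rw [Metric.mem_ball, dist_zero_right] at hy
        rcases eq_or_ne y 0 with rfl | hy0
        · simp [hF]
        · simp only [hF, hy0, if_false]
          rw [logCutoff_eq_zero_near hM hy0 hy, zero_mul]
      exact (continuousAt_const (y := (0 : ℝ))).congr this.symm
    · have h1 : ‖x‖ ^ 2 ≠ 0 := pow_ne_zero 2 (norm_ne_zero_iff.2 hx)
      have hn : ContinuousAt (fun y : Plane => ‖y‖ ^ 2) x := by fun_prop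
      have h2 : ContinuousAt (fun y : Plane => χ (Real.log (‖y‖ ^ 2) / 2) * (‖y‖ ^ 2)⁻¹) x :=
        (hχ.continuousAt.comp ((hn.log h1).div_const 2)).mul (hn.inv₀ h1)
      refine h2.congr ?_
      filter_upwards [isOpen_ne.mem_nhds hx] with y hy
      simp only [hF]
      rw [if_neg hy]
  · refine HasCompactSupport.intro (isCompact_closedBall (0 : Plane) (Real.exp M)) fun x hx => ?_
    rw [Metric.mem_closedBall, dist_zero_right, not_le] at hx
    simp only [hF]
    rw [logCutoff_eq_zero_far hM hx.le]
    simp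

lemma integrable_logPolar {F : Plane → ℝ} (hF : Integrable F) :
    Integrable (fun p => Real.exp (2 * p.1) * F (logPolar p)) cylinderMeasure ∧
    ∫ x, F x = ∫ p, Real.exp (2 * p.1) * F (logPolar p) ∂cylinderMeasure := by
  have hX := continuous_logPolar.measurable
  have hden : Measurable fun p : ℝ × ℝ => Real.toNNReal (Real.exp (2 * p.1)) := by fun_prop
  have hF' : Integrable F (Measure.map logPolar
      (cylinderMeasure.withDensity fun p => ENNReal.ofReal (Real.exp (2 * p.1)))) := by
    rw [map_logPolar]; exact hF
  have h1 := hF'.comp_measurable hX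
  have h2 : ∫ x, F x = ∫ p, F (logPolar p)
      ∂(cylinderMeasure.withDensity fun p => ENNReal.ofReal (Real.exp (2 * p.1))) := by
    rw [← integral_map hX.aemeasurable hF'.aestronglyMeasurable, map_logPolar]
  have e : (cylinderMeasure.withDensity fun p => ENNReal.ofReal (Real.exp (2 * p.1)))
      = cylinderMeasure.withDensity fun p => ((Real.toNNReal (Real.exp (2 * p.1)) : NNReal) : ℝ≥0∞) :=
    rfl
  rw [e] at h1 h2
  rw [integral_withDensity_eq_integral_smul hden] at h2
  rw [integrable_withDensity_iff_integrable_smul hden] at h1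
  simp only [NNReal.smul_def, Real.coe_toNNReal _ (Real.exp_pos _).le, smul_eq_mul] at h1 h2
  exact ⟨h1, h2⟩

/-- The factor |x|⁻² cancels the Jacobian e^(2t). This turns a one-dimensional pairing with an
angular mean into a planar integral against a compactly supported continuous function. -/
lemma integral_mul_angularMean {f : Plane → ℝ} (hf : LocallyIntegrable f) {χ : ℝ → ℝ}
    (hχ : Continuous χ) (hχc : HasCompactSupport χ) :
    Integrable (fun t => χ t * angularMean f t) ∧
    ∫ t, χ t * angularMean f t
      = (2 * Real.pi)⁻¹ * ∫ x : Plane, χ (Real.log (‖x‖ ^ 2) / 2) * (‖x‖ ^ 2)⁻¹ * f x := by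
  obtain ⟨hc, hcs⟩ := continuous_logCutoff hχ hχc
  have hI := hf.integrable_smul_left_of_hasCompactSupport hc hcs
  obtain ⟨h1, h2⟩ := integrable_logPolar hI
  have hlp : ∀ p : ℝ × ℝ, logPolar p ≠ 0 := fun p => by
    rw [← norm_pos_iff, norm_logPolar]; exact Real.exp_pos _
  have e1 : (fun p : ℝ × ℝ => Real.exp (2 * p.1) * ((if logPolar p = 0 then 0 else
      χ (Real.log (‖logPolar p‖ ^ 2) / 2) * (‖logPolar p‖ ^ 2)⁻¹) • f (logPolar p)))
      = fun p => χ p.1 * f (logPolar p) := by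
    funext p
    rw [if_neg (hlp p), norm_logPolar, log_sq_div_two, Real.log_exp, smul_eq_mul,
      ← Real.exp_nat_mul]
    push_cast
    have : Real.exp (2 * p.1) ≠ 0 := (Real.exp_pos _).ne'
    field_simp
  have e2 : ∀ᵐ x : Plane, (if x = 0 then 0 else χ (Real.log (‖x‖ ^ 2) / 2) * (‖x‖ ^ 2)⁻¹) • f x
      = χ (Real.log (‖x‖ ^ 2) / 2) * (‖x‖ ^ 2)⁻¹ * f x := by
    have : ∀ᵐ x : Plane, x ≠ 0 := by simp [ae_iff]
    filter_upwards [this] with x hx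
    rw [if_neg hx, smul_eq_mul]
  rw [e1] at h1 h2
  rw [integral_congr_ae e2] at h2
  have e3 : (fun t => χ t * angularMean f t) = fun t => (2 * Real.pi)⁻¹ *
      ∫ θ in Ioo (-Real.pi) Real.pi, χ t * f (logPolar (t, θ)) := by
    funext t
    rw [integral_const_mul, angularMean]; ring
  rw [e3]
  refine ⟨h1.integral_prod_left.const_mul _, ?_⟩
  rw [integral_const_mul, h2, cylinderMeasure, integral_prod _ h1]

/-- Near a given t the angular mean agrees with its product with a bump equal to 1 there, and that
product is integrable. -/
lemma locallyIntegrable_angularMean {f : Plane → ℝ} (hf : LocallyIntegrable f) :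
    LocallyIntegrable (angularMean f) := by
  intro t
  let b : ContDiffBump t := ⟨1, 2, by norm_num, by norm_num⟩
  have h1 := (integral_mul_angularMean hf b.continuous b.hasCompactSupport).1
  refine ⟨Metric.closedBall t 1, Metric.closedBall_mem_nhds t one_pos, ?_⟩
  refine (h1.integrableOn (s := Metric.closedBall t 1)).congr_fun (fun s hs => ?_)
    measurableSet_closedBall
  change b s * angularMean f s = angularMean f s
  rw [b.one_of_mem_closedBall hs, one_mul]

lemma measurable_angularMean {f : Plane → ℝ} (hf : Measurable f) : Measurable (angularMean f) := by
  have h1 : StronglyMeasurable fun p : ℝ × ℝ => f (logPolar p) :=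
    (hf.comp continuous_logPolar.measurable).stronglyMeasurable
  exact (h1.integral_prod_right' (ν := volume.restrict (Ioo (-Real.pi) Real.pi))).measurable.const_mul _

/-- Cauchy–Schwarz on the circle, whose angular measure is 2π. -/
lemma angularMean_sq_le {f : Plane → ℝ} (hf : Measurable f) (t : ℝ) :
    ENNReal.ofReal (2 * Real.pi) * ENNReal.ofReal (angularMean f t ^ 2)
      ≤ ∫⁻ θ in Ioo (-Real.pi) Real.pi, ENNReal.ofReal (f (logPolar (t, θ)) ^ 2) := by
  set κ := volume.restrict (Ioo (-Real.pi) Real.pi) with hκ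
  set F : ℝ → ℝ := fun θ => f (logPolar (t, θ)) with hF
  have hFm : Measurable F :=
    hf.comp (continuous_logPolar.measurable.comp (measurable_const.prodMk measurable_id))
  have hpi : 0 < 2 * Real.pi := by positivity
  have hvol : κ univ = ENNReal.ofReal (2 * Real.pi) := by
    rw [hκ, Measure.restrict_apply_univ, Real.volume_Ioo]; congr 1; ring
  have h1 : ‖∫ θ, F θ ∂κ‖ₑ ≤ eLpNorm F 1 κ := by
    rw [eLpNorm_one_eq_lintegral_enorm]; exact enorm_integral_le_lintegral_enorm F
  have h2 : eLpNorm F 1 κ ≤ eLpNorm F 2 κ * κ univ ^ (1 / 2 : ℝ) := by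
    have := eLpNorm_le_eLpNorm_mul_rpow_measure_univ (μ := κ) (p := 1) (q := 2) (by norm_num)
      hFm.aestronglyMeasurable
    convert this using 3
    norm_num
  have h3 : ‖∫ θ, F θ ∂κ‖ₑ ^ 2 ≤ ENNReal.ofReal (2 * Real.pi) * ∫⁻ θ, ENNReal.ofReal (F θ ^ 2) ∂κ := by
    calc ‖∫ θ, F θ ∂κ‖ₑ ^ 2 ≤ (eLpNorm F 2 κ * κ univ ^ (1 / 2 : ℝ)) ^ 2 := by
          gcongr; exact h1.trans h2
      _ = _ := by
          rw [mul_pow, eLpNorm_two_sq, hvol, mul_comm, ← ENNReal.rpow_two, ← ENNReal.rpow_mul]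
          norm_num
  have h4 : ‖∫ θ, F θ ∂κ‖ₑ ^ 2 = ENNReal.ofReal ((∫ θ, F θ ∂κ) ^ 2) := by
    rw [Real.enorm_eq_ofReal_abs, ← ENNReal.ofReal_pow (abs_nonneg _), sq_abs]
  rw [h4] at h3
  have h5 : ENNReal.ofReal (2 * Real.pi) * ENNReal.ofReal (angularMean f t ^ 2)
      = ENNReal.ofReal (2 * Real.pi)⁻¹ * ENNReal.ofReal ((∫ θ, F θ ∂κ) ^ 2) := by
    rw [← ENNReal.ofReal_mul hpi.le, ← ENNReal.ofReal_mul (by positivity), angularMean]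
    congr 1
    rw [mul_pow]
    field_simp
    rfl
  rw [h5]
  calc _ ≤ ENNReal.ofReal (2 * Real.pi)⁻¹ *
        (ENNReal.ofReal (2 * Real.pi) * ∫⁻ θ, ENNReal.ofReal (F θ ^ 2) ∂κ) := by gcongr
    _ = _ := by
        rw [← mul_assoc, ← ENNReal.ofReal_mul (by positivity), inv_mul_cancel₀ hpi.ne',
          ENNReal.ofReal_one, one_mul]

/-! ### From the scattering functional to the radial problem -/

/-- The radial weight, in the logarithmic variable, of the potential `v`. -/
def radialWeight (μ : ℝ) (v : ℝ → ℝ≥0∞) (t : ℝ) : ℝ≥0∞ :=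
  v (Real.exp t) * ENNReal.ofReal (Real.exp (2 * t) / (2 * μ))

lemma measurable_radialWeight {μ : ℝ} {v : ℝ → ℝ≥0∞} (hv : Measurable v) :
    Measurable (radialWeight μ v) :=
  (hv.comp Real.measurable_exp).mul (by fun_prop)

/-- A function with given derivative and small energy on a half-line can be replaced by a
nondecreasing profile with compact range. -/
lemma exists_slope_of_primitive {T e : ℝ} {w : ℝ → ℝ≥0∞} {f g : ℝ → ℝ}
    (hgm : Measurable g) (hg : LocallyIntegrable g)
    (hfg : ∀ᵐ t, t < T → f t = 1 - ∫ s in t..T, g s)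
    (hE : ∫⁻ t in Iio T, (ENNReal.ofReal (g t ^ 2) + w t * ENNReal.ofReal (f t ^ 2))
      < ENNReal.ofReal e) :
    ∃ t₀ h, IsSlope t₀ T h ∧ profileEnergy w t₀ T h ≤ ENNReal.ofReal e := by
  set E := ∫⁻ t in Iio T, (ENNReal.ofReal (g t ^ 2) + w t * ENNReal.ofReal (f t ^ 2)) with hEdef
  have hEfin : E ≠ ⊤ := hE.ne_top
  set r := E.toReal with hr
  have hr0 : 0 ≤ r := ENNReal.toReal_nonneg
  have hEr : E = ENNReal.ofReal r := (ENNReal.ofReal_toReal hEfin).symm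
  have hre : r < e := by
    rw [hEr] at hE
    exact (ENNReal.ofReal_lt_ofReal_iff_of_nonneg hr0).1 hE
  -- The gap e - r is spent in two halves: κ is chosen so that the factor 1 + κ costs at most d, and
  -- M so that the added constant slope 1/M costs at most d on an interval of length at most M.
  set d := (e - r) / 2 with hd
  have hd0 : 0 < d := by rw [hd]; linarith
  set κ := d / (r + 1) with hκ
  have hκ0 : 0 < κ := by positivity
  set M := (1 + 1 / κ) / d with hM
  have hM0 : 0 < M := by positivity
  -- the modified slope
  set k : ℝ → ℝ := fun t => max (g t) 0 + 1 / M with hk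
  have hkm : Measurable k := (hgm.max measurable_const).add_const _
  have hgi : ∀ a b : ℝ, IntervalIntegrable g volume a b := fun a b =>
    (hg.integrableOn_isCompact isCompact_uIcc).intervalIntegrable
  have hki : ∀ a b : ℝ, IntervalIntegrable k volume a b := fun a b => by
    refine IntervalIntegrable.add ?_ intervalIntegrable_const
    exact ⟨(hgi a b).1.pos_part, (hgi a b).2.pos_part⟩
  have hk0 : ∀ t, 0 ≤ k t := fun t => add_nonneg (le_max_right _ _) (by positivity)
  have hcont : Continuous fun t => ∫ s in t..T, k s := by
    have := intervalIntegral.continuous_primitive hki T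
    have h2 : (fun t => ∫ s in t..T, k s) = fun t => -∫ s in T..t, k s := by
      funext t; rw [intervalIntegral.integral_symm]
    rw [h2]; exact this.neg
  have hbig : 1 ≤ ∫ s in (T - M)..T, k s := by
    have h1 : ∫ s in (T - M)..T, (1 / M : ℝ) = 1 := by
      rw [intervalIntegral.integral_const, smul_eq_mul]; field_simp; ring
    rw [← h1]
    refine intervalIntegral.integral_mono_on (by linarith) intervalIntegrable_const (hki _ _)
      fun s _ => ?_
    simp only [hk]
    linarith [le_max_right (g s) 0]
  -- The added slope 1/M forces a rise of at least 1 over [T - M, T], so the profile, followed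
  -- backwards from the value 1 at T, reaches 0 at a finite t₀.
  obtain ⟨t₀, ht₀, ht₀1⟩ : ∃ t₀ ∈ Icc (T - M) T, ∫ s in t₀..T, k s = 1 := by
    have := intermediate_value_Icc' (by linarith : T - M ≤ T) hcont.continuousOn
    obtain ⟨t₀, h1, h2⟩ := this ⟨by simp, hbig⟩
    exact ⟨t₀, h1, h2⟩
  have K : IsSlope t₀ T k := ⟨ht₀.2, hkm, hk0, hki _ _, ht₀1⟩
  refine ⟨t₀, k, K, ?_⟩
  have hpt : ∀ᵐ t ∂(volume.restrict (Ioc t₀ T)),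
      ENNReal.ofReal (k t ^ 2) + w t * ENNReal.ofReal (profile t₀ k t ^ 2)
      ≤ ENNReal.ofReal (1 + κ) * (ENNReal.ofReal (g t ^ 2) + w t * ENNReal.ofReal (f t ^ 2))
        + ENNReal.ofReal ((1 + 1 / κ) * (1 / M) ^ 2) := by
    have hneT : ∀ᵐ t : ℝ, t ≠ T := by simp [ae_iff]
    filter_upwards [ae_restrict_mem measurableSet_Ioc, ae_restrict_of_ae hfg,
      ae_restrict_of_ae hneT] with t ht hft hneT
    have htT : t < T := lt_of_le_of_ne ht.2 hneT
    have htI : t ∈ Icc t₀ T := ⟨ht.1.le, ht.2⟩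
    have hp0 := K.profile_nonneg htI
    -- Both functions are reconstructed from the value 1 at T and k ≥ g, so the new profile lies
    -- below f; being nonnegative, it does not increase the potential term.
    have hpf : profile t₀ k t ≤ f t := by
      have h1 := K.profile_sub htI (right_mem_Icc.2 K.le)
      rw [K.profile_right] at h1
      rw [hft htT]
      have h2 : ∫ s in t..T, g s ≤ ∫ s in t..T, k s :=
        intervalIntegral.integral_mono_on ht.2 (hgi _ _) (hki _ _) fun s _ => by
          simp only [hk]
          have : 0 < 1 / M := by positivity
          linarith [le_max_left (g s) 0]
      linarith
    have h1 : ENNReal.ofReal (k t ^ 2) ≤ ENNReal.ofReal (1 + κ) * ENNReal.ofReal (g t ^ 2)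
        + ENNReal.ofReal ((1 + 1 / κ) * (1 / M) ^ 2) := by
      rw [← ENNReal.ofReal_mul (by positivity), ← ENNReal.ofReal_add (by positivity) (by positivity)]
      apply ENNReal.ofReal_le_ofReal
      have ha : max (g t) 0 ^ 2 ≤ g t ^ 2 := by
        rcases le_total (g t) 0 with h | h
        · rw [max_eq_right h]; nlinarith [sq_nonneg (g t)]
        · rw [max_eq_left h]
      simp only [hk]
      set a := max (g t) 0
      set b := 1 / M
      have h3 : (1 + κ) * a ^ 2 + (1 + 1 / κ) * b ^ 2 - (a + b) ^ 2 = (κ * a - b) ^ 2 / κ := by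
        field_simp; ring
      have h4 : 0 ≤ (κ * a - b) ^ 2 / κ := by positivity
      have h5 : (1 + κ) * a ^ 2 ≤ (1 + κ) * g t ^ 2 := by gcongr
      linarith
    have h2 : w t * ENNReal.ofReal (profile t₀ k t ^ 2)
        ≤ ENNReal.ofReal (1 + κ) * (w t * ENNReal.ofReal (f t ^ 2)) := by
      have h3 : (1 : ℝ≥0∞) ≤ ENNReal.ofReal (1 + κ) := by
        rw [ENNReal.one_le_ofReal]; linarith
      calc w t * ENNReal.ofReal (profile t₀ k t ^ 2) ≤ 1 * (w t * ENNReal.ofReal (f t ^ 2)) := by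
            rw [one_mul]; gcongr
        _ ≤ _ := by gcongr
    calc _ ≤ (ENNReal.ofReal (1 + κ) * ENNReal.ofReal (g t ^ 2)
        + ENNReal.ofReal ((1 + 1 / κ) * (1 / M) ^ 2))
        + ENNReal.ofReal (1 + κ) * (w t * ENNReal.ofReal (f t ^ 2)) := add_le_add h1 h2
      _ = _ := by ring
  refine (lintegral_mono_ae hpt).trans ?_
  rw [lintegral_add_right _ measurable_const, lintegral_const_mul' _ _ ENNReal.ofReal_ne_top,
    setLIntegral_const, Real.volume_Ioc]
  have hsub : ∫⁻ t in Ioc t₀ T, (ENNReal.ofReal (g t ^ 2) + w t * ENNReal.ofReal (f t ^ 2)) ≤ E := by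
    rw [hEdef, ← setLIntegral_congr Ioo_ae_eq_Ioc]
    exact lintegral_mono_set Ioo_subset_Iio_self
  calc _ ≤ ENNReal.ofReal (1 + κ) * ENNReal.ofReal r
        + ENNReal.ofReal ((1 + 1 / κ) * (1 / M) ^ 2) * ENNReal.ofReal M := by
        rw [← hEr]
        gcongr
        linarith [ht₀.1]
    _ = ENNReal.ofReal ((1 + κ) * r + (1 + 1 / κ) * (1 / M) ^ 2 * M) := by
        rw [← ENNReal.ofReal_mul (by positivity), ← ENNReal.ofReal_mul (by positivity),
          ← ENNReal.ofReal_add (by positivity) (by positivity)]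
    _ ≤ _ := by
        apply ENNReal.ofReal_le_ofReal
        have h1 : κ * r ≤ d := by
          rw [hκ, div_mul_eq_mul_div, div_le_iff₀ (by linarith)]
          nlinarith
        have h2 : (1 + 1 / κ) * (1 / M) ^ 2 * M = d := by
          have : (1 + 1 / κ) * (1 / M) ^ 2 * M = (1 + 1 / κ) / M := by field_simp
          rw [this, hM]
          have : (1 + 1 / κ) ≠ 0 := by positivity
          field_simp
        rw [h2]
        have : e = r + 2 * d := by rw [hd]; ring
        linarith

/-- The angular mean of a weakly differentiable function on the plane is a primitive of the mean of
its radial derivative. -/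
lemma angularMean_weakDeriv {φ : Plane → ℝ} {G : Fin 2 → Plane → ℝ}
    (hφG : ∀ k, HasWeakDeriv φ (G k) (unitVec k)) {χ : ℝ → ℝ} (hχ : ContDiff ℝ ∞ χ)
    (hχc : HasCompactSupport χ) :
    ∫ t, deriv χ t * angularMean φ t
      = -∫ t, χ t * angularMean (fun x => ∑ k, x k * G k x) t := by
  have hφ : LocallyIntegrable φ := (hφG 0).1
  have hG : ∀ k, LocallyIntegrable (G k) := fun k => (hφG k).2.1
  have hxG : LocallyIntegrable (fun x : Plane => ∑ k, x k * G k x) := by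
    refine locallyIntegrable_finsetSum _ fun k _ => ?_
    have hc : Continuous fun x : Plane => x k := (EuclideanSpace.proj k : Plane →L[ℝ] ℝ).continuous
    rw [← locallyIntegrableOn_univ]
    have := ((locallyIntegrableOn_univ.2 (hG k)).continuousOn_mul hc.continuousOn
      isOpen_univ.isLocallyClosed)
    exact this
  have hdc : Continuous (deriv χ) := hχ.continuous_deriv (by exact_mod_cast le_top)
  -- Both sides become planar integrals. The divergence of the radial test field produces the left
  -- one, its pairing with G the right one, and the weak derivative identity is applied component by
  -- component.
  rw [(integral_mul_angularMean hφ hdc hχc.deriv).2,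
    (integral_mul_angularMean hxG hχ.continuous hχc).2, ← mul_neg]
  congr 1
  have hne : ∀ᵐ x : Plane, x ≠ 0 := by simp [ae_iff]
  have i1 : ∀ k, Integrable fun x => fderiv ℝ (radialTest χ k) x (unitVec k) • φ x := fun k => by
    have hcd := radialTest_contDiff hχ hχc k
    refine hφ.integrable_smul_left_of_hasCompactSupport ?_ ?_
    · exact (hcd.continuous_fderiv (by simp)).clm_apply continuous_const
    · exact (radialTest_hasCompactSupport hχc k).fderiv_apply (𝕜 := ℝ) (unitVec k)
  have i2 : ∀ k, Integrable fun x => radialTest χ k x • G k x := fun k =>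
    (hG k).integrable_smul_left_of_hasCompactSupport (radialTest_contDiff hχ hχc k).continuous
      (radialTest_hasCompactSupport hχc k)
  have e1 : ∫ x : Plane, deriv χ (Real.log (‖x‖ ^ 2) / 2) * (‖x‖ ^ 2)⁻¹ * φ x
      = ∑ k, ∫ x, fderiv ℝ (radialTest χ k) x (unitVec k) • φ x := by
    rw [← integral_finsetSum _ fun k _ => i1 k]
    refine integral_congr_ae ?_
    filter_upwards [hne] with x hx
    rw [← radialTest_divergence hχ hχc hx, Finset.sum_mul]
    simp
  have e2 : ∫ x : Plane, χ (Real.log (‖x‖ ^ 2) / 2) * (‖x‖ ^ 2)⁻¹ * ∑ k, x k * G k x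
      = ∑ k, ∫ x, radialTest χ k x • G k x := by
    rw [← integral_finsetSum _ fun k _ => i2 k]
    refine integral_congr_ae (Eventually.of_forall fun x => ?_)
    simp only [radialTest, Finset.mul_sum, smul_eq_mul]
    refine Finset.sum_congr rfl fun k _ => ?_
    ring
  rw [e1, e2, ← Finset.sum_neg_distrib]
  refine Finset.sum_congr rfl fun k _ => ?_
  exact (hφG k).2.2 _ (radialTest_contDiff hχ hχc k) (radialTest_hasCompactSupport hχc k)

lemma ae_logPolar {P : Plane → Prop} (hP : ∀ᵐ x, P x) :
    ∀ᵐ t : ℝ, ∀ᵐ θ ∂(volume.restrict (Ioo (-Real.pi) Real.pi)), P (logPolar (t, θ)) := by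
  rw [← map_logPolar] at hP
  have h1 := ae_of_ae_map continuous_logPolar.measurable.aemeasurable hP
  rw [ae_withDensity_iff (by fun_prop)] at h1
  have h2 : ∀ᵐ p ∂cylinderMeasure, P (logPolar p) := h1.mono fun p hp =>
    hp (ENNReal.ofReal_pos.2 (Real.exp_pos _)).ne'
  exact Measure.ae_ae_of_ae_prod h2

lemma HasWeakDeriv.congr_ae {f f' g g' : Plane → ℝ} {e : Plane} (h : HasWeakDeriv f g e)
    (hf : f =ᵐ[volume] f') (hg : g =ᵐ[volume] g') : HasWeakDeriv f' g' e := by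
  refine ⟨h.1.congr hf, h.2.1.congr hg, fun η hη hηc => ?_⟩
  have e1 : ∫ x, fderiv ℝ η x e • f' x = ∫ x, fderiv ℝ η x e • f x :=
    integral_congr_ae (hf.mono fun x hx => by simp only [hx])
  have e2 : ∫ x, η x • g' x = ∫ x, η x • g x :=
    integral_congr_ae (hg.mono fun x hx => by simp only [hx])
  rw [e1, e2]
  exact h.2.2 η hη hηc

lemma enorm_sq_eq_ofReal (x : ℝ) : ‖x‖ₑ ^ 2 = ENNReal.ofReal (x ^ 2) := by
  rw [Real.enorm_eq_ofReal_abs, ← ENNReal.ofReal_pow (abs_nonneg _), sq_abs]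

/-- Passing to angular means does not increase the scattering functional. -/
lemma angularMean_energy_le {μ R : ℝ} {v : ℝ → ℝ≥0∞} (hμ : 0 < μ) (hv : Measurable v) (hR : 0 < R)
    {φ : Plane → ℝ} {G : Fin 2 → Plane → ℝ} (hφ : Measurable φ) (hG : ∀ k, Measurable (G k)) :
    ENNReal.ofReal (2 * Real.pi * μ) * ∫⁻ t in Iio (Real.log R),
      (ENNReal.ofReal (angularMean (fun x => ∑ k, x k * G k x) t ^ 2)
        + radialWeight μ v t * ENNReal.ofReal (angularMean φ t ^ 2))
      ≤ scatteringFunctional μ v R φ G := by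
  have hcoord : ∀ k : Fin 2, Measurable fun x : Plane => x k := fun k =>
    (EuclideanSpace.proj k : Plane →L[ℝ] ℝ).continuous.measurable
  have hxG : Measurable fun x : Plane => ∑ k, x k * G k x :=
    Finset.measurable_sum _ fun k _ => (hcoord k).mul (hG k)
  have hvn : Measurable fun x : Plane => v ‖x‖ := hv.comp measurable_norm
  have hQ : Measurable fun x : Plane =>
      ENNReal.ofReal μ * ∑ k, ‖G k x‖ₑ ^ 2 + v ‖x‖ / 2 * ‖φ x‖ₑ ^ 2 :=
    ((Finset.measurable_sum _ fun k _ => (hG k).enorm.pow_const 2).const_mul _).add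
      ((hvn.div_const 2).mul (hφ.enorm.pow_const 2))
  rw [scatteringFunctional, ← lintegral_indicator Metric.isOpen_ball.measurableSet,
    lintegral_logPolar (hQ.indicator Metric.isOpen_ball.measurableSet),
    ← lintegral_const_mul' _ _ ENNReal.ofReal_ne_top]
  rw [← lintegral_indicator measurableSet_Iio]
  refine lintegral_mono fun t => ?_
  by_cases ht : t ∈ Iio (Real.log R)
  swap
  · rw [indicator_of_notMem ht]; exact zero_le
  rw [indicator_of_mem ht]
  have hball : ∀ θ, logPolar (t, θ) ∈ Metric.ball (0 : Plane) R := fun θ => by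
    rw [Metric.mem_ball, dist_zero_right, norm_logPolar]
    exact (Real.lt_log_iff_exp_lt hR).1 ht
  simp only [indicator_of_mem (hball _), norm_logPolar]
  set X : ℝ → Plane := fun θ => logPolar (t, θ) with hX
  have hXm : Measurable X :=
    continuous_logPolar.measurable.comp (measurable_const.prodMk measurable_id)
  have h1 := angularMean_sq_le hxG t
  have h2 := angularMean_sq_le hφ t
  -- Only the radial derivative is kept: (x·G)² ≤ |x|²|G|² with |x|² = e^(2t), the difference being
  -- the square of the angular component.
  have h3 : ∫⁻ θ in Ioo (-Real.pi) Real.pi,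
      ENNReal.ofReal ((∑ k, logPolar (t, θ) k * G k (logPolar (t, θ))) ^ 2)
      ≤ ∫⁻ θ in Ioo (-Real.pi) Real.pi, ENNReal.ofReal (Real.exp (2 * t)) *
        ∑ k, ‖G k (logPolar (t, θ))‖ₑ ^ 2 := by
    refine lintegral_mono fun θ => ?_
    simp only [enorm_sq_eq_ofReal]
    rw [← ENNReal.ofReal_sum_of_nonneg fun k _ => sq_nonneg _, ← ENNReal.ofReal_mul
      (Real.exp_pos _).le]
    apply ENNReal.ofReal_le_ofReal
    have hn : Real.exp (2 * t) = logPolar (t, θ) 0 ^ 2 + logPolar (t, θ) 1 ^ 2 := by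
      rw [← norm_sq_plane, norm_logPolar, ← Real.exp_nat_mul]; push_cast; rfl
    rw [hn, Fin.sum_univ_two, Fin.sum_univ_two]
    set x := logPolar (t, θ)
    nlinarith [sq_nonneg (x 0 * G 1 x - x 1 * G 0 x)]
  have e1 : ENNReal.ofReal (2 * Real.pi * μ) = ENNReal.ofReal μ * ENNReal.ofReal (2 * Real.pi) := by
    rw [← ENNReal.ofReal_mul hμ.le]; congr 1; ring
  have e2 : ENNReal.ofReal μ * radialWeight μ v t
      = ENNReal.ofReal (Real.exp (2 * t)) * (v (Real.exp t) / 2) := by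
    rw [radialWeight, mul_left_comm, ← ENNReal.ofReal_mul hμ.le, ENNReal.div_eq_inv_mul,
      show μ * (Real.exp (2 * t) / (2 * μ)) = Real.exp (2 * t) * (2 : ℝ)⁻¹ by field_simp,
      ENNReal.ofReal_mul (Real.exp_pos _).le, ENNReal.ofReal_inv_of_pos (by norm_num),
      ENNReal.ofReal_ofNat]
    ring
  have hGm : Measurable fun θ => ENNReal.ofReal (Real.exp (2 * t)) *
      ∑ k, ‖G k (logPolar (t, θ))‖ₑ ^ 2 :=
    (Finset.measurable_sum _ fun k _ => (((hG k).comp hXm).enorm.pow_const 2)).const_mul _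
  have hφm : Measurable fun θ => ENNReal.ofReal (φ (logPolar (t, θ)) ^ 2) :=
    ((hφ.comp hXm).pow_const 2).ennreal_ofReal
  calc ENNReal.ofReal (2 * Real.pi * μ) *
        (ENNReal.ofReal (angularMean (fun x => ∑ k, x k * G k x) t ^ 2)
          + radialWeight μ v t * ENNReal.ofReal (angularMean φ t ^ 2))
      = ENNReal.ofReal μ * (ENNReal.ofReal (2 * Real.pi) *
          ENNReal.ofReal (angularMean (fun x => ∑ k, x k * G k x) t ^ 2))
        + (ENNReal.ofReal μ * radialWeight μ v t) * (ENNReal.ofReal (2 * Real.pi) *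
          ENNReal.ofReal (angularMean φ t ^ 2)) := by rw [e1]; ring
    _ ≤ ENNReal.ofReal μ * (∫⁻ θ in Ioo (-Real.pi) Real.pi, ENNReal.ofReal (Real.exp (2 * t)) *
          ∑ k, ‖G k (logPolar (t, θ))‖ₑ ^ 2)
        + (ENNReal.ofReal (Real.exp (2 * t)) * (v (Real.exp t) / 2)) *
          ∫⁻ θ in Ioo (-Real.pi) Real.pi, ENNReal.ofReal (φ (logPolar (t, θ)) ^ 2) := by
        rw [e2]
        gcongr
        exact h1.trans h3
    _ = _ := by
        rw [← lintegral_const_mul _ hGm, ← lintegral_const_mul _ hφm,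
          ← lintegral_add_left (hGm.const_mul _)]
        refine lintegral_congr fun θ => ?_
        simp only [enorm_sq_eq_ofReal]
        ring

/-- The scattering energy controls the radial variational problem. -/
lemma exists_slope_of_scatteringEnergy_lt {μ R e : ℝ} {v : ℝ → ℝ≥0∞} (hμ : 0 < μ)
    (hv : Measurable v) (hR : 0 < R)
    (hE : scatteringEnergy μ v R < ENNReal.ofReal (2 * Real.pi * μ * e)) :
    ∃ t₀ h, IsSlope t₀ (Real.log R) h ∧
      profileEnergy (radialWeight μ v) t₀ (Real.log R) h ≤ ENNReal.ofReal e := by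
  obtain ⟨_, ⟨φ₀, G₀, htrial, rfl⟩, hlt⟩ := sInf_lt_iff.1 hE
  have hφ₀ : AEStronglyMeasurable φ₀ volume := (htrial.weakDeriv 0).1.aestronglyMeasurable
  have hG₀ : ∀ k, AEStronglyMeasurable (G₀ k) volume := fun k =>
    (htrial.weakDeriv k).2.1.aestronglyMeasurable
  -- The trial function is only almost everywhere measurable, whereas the bounds on its circle means
  -- are proved for measurable functions; hence the passage to measurable representatives.
  set φ := hφ₀.mk φ₀ with hφdef
  set G : Fin 2 → Plane → ℝ := fun k => (hG₀ k).mk (G₀ k) with hGdef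
  have hφ : Measurable φ := hφ₀.stronglyMeasurable_mk.measurable
  have hG : ∀ k, Measurable (G k) := fun k => (hG₀ k).stronglyMeasurable_mk.measurable
  have hφe : φ₀ =ᵐ[volume] φ := hφ₀.ae_eq_mk
  have hGe : ∀ k, G₀ k =ᵐ[volume] G k := fun k => (hG₀ k).ae_eq_mk
  have hweak : ∀ k, HasWeakDeriv φ (G k) (unitVec k) := fun k =>
    (htrial.weakDeriv k).congr_ae hφe (hGe k)
  have hfun : scatteringFunctional μ v R φ₀ G₀ = scatteringFunctional μ v R φ G := by
    refine lintegral_congr_ae (ae_restrict_of_ae ?_)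
    filter_upwards [hφe, hGe 0, hGe 1] with x h1 h2 h3
    simp only [Fin.sum_univ_two, h1, h2, h3]
  rw [hfun] at hlt
  set f := angularMean φ with hf
  set γ : Plane → ℝ := fun x => ∑ k, x k * G k x with hγ
  set g := angularMean γ with hg
  have hγm : Measurable γ := Finset.measurable_sum _ fun k _ =>
    ((EuclideanSpace.proj k : Plane →L[ℝ] ℝ).continuous.measurable).mul (hG k)
  have hγi : LocallyIntegrable γ := by
    refine locallyIntegrable_finsetSum _ fun k _ => ?_
    have hc : Continuous fun x : Plane => x k := (EuclideanSpace.proj k : Plane →L[ℝ] ℝ).continuous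
    rw [← locallyIntegrableOn_univ]
    exact ((locallyIntegrableOn_univ.2 (hweak k).2.1).continuousOn_mul hc.continuousOn
      isOpen_univ.isLocallyClosed)
  have hgi : LocallyIntegrable g := locallyIntegrable_angularMean hγi
  have hgint : ∀ a b : ℝ, IntervalIntegrable g volume a b := fun a b =>
    (hgi.integrableOn_isCompact isCompact_uIcc).intervalIntegrable
  obtain ⟨C, hC⟩ := ae_eq_primitive_of_weakDeriv (locallyIntegrable_angularMean (hweak 0).1) hgi
    fun χ hχ hχc => angularMean_weakDeriv hweak hχ hχc
  set T := Real.log R with hT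
  have hone : ∀ᵐ t, T < t → f t = 1 := by
    have h1 : ∀ᵐ x : Plane, R ≤ ‖x‖ → φ x = 1 := by
      filter_upwards [hφe] with x hx hRx
      rw [← hx]; exact htrial.eq_one x hRx
    filter_upwards [ae_logPolar h1] with t ht hTt
    have h2 : ∫ θ in Ioo (-Real.pi) Real.pi, φ (logPolar (t, θ))
        = ∫ θ in Ioo (-Real.pi) Real.pi, (1 : ℝ) := by
      refine integral_congr_ae (ht.mono fun θ hθ => hθ ?_)
      rw [norm_logPolar]
      exact ((Real.log_lt_iff_lt_exp hR).1 hTt).le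
    rw [hf, angularMean, h2, setIntegral_const, Measure.real, Real.volume_Ioo,
      ENNReal.toReal_ofReal (by linarith [Real.pi_pos]), smul_eq_mul, mul_one,
      show Real.pi - -Real.pi = 2 * Real.pi by ring]
    exact inv_mul_cancel₀ (by positivity)
  have hcont : Continuous fun s => C + ∫ r in (0 : ℝ)..s, g r :=
    continuous_const.add (intervalIntegral.continuous_primitive hgint 0)
  -- The mean equals 1 almost everywhere beyond T. By continuity the primitive representing it
  -- equals 1 at T as well, which fixes the constant C.
  have hTone : C + ∫ r in (0 : ℝ)..T, g r = 1 := by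
    have h1 : (fun s => C + ∫ r in (0 : ℝ)..s, g r) =ᵐ[volume.restrict (Ioi T)] fun _ => (1 : ℝ) := by
      filter_upwards [ae_restrict_mem measurableSet_Ioi, ae_restrict_of_ae hone,
        ae_restrict_of_ae hC] with t h1 h2 h3
      rw [← h3]; exact h2 h1
    have h2 := Measure.eqOn_open_of_ae_eq h1 isOpen_Ioi hcont.continuousOn continuousOn_const
    have h3 := h2.closure hcont continuous_const
    exact h3 (by rw [closure_Ioi]; exact self_mem_Ici)
  refine exists_slope_of_primitive (f := f) (measurable_angularMean hγm) hgi ?_ ?_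
  · filter_upwards [hC] with t ht _
    have := intervalIntegral.integral_add_adjacent_intervals (hgint 0 t) (hgint t T)
    change f t = _ at ht
    rw [ht]; linarith
  · have hle := (angularMean_energy_le hμ hv hR hφ hG).trans_lt hlt
    rw [ENNReal.ofReal_mul (p := 2 * Real.pi * μ) (q := e) (by positivity)] at hle
    exact lt_of_mul_lt_mul_left' hle

/-- The one-body profile provided by the scattering length. -/
lemma exists_scatteringProfile_of_scatteringLength {μ R₀ R a b ℓ : ℝ} {v : ℝ → ℝ≥0∞} (hμ : 0 < μ)
    (hv : Measurable v) (hv0 : ∀ r, R₀ < r → v r = 0) (hRR : R₀ < R)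
    (ha : a = scatteringLength μ v R) (ha0 : 0 < a) (hℓ : 0 < ℓ)
    (hℓb : ℓ = Real.log b - Real.log a - 1) :
    ∃ U, IsScatteringProfile (radialWeight μ v) (Real.log b) ℓ U := by
  have he0 : scatteringEnergy μ v R ≠ 0 := by
    intro h0
    rw [scatteringLength, if_pos h0] at ha
    exact ha0.ne' ha
  rw [scatteringLength, if_neg he0] at ha
  have hR : 0 < R := by
    rw [ha] at ha0
    exact pos_of_mul_pos_left ha0 (Real.exp_pos _).le
  set x := (scatteringEnergy μ v R).toReal with hx
  have hloga : Real.log a = Real.log R - 2 * Real.pi * μ / x := by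
    rw [ha, Real.log_mul hR.ne' (Real.exp_pos _).ne', Real.log_exp]; ring
  have hwT : ∀ t, Real.log R < t → radialWeight μ v t = 0 := fun t ht => by
    have : R < Real.exp t := (Real.log_lt_iff_lt_exp hR).1 ht
    rw [radialWeight, hv0 _ (hRR.trans this), zero_mul]
  -- Giving up 1 from ln (R/a) makes the scattering energy strictly smaller than 2πμ/q, so some
  -- trial function lies below that value. This is the source of the -1 in ℓ.
  obtain ⟨q, hq⟩ : ∃ q, q = 2 * Real.pi * μ / x - 1 := ⟨_, rfl⟩
  -- If b lies beyond R the slope is extended up to log b; otherwise T' = log R and the profile is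
  -- later truncated inside.
  set T' := max (Real.log R) (Real.log b) with hT'
  have hT'R : Real.log R ≤ T' := le_max_left _ _
  have hT'b : Real.log b ≤ T' := le_max_right _ _
  have hqM : 0 < q + (T' - Real.log R) := by rw [hq]; linarith
  obtain ⟨t₀, h, H, hH⟩ : ∃ t₀ h, IsSlope t₀ T' h ∧
      profileEnergy (radialWeight μ v) t₀ T' h ≤ ENNReal.ofReal (1 / (q + (T' - Real.log R))) := by
    -- If q ≤ 0, the whole rise can take place beyond R, where the potential vanishes. This branch
    -- also absorbs the default value x = 0 for an infinite scattering energy, for which division by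
    -- zero gives q = -1.
    rcases le_or_gt q 0 with hq0 | hq0
    · obtain ⟨h, H, hH⟩ := exists_constant_slope (T' := T') hwT (by linarith)
      refine ⟨_, h, H, hH.trans (ENNReal.ofReal_le_ofReal ?_)⟩
      exact one_div_le_one_div_of_le hqM (by linarith)
    · have hx0 : 0 < x := by
        rcases (ENNReal.toReal_nonneg : 0 ≤ x).lt_or_eq with h | h
        · exact h
        · rw [hx.trans h.symm, div_zero] at hq; linarith
      have hfin : scatteringEnergy μ v R ≠ ⊤ := by
        intro htop; rw [hx, htop] at hx0; simp at hx0
      have hlt : scatteringEnergy μ v R < ENNReal.ofReal (2 * Real.pi * μ * (1 / q)) := by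
        rw [← ENNReal.ofReal_toReal hfin, ENNReal.ofReal_lt_ofReal_iff_of_nonneg hx0.le,
          mul_one_div, lt_div_iff₀ hq0]
        have : x * (2 * Real.pi * μ / x) = 2 * Real.pi * μ := by field_simp
        rw [hq, mul_sub, this]
        linarith
      obtain ⟨t₀, k, K, hK⟩ := exists_slope_of_scatteringEnergy_lt hμ hv hR hlt
      obtain ⟨h, H, hH⟩ := exists_extended_slope K hwT hq0 hT'R hK
      exact ⟨t₀, h, H, hH⟩
  refine exists_scatteringProfile (measurable_radialWeight hv)
    (fun t ht => hwT t (hT'R.trans_lt ht)) (by positivity) H hH hT'b hℓ ?_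
  rw [one_div_one_div, hℓb, hloga, hq]
  ring

/-! ### Periodization -/

/-- The lattice vector `L n`. -/
def latticeVec (L : ℝ) (n : Fin 2 → ℤ) : Plane := WithLp.toLp 2 fun k => L * (n k : ℝ)

@[simp] lemma latticeVec_apply (L : ℝ) (n : Fin 2 → ℤ) (k : Fin 2) :
    latticeVec L n k = L * n k := rfl

lemma latticeVec_add (L : ℝ) (m n : Fin 2 → ℤ) :
    latticeVec L (m + n) = latticeVec L m + latticeVec L n := by
  ext k; simp; ring

lemma latticeVec_neg (L : ℝ) (n : Fin 2 → ℤ) : latticeVec L (-n) = -latticeVec L n := by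
  ext k; simp

lemma latticeVec_single (L : ℝ) (k : Fin 2) : latticeVec L (Pi.single k 1) = L • unitVec k := by
  ext j
  rcases eq_or_ne j k with rfl | h
  · simp [unitVec]
  · simp [unitVec, h]

/-- The fundamental cell `[0, L)²`. -/
def cell (L : ℝ) : Set Plane := {x | ∀ k, x k ∈ Ico 0 L}

lemma measurable_coord (k : Fin 2) : Measurable fun x : Plane => x k :=
  (EuclideanSpace.proj k : Plane →L[ℝ] ℝ).continuous.measurable

lemma measurableSet_cell (L : ℝ) : MeasurableSet (cell L) := by
  have : cell L = ⋂ k, (fun x : Plane => x k) ⁻¹' Ico 0 L := by ext x; simp [cell]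
  rw [this]
  exact MeasurableSet.iInter fun k => measurable_coord k measurableSet_Ico

lemma volume_cell {L : ℝ} (hL : 0 < L) : volume (cell L) = ENNReal.ofReal (L ^ 2) := by
  have h1 : (WithLp.toLp 2 : (Fin 2 → ℝ) → Plane) ⁻¹' cell L = Set.pi univ fun _ => Ico 0 L := by
    ext x; simp [cell]
  rw [← (PiLp.volume_preserving_toLp (Fin 2)).measure_preimage
    (measurableSet_cell L).nullMeasurableSet, h1, volume_pi_pi]
  simp [Real.volume_Ico]
  rw [ENNReal.ofReal_pow hL.le]

lemma tsum_indicator_cell {L : ℝ} (hL : 0 < L) (x : Plane) :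
    ∑' n : Fin 2 → ℤ, (cell L).indicator (fun _ => (1 : ℝ≥0∞)) (x + latticeVec L n) = 1 := by
  rw [tsum_eq_single (fun k => -⌊x k / L⌋)]
  · rw [indicator_of_mem]
    intro k
    have h1 := Int.floor_le (x k / L)
    have h2 := Int.lt_floor_add_one (x k / L)
    rw [le_div_iff₀ hL] at h1
    rw [div_lt_iff₀ hL] at h2
    simp only [PiLp.add_apply, latticeVec_apply]
    push_cast
    constructor <;> linarith
  · intro n hn
    rw [indicator_of_notMem]
    intro hmem
    apply hn
    funext k
    have h := hmem k
    simp only [PiLp.add_apply, latticeVec_apply] at h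
    have h3 : ⌊x k / L⌋ = -n k := by
      rw [Int.floor_eq_iff, le_div_iff₀ hL, div_lt_iff₀ hL]
      push_cast
      constructor <;> [linarith [h.1]; linarith [h.2]]
    rw [h3]; ring

/-- Unfolding of a periodized integral. -/
lemma lintegral_cell_tsum {L : ℝ} (hL : 0 < L) {A : Plane → ℝ≥0∞} (hA : Measurable A) :
    ∫⁻ x in cell L, ∑' n : Fin 2 → ℤ, A (x + latticeVec L n) = ∫⁻ x, A x := by
  have hm : ∀ n : Fin 2 → ℤ, Measurable fun x : Plane => A (x + latticeVec L n) := fun n =>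
    hA.comp (measurable_id.add_const _)
  rw [lintegral_tsum fun n => (hm n).aemeasurable]
  have h1 : ∀ n : Fin 2 → ℤ, ∫⁻ x in cell L, A (x + latticeVec L n)
      = ∫⁻ x, (cell L).indicator (fun _ => (1 : ℝ≥0∞)) (x + latticeVec L (-n)) * A x := by
    intro n
    rw [← lintegral_indicator (measurableSet_cell L), ← lintegral_add_right_eq_self
      (fun x => (cell L).indicator (fun _ => (1 : ℝ≥0∞)) (x + latticeVec L (-n)) * A x)
      (latticeVec L n)]
    refine lintegral_congr fun x => ?_
    rw [latticeVec_neg, add_neg_cancel_right]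
    by_cases hx : x ∈ cell L
    · simp [hx]
    · simp [hx]
  simp_rw [h1]
  rw [← lintegral_tsum]
  · refine lintegral_congr fun x => ?_
    have h2 := (Equiv.neg (Fin 2 → ℤ)).tsum_eq
      (fun n => (cell L).indicator (fun _ => (1 : ℝ≥0∞)) (x + latticeVec L n))
    simp only [Equiv.neg_apply] at h2
    rw [ENNReal.tsum_mul_right, h2, tsum_indicator_cell hL, one_mul]
  · intro n
    refine ((Measurable.indicator measurable_const (measurableSet_cell L)).comp
      (measurable_id.add_const _)).mul hA |>.aemeasurable

/-- The integral of a periodic function over a cell is translation invariant. -/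
lemma lintegral_cell_sub {L : ℝ} (hL : 0 < L) {A : Plane → ℝ≥0∞} (hA : Measurable A)
    (hper : ∀ n x, A (x + latticeVec L n) = A x) (y : Plane) :
    ∫⁻ x in cell L, A (x - y) = ∫⁻ x in cell L, A x := by
  set B : Plane → ℝ≥0∞ := fun x => (cell L).indicator A (x - y) with hB
  have hBm : Measurable B := (hA.indicator (measurableSet_cell L)).comp (measurable_id.sub_const y)
  have h1 : ∀ x, ∑' n : Fin 2 → ℤ, B (x + latticeVec L n) = A (x - y) := by
    intro x
    have : ∀ n : Fin 2 → ℤ, B (x + latticeVec L n)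
        = (cell L).indicator (fun _ => (1 : ℝ≥0∞)) (x - y + latticeVec L n) * A (x - y) := by
      intro n
      simp only [hB]
      rw [add_sub_right_comm]
      by_cases hx : x - y + latticeVec L n ∈ cell L
      · rw [indicator_of_mem hx, indicator_of_mem hx, hper, one_mul]
      · rw [indicator_of_notMem hx, indicator_of_notMem hx, zero_mul]
    simp_rw [this]
    rw [ENNReal.tsum_mul_right, tsum_indicator_cell hL, one_mul]
  have h2 := lintegral_cell_tsum hL hBm
  simp_rw [h1] at h2
  rw [h2, hB, lintegral_sub_right_eq_self, lintegral_indicator (measurableSet_cell L)]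

/-- The distance to the lattice. -/
def latticeDist (L : ℝ) (x : Plane) : ℝ := Metric.infDist x (range (latticeVec L))

lemma latticeDist_le (L : ℝ) (x : Plane) (n : Fin 2 → ℤ) :
    latticeDist L x ≤ ‖x + latticeVec L n‖ := by
  have := Metric.infDist_le_dist_of_mem (x := x) (mem_range_self (f := latticeVec L) (-n))
  rwa [latticeVec_neg, dist_eq_norm, sub_neg_eq_add] at this

/-- The lattice is square, so rounding each coordinate separately gives a nearest lattice point. -/
lemma exists_latticeDist_eq {L : ℝ} (hL : 0 < L) (x : Plane) :
    ∃ n, latticeDist L x = ‖x + latticeVec L n‖ := by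
  refine ⟨fun k => -round (x k / L), le_antisymm (latticeDist_le L x _) ?_⟩
  refine (Metric.le_infDist (range_nonempty _)).2 ?_
  rintro _ ⟨m, rfl⟩
  rw [dist_eq_norm, ← sq_le_sq₀ (norm_nonneg _) (norm_nonneg _), norm_sq_plane, norm_sq_plane]
  have h : ∀ k, (x + latticeVec L fun k => -round (x k / L)) k ^ 2 ≤ (x - latticeVec L m) k ^ 2 := by
    intro k
    have h1 := round_le (x k / L) (m k)
    simp only [PiLp.add_apply, PiLp.sub_apply, latticeVec_apply]
    have e1 : x k + L * ((-round (x k / L) : ℤ) : ℝ) = L * (x k / L - round (x k / L)) := by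
      push_cast; field_simp; ring
    have e2 : x k - L * (m k : ℝ) = L * (x k / L - m k) := by field_simp
    rw [e1, e2, mul_pow, mul_pow]
    gcongr ?_ * ?_
    exact sq_le_sq.2 h1
  exact add_le_add (h 0) (h 1)

lemma latticeDist_add {L : ℝ} (hL : 0 < L) (x : Plane) (m : Fin 2 → ℤ) :
    latticeDist L (x + latticeVec L m) = latticeDist L x := by
  refine le_antisymm ?_ ?_
  · obtain ⟨n, hn⟩ := exists_latticeDist_eq hL x
    rw [hn]
    refine (latticeDist_le L _ (n - m)).trans (le_of_eq ?_)
    rw [sub_eq_add_neg, latticeVec_add, latticeVec_neg]; congr 1; abel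
  · obtain ⟨n, hn⟩ := exists_latticeDist_eq hL (x + latticeVec L m)
    rw [hn]
    refine (latticeDist_le L _ (m + n)).trans (le_of_eq ?_)
    rw [latticeVec_add, add_assoc]

lemma latticeDist_neg {L : ℝ} (hL : 0 < L) (x : Plane) : latticeDist L (-x) = latticeDist L x := by
  have key : ∀ y, latticeDist L (-y) ≤ latticeDist L y := by
    intro y
    obtain ⟨n, hn⟩ := exists_latticeDist_eq hL y
    rw [hn]
    refine (latticeDist_le L _ (-n)).trans (le_of_eq ?_)
    rw [latticeVec_neg, ← neg_add, norm_neg]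
  refine le_antisymm (key x) ?_
  simpa using key (-x)

lemma measurable_periodicPotential {v : ℝ → ℝ≥0∞} (hv : Measurable v) (L : ℝ) :
    Measurable (periodicPotential v L) := by
  refine Measurable.tsum fun n => ?_
  exact hv.comp (measurable_norm.comp (measurable_id.add_const _))

lemma periodicPotential_add (v : ℝ → ℝ≥0∞) (L : ℝ) (m : Fin 2 → ℤ) (x : Plane) :
    periodicPotential v L (x + latticeVec L m) = periodicPotential v L x := by
  change ∑' n : Fin 2 → ℤ, v ‖x + latticeVec L m + latticeVec L n‖
    = ∑' n : Fin 2 → ℤ, v ‖x + latticeVec L n‖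
  rw [← (Equiv.addLeft m).tsum_eq (fun n => v ‖x + latticeVec L n‖)]
  refine tsum_congr fun n => ?_
  rw [Equiv.coe_addLeft, latticeVec_add, add_assoc]

lemma periodicPotential_neg (v : ℝ → ℝ≥0∞) (L : ℝ) (x : Plane) :
    periodicPotential v L (-x) = periodicPotential v L x := by
  change ∑' n : Fin 2 → ℤ, v ‖-x + latticeVec L n‖ = ∑' n : Fin 2 → ℤ, v ‖x + latticeVec L n‖
  rw [← (Equiv.neg (Fin 2 → ℤ)).tsum_eq (fun n => v ‖x + latticeVec L n‖)]
  refine tsum_congr fun n => ?_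
  rw [Equiv.neg_apply, latticeVec_neg, ← norm_neg]
  congr 2
  abel

/-! ### The periodic pair function -/

/-- A periodic Lipschitz pair function with values in `[0, 1]`, with bounds on its defect, its
energy and its gradient over a cell. -/
structure IsPairFunction (μ : ℝ) (v : ℝ → ℝ≥0∞) (L : ℝ) (F : Plane → ℝ) (I J K : ℝ) : Prop where
  lipschitz : ∃ C, LipschitzWith C F
  nonneg : ∀ x, 0 ≤ F x
  le_one : ∀ x, F x ≤ 1
  even : ∀ x, F (-x) = F x
  periodic : ∀ n x, F (x + latticeVec L n) = F x
  defect_le : ∫⁻ x in cell L, ENNReal.ofReal (1 - F x ^ 2) ≤ ENNReal.ofReal I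
  energy_le : ∫⁻ x in cell L, (ENNReal.ofReal μ * ‖fderiv ℝ F x‖ₑ ^ 2
    + periodicPotential v L x / 2 * ENNReal.ofReal (F x ^ 2)) ≤ ENNReal.ofReal J
  gradient_le : ∫⁻ x in cell L, ENNReal.ofReal (F x) * ‖fderiv ℝ F x‖ₑ ≤ ENNReal.ofReal K

/-- By the radial integration formula a null set of logarithmic radii lifts to a null set of the
plane. This transfers the almost everywhere differentiability of U to radial functions. -/
lemma ae_log_norm {P : ℝ → Prop} (hP : ∀ᵐ t, P t) : ∀ᵐ x : Plane, P (Real.log ‖x‖) := by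
  set N := toMeasurable volume {t | ¬ P t} with hN
  have hNm : MeasurableSet N := measurableSet_toMeasurable _ _
  have hN0 : volume N = 0 := by rw [hN, measure_toMeasurable]; exact hP
  have hNP : ∀ t, t ∉ N → P t := fun t ht => by
    by_contra hcon
    exact ht (subset_toMeasurable _ _ hcon)
  have hq : Measurable fun r : ℝ => N.indicator (fun _ => (1 : ℝ≥0∞)) (Real.log r) :=
    (measurable_const.indicator hNm).comp Real.measurable_log
  have h1 := lintegral_radial hq
  have h2 : ∫⁻ t, ENNReal.ofReal (Real.exp (2 * t)) *
      N.indicator (fun _ => (1 : ℝ≥0∞)) (Real.log (Real.exp t)) = 0 := by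
    have h3 : ∀ᵐ t, t ∉ N := by rw [ae_iff]; simpa using hN0
    refine (lintegral_congr_ae (g := fun _ => 0) (h3.mono fun t ht => ?_)).trans lintegral_zero
    simp [Real.log_exp, ht]
  rw [h2, mul_zero] at h1
  have h4 := (lintegral_eq_zero_iff (hq.comp (measurable_norm (α := Plane)))).1 h1
  filter_upwards [h4] with x hx
  apply hNP
  intro hmem
  simp [hmem] at hx

namespace IsScatteringProfile

variable {w : ℝ → ℝ≥0∞} {t₁ ℓ : ℝ} {U : ℝ → ℝ}

lemma abs_deriv_le (H : IsScatteringProfile w t₁ ℓ U) (hℓ : 0 < ℓ) (t : ℝ) :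
    |deriv U t| ≤ 1 / ℓ := by
  have hlip : LipschitzWith (Real.toNNReal (1 / ℓ)) U := by
    refine LipschitzWith.of_le_add_mul _ fun s t => ?_
    rw [Real.coe_toNNReal _ (by positivity), Real.dist_eq]
    rcases le_total s t with h | h
    · have h1 := H.mono h
      have : 0 ≤ 1 / ℓ * |s - t| := by positivity
      linarith
    · have h1 := H.sub_le t s h
      rw [abs_of_nonneg (by linarith), one_div_mul_eq_div]
      linarith
  have := norm_deriv_le_of_lipschitz hlip (x₀ := t)
  rwa [Real.coe_toNNReal _ (by positivity), Real.norm_eq_abs] at this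

lemma deriv_eq_zero (H : IsScatteringProfile w t₁ ℓ U) {t : ℝ} (ht : t₁ < t) : deriv U t = 0 := by
  have : U =ᶠ[𝓝 t] fun _ => 1 := by
    filter_upwards [Ioi_mem_nhds ht] with s hs using H.eq_one s (le_of_lt hs)
  rw [this.deriv_eq]; simp

end IsScatteringProfile

lemma lintegral_exp_Iic {b : ℝ} (hb : 0 < b) :
    ∫⁻ t in Iic (Real.log b), ENNReal.ofReal (Real.exp t) = ENNReal.ofReal b := by
  have h := lintegral_exp_substitution ((Iic b).indicator fun _ => 1)
  rw [lintegral_indicator measurableSet_Iic, Measure.restrict_restrict measurableSet_Iic,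
    lintegral_one, Measure.restrict_apply_univ, Iic_inter_Ioi, Real.volume_Ioc, sub_zero] at h
  rw [h, ← lintegral_indicator measurableSet_Iic]
  refine lintegral_congr fun t => ?_
  by_cases ht : t ≤ Real.log b
  · have h1 : Real.exp t ≤ b := (Real.le_log_iff_exp_le hb).1 ht
    rw [indicator_of_mem (by exact ht), indicator_of_mem (by exact h1), mul_one]
  · have h1 : ¬ Real.exp t ≤ b := fun hc => ht ((Real.le_log_iff_exp_le hb).2 hc)
    rw [indicator_of_notMem (by exact ht), indicator_of_notMem (by exact h1), mul_zero]

lemma log_max_lipschitz {r₀ : ℝ} (hr₀ : 0 < r₀) {s t : ℝ} (hst : s ≤ t) :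
    Real.log (max t r₀) - Real.log (max s r₀) ≤ (t - s) / r₀ := by
  have hs : 0 < max s r₀ := lt_max_of_lt_right hr₀
  have ht : 0 < max t r₀ := lt_max_of_lt_right hr₀
  have hmm : max t r₀ - max s r₀ ≤ t - s := by
    rcases max_cases t r₀ with h | h <;> rcases max_cases s r₀ with h' | h' <;> linarith
  have hmm0 : max s r₀ ≤ max t r₀ := max_le_max hst le_rfl
  rw [← Real.log_div ht.ne' hs.ne']
  calc Real.log (max t r₀ / max s r₀) ≤ max t r₀ / max s r₀ - 1 :=
        Real.log_le_sub_one_of_pos (by positivity)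
    _ = (max t r₀ - max s r₀) / max s r₀ := by field_simp
    _ ≤ (t - s) / r₀ := by
        apply div_le_div₀ (by linarith) hmm hr₀ (le_max_right _ _)

/-- Every scattering profile yields a periodic pair function. -/
lemma exists_pairFunction {μ b ℓ L : ℝ} {v : ℝ → ℝ≥0∞} {U : ℝ → ℝ} (hμ : 0 < μ)
    (hv : Measurable v) (hb : 0 < b) (hℓ : 0 < ℓ) (hL : 0 < L)
    (H : IsScatteringProfile (radialWeight μ v) (Real.log b) ℓ U) :
    ∃ F, IsPairFunction μ v L F (4 * Real.pi * b ^ 2 / ℓ) (2 * Real.pi * μ / ℓ)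
      (2 * Real.pi * b / ℓ) := by
  obtain ⟨t₀, ht₀⟩ := H.exists_eq_zero
  set r₀ := Real.exp t₀ with hr₀
  have hr₀p : 0 < r₀ := Real.exp_pos _
  -- U vanishes up to t₀, so freezing the radius at r₀ changes nothing for r > 0 and removes the
  -- singularity of the logarithm: u is Lipschitz down to r = 0.
  set u : ℝ → ℝ := fun r => U (Real.log (max r r₀)) with hu
  have hu_log : ∀ r, 0 < r → u r = U (Real.log r) := by
    intro r hr
    simp only [hu]
    rcases le_total r r₀ with h | h
    · rw [max_eq_right h, hr₀, Real.log_exp, ht₀ t₀ le_rfl,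
        ht₀ (Real.log r) ((Real.log_le_iff_le_exp hr).2 h)]
    · rw [max_eq_left h]
  have humono : Monotone u := fun r s hrs =>
    H.mono (Real.log_le_log (lt_max_of_lt_right hr₀p) (max_le_max hrs le_rfl))
  have hu0 : ∀ r, 0 ≤ u r := fun r => H.nonneg _
  have hu1 : ∀ r, u r ≤ 1 := fun r => H.le_one _
  have hulip : LipschitzWith (Real.toNNReal (1 / (r₀ * ℓ))) u := by
    refine LipschitzWith.of_le_add_mul _ fun s t => ?_
    rw [Real.coe_toNNReal _ (by positivity), Real.dist_eq]
    rcases le_total s t with h | h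
    · have h1 := humono h
      have : 0 ≤ 1 / (r₀ * ℓ) * |s - t| := by positivity
      linarith
    · have h1 := H.sub_le (Real.log (max t r₀)) (Real.log (max s r₀))
        (Real.log_le_log (lt_max_of_lt_right hr₀p) (max_le_max h le_rfl))
      have h2 := log_max_lipschitz hr₀p h
      have h3 : (Real.log (max s r₀) - Real.log (max t r₀)) / ℓ ≤ (s - t) / r₀ / ℓ := by gcongr
      rw [abs_of_nonneg (by linarith)]
      have h4 : 1 / (r₀ * ℓ) * (s - t) = (s - t) / r₀ / ℓ := by field_simp
      rw [h4]
      simp only [hu]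
      linarith
  -- Because u is nondecreasing, F lies below the profile of every image. Every density of F is
  -- therefore bounded by a sum over images, which unfolds to a radial integral over the plane, and
  -- b need not be small compared with L.
  set F : Plane → ℝ := fun x => u (latticeDist L x) with hF
  have hFlip : LipschitzWith (Real.toNNReal (1 / (r₀ * ℓ)) * 1) F :=
    hulip.comp (Metric.lipschitz_infDist_pt _)
  have hFle : ∀ x n, F x ≤ u ‖x + latticeVec L n‖ := fun x n => humono (latticeDist_le L x n)
  -- radial functions on the plane
  have hUm : Measurable U := H.mono.measurable
  have hum : Measurable u := humono.measurable
  have hDm : Measurable (deriv U) := measurable_deriv U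
  set A₁ : ℝ → ℝ≥0∞ := fun r => ENNReal.ofReal (1 - u r ^ 2) with hA₁
  set D : ℝ → ℝ := fun r => |deriv U (Real.log r)| / r with hD
  have hDmeas : Measurable D := by
    have h1 : Measurable fun r => deriv U (Real.log r) := hDm.comp Real.measurable_log
    exact (measurable_norm.comp h1).div measurable_id
  set A₂ : ℝ → ℝ≥0∞ := fun r => ENNReal.ofReal (u r) * ENNReal.ofReal (D r) with hA₂
  set A₃ : ℝ → ℝ≥0∞ := fun r => ENNReal.ofReal μ * ENNReal.ofReal (D r ^ 2) with hA₃
  set A₄ : ℝ → ℝ≥0∞ := fun r => v r / 2 * ENNReal.ofReal (u r ^ 2) with hA₄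
  have hA₁m : Measurable A₁ := (measurable_const.sub (hum.pow_const 2)).ennreal_ofReal
  have hA₂m : Measurable A₂ := hum.ennreal_ofReal.mul hDmeas.ennreal_ofReal
  have hA₃m : Measurable A₃ := (hDmeas.pow_const 2).ennreal_ofReal.const_mul _
  have hA₄m : Measurable A₄ := (hv.div_const 2).mul (hum.pow_const 2).ennreal_ofReal
  have hper : ∀ {A : ℝ → ℝ≥0∞}, Measurable A →
      ∫⁻ x in cell L, ∑' n : Fin 2 → ℤ, A ‖x + latticeVec L n‖
        = ENNReal.ofReal (2 * Real.pi) *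
          ∫⁻ t, ENNReal.ofReal (Real.exp (2 * t)) * A (Real.exp t) := by
    intro A hA
    rw [lintegral_cell_tsum hL (A := fun x => A ‖x‖) (hA.comp measurable_norm), lintegral_radial hA]
  have huexp : ∀ t, u (Real.exp t) = U t := fun t => by
    rw [hu_log _ (Real.exp_pos _), Real.log_exp]
  -- the gradient
  have hgrad : ∀ᵐ x : Plane, ∃ n, F x = u ‖x + latticeVec L n‖ ∧
      ‖fderiv ℝ F x‖ₑ ≤ ENNReal.ofReal (D ‖x + latticeVec L n‖) := by
    have hUd : ∀ᵐ t, DifferentiableAt ℝ U t := H.mono.ae_differentiableAt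
    have h1 : ∀ᵐ x : Plane, ∀ n : Fin 2 → ℤ,
        DifferentiableAt ℝ U (Real.log ‖x + latticeVec L n‖) ∧ x + latticeVec L n ≠ 0 := by
      rw [ae_all_iff]
      intro n
      have h2 : ∀ᵐ x : Plane, x ≠ 0 := by simp [ae_iff]
      have h3 := (ae_log_norm hUd).and h2
      exact (measurePreserving_add_right volume (latticeVec L n)).quasiMeasurePreserving.ae h3
    filter_upwards [h1, hFlip.ae_differentiableAt] with x hx hFx
    obtain ⟨n, hn⟩ := exists_latticeDist_eq hL x
    have hFn : F x = u ‖x + latticeVec L n‖ := by simp only [hF, hn]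
    refine ⟨n, hFn, ?_⟩
    set y := x + latticeVec L n with hy
    obtain ⟨hUy, hy0⟩ := hx n
    have hyn : 0 < ‖y‖ := norm_pos_iff.2 hy0
    have hnorm : HasFDerivAt (fun z : Plane => ‖z‖) (fderiv ℝ (fun z : Plane => ‖z‖) y) y :=
      ((contDiffAt_norm ℝ hy0).differentiableAt (n := 1) (by norm_num)).hasFDerivAt
    have hnormle : ‖fderiv ℝ (fun z : Plane => ‖z‖) y‖ ≤ 1 := by
      have := norm_fderiv_le_of_lipschitz ℝ (x₀ := y) (lipschitzWith_one_norm (E := Plane))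
      simpa using this
    have hf : HasFDerivAt (fun z : Plane => U (Real.log ‖z‖))
        (deriv U (Real.log ‖y‖) • (‖y‖⁻¹ • fderiv ℝ (fun z : Plane => ‖z‖) y)) y :=
      hUy.hasDerivAt.comp_hasFDerivAt y (hnorm.log hyn.ne')
    have hshift : HasFDerivAt (fun z : Plane => u ‖z + latticeVec L n‖)
        (deriv U (Real.log ‖y‖) • (‖y‖⁻¹ • fderiv ℝ (fun z : Plane => ‖z‖) y)) x := by
      have h2 : HasFDerivAt (fun z : Plane => u ‖z‖)
          (deriv U (Real.log ‖y‖) • (‖y‖⁻¹ • fderiv ℝ (fun z : Plane => ‖z‖) y)) y := by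
        refine hf.congr_of_eventuallyEq ?_
        filter_upwards [isOpen_ne.mem_nhds hy0] with z hz
        exact hu_log _ (norm_pos_iff.2 hz)
      have h3 : HasFDerivAt (fun z : Plane => z + latticeVec L n) (ContinuousLinearMap.id ℝ Plane) x :=
        (hasFDerivAt_id x).add_const _
      have h4 := h2.comp x h3
      rwa [ContinuousLinearMap.comp_id] at h4
    -- The profile of the nearest image lies above F and touches it at x. Where both are
    -- differentiable the gradients agree, so no analysis of the cut locus is needed.
    have hmin : IsLocalMin (fun z => u ‖z + latticeVec L n‖ - F z) x := by
      refine Eventually.of_forall fun z => ?_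
      have := hFle z n
      change u ‖x + latticeVec L n‖ - F x ≤ _
      rw [hFn]; linarith
    have hzero := hmin.hasFDerivAt_eq_zero (hshift.sub hFx.hasFDerivAt)
    have heq : fderiv ℝ F x
        = deriv U (Real.log ‖y‖) • (‖y‖⁻¹ • fderiv ℝ (fun z : Plane => ‖z‖) y) :=
      (sub_eq_zero.1 hzero).symm
    rw [← ofReal_norm, heq, norm_smul, norm_smul]
    apply ENNReal.ofReal_le_ofReal
    simp only [hD, Real.norm_eq_abs, abs_of_pos (inv_pos.2 hyn)]
    rw [div_eq_mul_inv]
    gcongr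
    exact mul_le_of_le_one_right (by positivity) hnormle
  refine ⟨F, ⟨_, hFlip⟩, fun x => hu0 _, fun x => hu1 _, fun x => ?_, fun n x => ?_, ?_, ?_, ?_⟩
  · simp only [hF, latticeDist_neg hL]
  · simp only [hF, latticeDist_add hL]
  · -- defect
    calc ∫⁻ x in cell L, ENNReal.ofReal (1 - F x ^ 2)
        ≤ ∫⁻ x in cell L, ∑' n : Fin 2 → ℤ, A₁ ‖x + latticeVec L n‖ := by
          refine lintegral_mono fun x => ?_
          obtain ⟨n, hn⟩ := exists_latticeDist_eq hL x
          refine le_trans (le_of_eq ?_) (ENNReal.le_tsum n)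
          simp only [hF, hA₁, hn]
      _ = ENNReal.ofReal (2 * Real.pi) *
          ∫⁻ t, ENNReal.ofReal (Real.exp (2 * t)) * A₁ (Real.exp t) := hper hA₁m
      _ ≤ ENNReal.ofReal (2 * Real.pi) * ∫⁻ t in Iic (Real.log b),
          ENNReal.ofReal (2 * b / ℓ) * ENNReal.ofReal (Real.exp t) := by
          refine mul_le_mul' le_rfl ?_
          rw [← lintegral_indicator measurableSet_Iic]
          refine lintegral_mono fun t => ?_
          simp only [hA₁, huexp]
          by_cases ht : t ∈ Iic (Real.log b)
          · rw [indicator_of_mem ht, ← ENNReal.ofReal_mul (Real.exp_pos _).le,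
              ← ENNReal.ofReal_mul (by positivity)]
            apply ENNReal.ofReal_le_ofReal
            have h1 := H.sub_le t (Real.log b) ht
            rw [H.eq_one _ le_rfl] at h1
            -- The inequality ln (b/r) ≤ b/r leaves a factor e^t after multiplication by e^(2t), and
            -- its integral up to log b is b; this yields the order b²/ℓ.
            have h2 : Real.log b - t ≤ b * Real.exp (-t) := by
              have h3 := Real.log_le_sub_one_of_pos (x := b * Real.exp (-t)) (by positivity)
              rw [Real.log_mul hb.ne' (Real.exp_pos _).ne', Real.log_exp] at h3
              linarith
            have h3 : 1 - U t ^ 2 ≤ 2 * (b * Real.exp (-t) / ℓ) := by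
              have h4 : (Real.log b - t) / ℓ ≤ b * Real.exp (-t) / ℓ := by gcongr
              nlinarith [H.nonneg t, H.le_one t]
            calc Real.exp (2 * t) * (1 - U t ^ 2)
                ≤ Real.exp (2 * t) * (2 * (b * Real.exp (-t) / ℓ)) := by gcongr
              _ = 2 * b / ℓ * (Real.exp (2 * t) * Real.exp (-t)) := by ring
              _ = 2 * b / ℓ * Real.exp t := by rw [← Real.exp_add]; ring_nf
          · rw [indicator_of_notMem ht, H.eq_one t (le_of_lt (not_le.1 ht))]
            simp
      _ = ENNReal.ofReal (4 * Real.pi * b ^ 2 / ℓ) := by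
          rw [lintegral_const_mul' _ _ ENNReal.ofReal_ne_top, lintegral_exp_Iic hb,
            ← ENNReal.ofReal_mul (by positivity), ← ENNReal.ofReal_mul (by positivity)]
          congr 1; field_simp; ring
  · -- energy
    calc _ ≤ ∫⁻ x in cell L, ∑' n : Fin 2 → ℤ, (A₃ ‖x + latticeVec L n‖ + A₄ ‖x + latticeVec L n‖) := by
          refine lintegral_mono_ae (ae_restrict_of_ae (hgrad.mono fun x hx => ?_))
          rw [ENNReal.summable.tsum_add ENNReal.summable]
          refine add_le_add ?_ ?_
          · obtain ⟨n, -, hn⟩ := hx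
            refine le_trans ?_ (ENNReal.le_tsum n)
            simp only [hA₃]
            have hD0 : 0 ≤ D ‖x + latticeVec L n‖ := div_nonneg (abs_nonneg _) (norm_nonneg _)
            rw [ENNReal.ofReal_pow hD0]
            gcongr
          · change (∑' n : Fin 2 → ℤ, v ‖x + latticeVec L n‖) / 2 * _ ≤ _
            rw [ENNReal.div_eq_inv_mul, mul_assoc, ← ENNReal.tsum_mul_right, ← ENNReal.tsum_mul_left]
            refine ENNReal.tsum_le_tsum fun n => ?_
            simp only [hA₄]
            rw [ENNReal.div_eq_inv_mul, mul_assoc]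
            gcongr
            · exact hu0 _
            · exact hFle x n
      _ = ENNReal.ofReal (2 * Real.pi) * ∫⁻ t, ENNReal.ofReal (Real.exp (2 * t)) *
          (A₃ (Real.exp t) + A₄ (Real.exp t)) := hper (A := fun r => A₃ r + A₄ r) (hA₃m.add hA₄m)
      _ = ENNReal.ofReal (2 * Real.pi) * (ENNReal.ofReal μ *
          ∫⁻ t, (ENNReal.ofReal (deriv U t ^ 2) + radialWeight μ v t * ENNReal.ofReal (U t ^ 2))) := by
          rw [← lintegral_const_mul' (ENNReal.ofReal μ) _ ENNReal.ofReal_ne_top]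
          congr 1
          refine lintegral_congr fun t => ?_
          simp only [hA₃, hA₄, huexp, hD, Real.log_exp, radialWeight]
          have e1 : ENNReal.ofReal (Real.exp (2 * t)) *
              ENNReal.ofReal ((|deriv U t| / Real.exp t) ^ 2) = ENNReal.ofReal (deriv U t ^ 2) := by
            rw [← ENNReal.ofReal_mul (Real.exp_pos _).le, div_pow, sq_abs, ← Real.exp_nat_mul]
            congr 1
            push_cast
            field_simp
          have e2 : ENNReal.ofReal μ * ENNReal.ofReal (Real.exp (2 * t) / (2 * μ))
              = ENNReal.ofReal (Real.exp (2 * t)) * 2⁻¹ := by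
            rw [← ENNReal.ofReal_mul hμ.le,
              show μ * (Real.exp (2 * t) / (2 * μ)) = Real.exp (2 * t) * (2 : ℝ)⁻¹ by field_simp,
              ENNReal.ofReal_mul (Real.exp_pos _).le, ENNReal.ofReal_inv_of_pos (by norm_num),
              ENNReal.ofReal_ofNat]
          rw [mul_add, mul_add, mul_left_comm, e1, ENNReal.div_eq_inv_mul]
          congr 1
          calc _ = v (Real.exp t) * ENNReal.ofReal (U t ^ 2) *
                (ENNReal.ofReal (Real.exp (2 * t)) * 2⁻¹) := by ring
            _ = _ := by rw [← e2]; ring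
      _ ≤ ENNReal.ofReal (2 * Real.pi) * (ENNReal.ofReal μ * ENNReal.ofReal (1 / ℓ)) := by
          gcongr; exact H.energy_le
      _ = ENNReal.ofReal (2 * Real.pi * μ / ℓ) := by
          rw [← ENNReal.ofReal_mul hμ.le, ← ENNReal.ofReal_mul (by positivity)]
          congr 1; field_simp
  · -- gradient
    calc ∫⁻ x in cell L, ENNReal.ofReal (F x) * ‖fderiv ℝ F x‖ₑ
        ≤ ∫⁻ x in cell L, ∑' n : Fin 2 → ℤ, A₂ ‖x + latticeVec L n‖ := by
          refine lintegral_mono_ae (ae_restrict_of_ae (hgrad.mono fun x hx => ?_))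
          obtain ⟨n, hn, hn'⟩ := hx
          refine le_trans ?_ (ENNReal.le_tsum n)
          simp only [hA₂]
          rw [hn]
          gcongr
      _ = ENNReal.ofReal (2 * Real.pi) *
          ∫⁻ t, ENNReal.ofReal (Real.exp (2 * t)) * A₂ (Real.exp t) := hper hA₂m
      _ ≤ ENNReal.ofReal (2 * Real.pi) * ∫⁻ t in Iic (Real.log b),
          ENNReal.ofReal (1 / ℓ) * ENNReal.ofReal (Real.exp t) := by
          refine mul_le_mul' le_rfl ?_
          rw [← lintegral_indicator measurableSet_Iic]
          refine lintegral_mono fun t => ?_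
          simp only [hA₂, huexp, hD, Real.log_exp]
          by_cases ht : t ∈ Iic (Real.log b)
          · rw [indicator_of_mem ht, ← ENNReal.ofReal_mul (H.nonneg t),
              ← ENNReal.ofReal_mul (Real.exp_pos _).le, ← ENNReal.ofReal_mul (by positivity)]
            apply ENNReal.ofReal_le_ofReal
            have h1 := H.abs_deriv_le hℓ t
            have h2 : Real.exp (2 * t) = Real.exp t * Real.exp t := by
              rw [← Real.exp_add]; ring_nf
            calc Real.exp (2 * t) * (U t * (|deriv U t| / Real.exp t))
                = U t * (|deriv U t| * Real.exp t) := by rw [h2]; field_simp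
              _ ≤ 1 * (1 / ℓ * Real.exp t) := by
                  gcongr
                  exact H.le_one t
              _ = _ := one_mul _
          · rw [indicator_of_notMem ht, H.deriv_eq_zero (not_le.1 ht)]
            simp
      _ = ENNReal.ofReal (2 * Real.pi * b / ℓ) := by
          rw [lintegral_const_mul' _ _ ENNReal.ofReal_ne_top, lintegral_exp_Iic hb,
            ← ENNReal.ofReal_mul (by positivity), ← ENNReal.ofReal_mul (by positivity)]
          congr 1; field_simp

/-! ### The product wave function -/

variable {N : ℕ} {F : Plane → ℝ}

/-- The product of `F (x i - x j)` over all unordered pairs of distinct particles in `S`, for an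
even nonnegative function `F`. -/
def pairWeight (F : Plane → ℝ) (S : Finset (Fin N)) (x : Config N) : ℝ :=
  √(∏ p ∈ S.offDiag, F (x p.1 - x p.2))

lemma pairWeight_empty (x : Config N) : pairWeight F ∅ x = 1 := by simp [pairWeight]

lemma pairWeight_nonneg (S : Finset (Fin N)) (x : Config N) : 0 ≤ pairWeight F S x :=
  Real.sqrt_nonneg _

/-- The new ordered pairs come in two copies, (i, j) and (j, i), with equal factors because F is
even; the square root removes the duplication. Using ordered pairs makes permutation symmetry a mere
reindexing. -/
lemma pairWeight_insert (h0 : ∀ x, 0 ≤ F x) (he : ∀ x, F (-x) = F x) {S : Finset (Fin N)}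
    {i : Fin N} (hi : i ∉ S) (x : Config N) :
    pairWeight F (insert i S) x = pairWeight F S x * ∏ j ∈ S, F (x i - x j) := by
  have hd1 : Disjoint S.offDiag ({i} ×ˢ S) := by
    rw [Finset.disjoint_left]; rintro ⟨a, b⟩ h1 h2
    simp only [Finset.mem_offDiag, Finset.mem_product, Finset.mem_singleton] at h1 h2
    exact hi (h2.1 ▸ h1.1)
  have hd2 : Disjoint (S.offDiag ∪ {i} ×ˢ S) (S ×ˢ {i}) := by
    rw [Finset.disjoint_left]; rintro ⟨a, b⟩ h1 h2
    simp only [Finset.mem_union, Finset.mem_offDiag, Finset.mem_product,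
      Finset.mem_singleton] at h1 h2
    rcases h1 with h1 | h1
    · exact hi (h2.2 ▸ h1.2.1)
    · exact hi (h1.1 ▸ h2.1)
  have hs : ∏ j ∈ S, F (x j - x i) = ∏ j ∈ S, F (x i - x j) :=
    Finset.prod_congr rfl fun j _ => by rw [← he, neg_sub]
  rw [pairWeight, Finset.offDiag_insert hi, Finset.prod_union hd2, Finset.prod_union hd1,
    Finset.prod_product, Finset.prod_product, Finset.prod_singleton]
  simp only [Finset.prod_singleton]
  rw [hs, mul_assoc, Real.sqrt_mul (Finset.prod_nonneg fun _ _ => h0 _),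
    Real.sqrt_mul_self (Finset.prod_nonneg fun _ _ => h0 _), pairWeight]

lemma pairWeight_erase (h0 : ∀ x, 0 ≤ F x) (he : ∀ x, F (-x) = F x) {S : Finset (Fin N)}
    {i : Fin N} (hi : i ∈ S) (x : Config N) :
    pairWeight F S x = pairWeight F (S.erase i) x * ∏ j ∈ S.erase i, F (x i - x j) := by
  rw [← pairWeight_insert h0 he (Finset.notMem_erase i S), Finset.insert_erase hi]

lemma pairWeight_le_erase (h0 : ∀ x, 0 ≤ F x) (h1 : ∀ x, F x ≤ 1) (he : ∀ x, F (-x) = F x)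
    (S : Finset (Fin N)) (i : Fin N) (x : Config N) :
    pairWeight F S x ≤ pairWeight F (S.erase i) x := by
  by_cases hi : i ∈ S
  · rw [pairWeight_erase h0 he hi]
    exact mul_le_of_le_one_right (pairWeight_nonneg _ _)
      (Finset.prod_le_one (fun _ _ => h0 _) fun _ _ => h1 _)
  · rw [Finset.erase_eq_of_notMem hi]

lemma pairWeight_le_one (h0 : ∀ x, 0 ≤ F x) (h1 : ∀ x, F x ≤ 1) (S : Finset (Fin N))
    (x : Config N) : pairWeight F S x ≤ 1 := by
  rw [pairWeight, Real.sqrt_le_iff, one_pow]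
  refine ⟨zero_le_one, ?_⟩
  exact Finset.prod_le_one (fun _ _ => h0 _) fun _ _ => h1 _

lemma pairWeight_update {S : Finset (Fin N)} {i : Fin N} (hi : i ∉ S) (x : Config N) (y : Plane) :
    pairWeight F S (Function.update x i y) = pairWeight F S x := by
  unfold pairWeight
  congr 1
  refine Finset.prod_congr rfl fun p hp => ?_
  rw [Finset.mem_offDiag] at hp
  rw [Function.update_of_ne (fun h => hi (by rw [← h]; exact hp.1)),
    Function.update_of_ne (fun h => hi (by rw [← h]; exact hp.2.1))]

lemma pairWeight_perm (σ : Equiv.Perm (Fin N)) (x : Config N) :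
    pairWeight F Finset.univ (fun i => x (σ i)) = pairWeight F Finset.univ x := by
  unfold pairWeight
  congr 1
  refine Finset.prod_equiv (Equiv.prodCongr σ σ) ?_ ?_
  · rintro ⟨i, j⟩; simp
  · rintro ⟨i, j⟩ _; rfl

lemma pairWeight_add_latticeVec {L : ℝ} (hper : ∀ n x, F (x + latticeVec L n) = F x)
    (S : Finset (Fin N)) (i : Fin N) (n : Fin 2 → ℤ) (x : Config N) :
    pairWeight F S (x + Pi.single i (latticeVec L n)) = pairWeight F S x := by
  unfold pairWeight
  congr 1
  refine Finset.prod_congr rfl fun p hp => ?_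
  rw [Finset.mem_offDiag] at hp
  simp only [Pi.add_apply]
  by_cases h1 : p.1 = i
  · have h2 : p.2 ≠ i := fun h => hp.2.2 (h1.trans h.symm)
    rw [h1, Pi.single_eq_same, Pi.single_eq_of_ne h2, add_zero, add_sub_right_comm, hper]
  · rw [Pi.single_eq_of_ne h1, add_zero]
    by_cases h2 : p.2 = i
    · rw [h2, Pi.single_eq_same]
      have := hper (-n) (x p.1 - x i)
      rw [latticeVec_neg] at this
      rw [← this]; congr 1; abel
    · rw [Pi.single_eq_of_ne h2, add_zero]

lemma lipschitz_mul_of_le_one {E : Type*} [PseudoMetricSpace E] {f g : E → ℝ} {C D : NNReal}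
    (hf : LipschitzWith C f) (hg : LipschitzWith D g) (hf1 : ∀ x, |f x| ≤ 1)
    (hg1 : ∀ x, |g x| ≤ 1) : LipschitzWith (C + D) fun x => f x * g x := by
  refine LipschitzWith.of_dist_le_mul fun x y => ?_
  have h1 := hf.dist_le_mul x y
  have h2 := hg.dist_le_mul x y
  rw [Real.dist_eq] at *
  have e : f x * g x - f y * g y = (f x - f y) * g x + f y * (g x - g y) := by ring
  rw [e]
  refine (abs_add_le _ _).trans ?_
  rw [abs_mul, abs_mul]
  have h3 : |f x - f y| * |g x| ≤ |f x - f y| := mul_le_of_le_one_right (abs_nonneg _) (hg1 x)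
  have h4 : |f y| * |g x - g y| ≤ |g x - g y| := mul_le_of_le_one_left (abs_nonneg _) (hf1 y)
  push_cast
  linarith

lemma exists_lipschitz_prod {E ι : Type*} [PseudoMetricSpace E] (f : ι → E → ℝ)
    (hf : ∀ i, ∃ C, LipschitzWith C (f i)) (h0 : ∀ i x, 0 ≤ f i x) (h1 : ∀ i x, f i x ≤ 1)
    (S : Finset ι) : ∃ C, LipschitzWith C fun x => ∏ i ∈ S, f i x := by
  classical
  induction S using Finset.induction with
  | empty => exact ⟨0, by simp⟩
  | insert i S hi ih =>
    obtain ⟨C, hC⟩ := ih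
    obtain ⟨D, hD⟩ := hf i
    refine ⟨D + C, ?_⟩
    simp only [Finset.prod_insert hi]
    refine lipschitz_mul_of_le_one hD hC (fun x => ?_) fun x => ?_
    · rw [abs_of_nonneg (h0 i x)]; exact h1 i x
    · rw [abs_of_nonneg (Finset.prod_nonneg fun _ _ => h0 _ _)]
      exact Finset.prod_le_one (fun _ _ => h0 _ _) fun _ _ => h1 _ _

lemma exists_lipschitz_pairWeight (hF : ∃ C, LipschitzWith C F) (h0 : ∀ x, 0 ≤ F x)
    (h1 : ∀ x, F x ≤ 1) (he : ∀ x, F (-x) = F x) (S : Finset (Fin N)) :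
    ∃ C, LipschitzWith C (pairWeight F S) := by
  obtain ⟨C, hC⟩ := hF
  have hpair : ∀ i j : Fin N, ∃ C, LipschitzWith C fun x : Config N => F (x i - x j) :=
    fun i j => ⟨_, hC.comp ((LipschitzWith.eval i).sub (LipschitzWith.eval j))⟩
  induction S using Finset.induction with
  | empty => exact ⟨0, by simp [funext (pairWeight_empty (F := F))]⟩
  | insert i S hi ih =>
    obtain ⟨A, hA⟩ := ih
    obtain ⟨B, hB⟩ := exists_lipschitz_prod (fun j (x : Config N) => F (x i - x j))
      (fun j => hpair i j) (fun _ _ => h0 _) (fun _ _ => h1 _) S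
    refine ⟨A + B, ?_⟩
    rw [funext (pairWeight_insert h0 he hi)]
    refine lipschitz_mul_of_le_one hA hB (fun x => ?_) fun x => ?_
    · rw [abs_of_nonneg (pairWeight_nonneg _ _)]; exact pairWeight_le_one h0 h1 S x
    · rw [abs_of_nonneg (Finset.prod_nonneg fun _ _ => h0 _)]
      exact Finset.prod_le_one (fun _ _ => h0 _) fun _ _ => h1 _

/-! ### Weak derivatives of Lipschitz functions -/

/-- Integration by parts for line derivatives of Lipschitz functions, one of them compactly
supported; boundedness of the line derivative gives local integrability. -/
lemma hasWeakDeriv_ofReal_of_lipschitz {E : Type*} [NormedAddCommGroup E] [NormedSpace ℝ E]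
    [MeasureSpace E] [BorelSpace E] [FiniteDimensional ℝ E]
    [(volume : Measure E).IsAddHaarMeasure] {f : E → ℝ} {C : NNReal} (hf : LipschitzWith C f)
    (e : E) :
    HasWeakDeriv (fun x => (f x : ℂ)) (fun x => ((lineDeriv ℝ f x e : ℝ) : ℂ)) e := by
  refine ⟨?_, ?_, fun η hη hηc => ?_⟩
  · exact (Complex.continuous_ofReal.comp hf.continuous).locallyIntegrable
  · have h := hf.memLp_lineDeriv (μ := volume) e
    exact (MemLp.ofReal (K := ℂ) h).locallyIntegrable le_top
  · obtain ⟨D, hD⟩ := hη.lipschitzWith_of_hasCompactSupport hηc (by simp)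
    have h := hf.integral_lineDeriv_mul_eq (μ := volume) hD hηc e
    have h1 : ∀ x, lineDeriv ℝ η x (-e) = -(fderiv ℝ η x e) := fun x => by
      rw [((hη.differentiable (by simp)) x).lineDeriv_eq_fderiv, map_neg]
    simp only [h1, neg_mul, integral_neg] at h
    have e1 : ∀ x, (fderiv ℝ η x e) • (f x : ℂ) = ((fderiv ℝ η x e * f x : ℝ) : ℂ) := by
      intro x; simp
    have e2 : ∀ x, η x • ((lineDeriv ℝ f x e : ℝ) : ℂ) = ((lineDeriv ℝ f x e * η x : ℝ) : ℂ) := by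
      intro x; simp [mul_comm]
    simp_rw [e1, e2]
    rw [integral_complex_ofReal, integral_complex_ofReal, h]
    simp

/-! ### Integration over the box, one particle at a time -/

lemma box_eq_pi (N : ℕ) (L : ℝ) : box N L = Set.pi univ fun _ => cell L := by
  ext x; simp [box, cell]

lemma restrict_box (N : ℕ) (L : ℝ) :
    (volume : Measure (Config N)).restrict (box N L)
      = Measure.pi fun _ => (volume : Measure Plane).restrict (cell L) := by
  rw [box_eq_pi, volume_pi, Measure.restrict_pi_pi]

lemma volume_box {L : ℝ} (hL : 0 < L) : volume (box N L) = ENNReal.ofReal (L ^ 2) ^ N := by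
  rw [box_eq_pi, volume_pi_pi]; simp [volume_cell hL]

/-- Replacing coordinate j by an independent variable leaves the old coordinate idle, and it
contributes its total mass. One particle can thus be integrated out without splitting the product
space. -/
lemma lintegral_pi_update {ι X : Type*} [Fintype ι] [DecidableEq ι] [MeasurableSpace X]
    (κ : Measure X) [SigmaFinite κ] {f : (ι → X) → ℝ≥0∞} (hf : Measurable f) (j : ι)
    (hκ : κ univ ≠ ⊤) :
    ∫⁻ x, ∫⁻ y, f (Function.update x j y) ∂κ ∂(Measure.pi fun _ => κ)
      = κ univ * ∫⁻ x, f x ∂(Measure.pi fun _ => κ) := by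
  rcases isEmpty_or_nonempty (ι → X) with h | ⟨⟨x₀⟩⟩
  · simp [lintegral_of_isEmpty]
  set g : (ι → X) → ℝ≥0∞ := fun x => ∫⁻ y, f (Function.update x j y) ∂κ with hg
  have hgm : Measurable g := by
    have := hf.lmarginal (μ := fun _ : ι => κ) (s := {j})
    rwa [lmarginal_singleton] at this
  rw [lintegral_eq_lmarginal_univ x₀, lintegral_eq_lmarginal_univ (f := f) x₀,
    lmarginal_erase' _ hf (Finset.mem_univ j), lmarginal_erase' _ hgm (Finset.mem_univ j)]
  have h1 : (fun x => ∫⁻ y, g (Function.update x j y) ∂κ) = fun x => κ univ * g x := by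
    funext x
    simp [hg, mul_comm]
  simp only [h1]
  rw [lmarginal, lmarginal, lintegral_const_mul' _ _ hκ]

/-- Integration of a periodic function of `x j - x i` over the position of particle `j`. -/
lemma lintegral_box_mul_le {L c : ℝ} (hL : 0 < L) {A : Plane → ℝ≥0∞} (hA : Measurable A)
    (hper : ∀ n x, A (x + latticeVec L n) = A x)
    (hAc : ∫⁻ x in cell L, A x ≤ ENNReal.ofReal c) {Q : Config N → ℝ≥0∞} (hQ : Measurable Q)
    {i j : Fin N} (hij : i ≠ j) (hQj : ∀ x y, Q (Function.update x j y) = Q x) :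
    ∫⁻ x in box N L, Q x * A (x j - x i)
      ≤ ENNReal.ofReal (c / L ^ 2) * ∫⁻ x in box N L, Q x := by
  have hf : Measurable fun x : Config N => Q x * A (x j - x i) :=
    hQ.mul (hA.comp ((measurable_pi_apply j).sub (measurable_pi_apply i)))
  have hκ : (volume : Measure Plane).restrict (cell L) univ = ENNReal.ofReal (L ^ 2) := by
    rw [Measure.restrict_apply_univ, volume_cell hL]
  have h := lintegral_pi_update ((volume : Measure Plane).restrict (cell L)) hf j
    (by rw [hκ]; exact ENNReal.ofReal_ne_top)
  have h1 : ∀ x : Config N, ∫⁻ y in cell L, Q (Function.update x j y) *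
      A (Function.update x j y j - Function.update x j y i) ≤ Q x * ENNReal.ofReal c := by
    intro x
    simp only [hQj, Function.update_self, Function.update_of_ne hij]
    have hAm : Measurable fun y => A (y - x i) := hA.comp (measurable_id.sub_const _)
    rw [lintegral_const_mul _ hAm, lintegral_cell_sub hL hA hper]
    gcongr
  rw [restrict_box]
  have h2 := (lintegral_mono (μ := Measure.pi fun _ : Fin N =>
    (volume : Measure Plane).restrict (cell L)) h1).trans_eq
      (lintegral_mul_const' _ _ ENNReal.ofReal_ne_top)
  rw [h, hκ] at h2
  have hL2 : ENNReal.ofReal (L ^ 2) ≠ 0 := by simpa using hL.ne'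
  rw [ENNReal.ofReal_div_of_pos (by positivity), ENNReal.div_eq_inv_mul, mul_assoc,
    ← ENNReal.mul_le_iff_le_inv hL2 ENNReal.ofReal_ne_top, mul_comm (ENNReal.ofReal c)]
  exact h2

/-- The union bound, by induction: (1 - f i)(1 - ∏ f) ≥ 0. It keeps the norm estimate linear in the
pair defect. -/
lemma one_le_prod_add_sum {ι : Type*} (S : Finset ι) (f : ι → ℝ) (h0 : ∀ i, 0 ≤ f i)
    (h1 : ∀ i, f i ≤ 1) : 1 ≤ ∏ i ∈ S, f i + ∑ i ∈ S, (1 - f i) := by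
  classical
  induction S using Finset.induction with
  | empty => simp
  | insert i S hi ih =>
    rw [Finset.prod_insert hi, Finset.sum_insert hi]
    have hp0 : 0 ≤ ∏ i ∈ S, f i := Finset.prod_nonneg fun _ _ => h0 _
    have hp1 : ∏ i ∈ S, f i ≤ 1 := Finset.prod_le_one (fun _ _ => h0 _) fun _ _ => h1 _
    nlinarith [mul_nonneg (sub_nonneg.2 (h1 i)) (sub_nonneg.2 hp1)]

/-- The integral of the squared pair weight over the box. -/
def weightIntegral (F : Plane → ℝ) (L : ℝ) (S : Finset (Fin N)) : ℝ≥0∞ :=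
  ∫⁻ x in box N L, ENNReal.ofReal (pairWeight F S x ^ 2)

namespace IsPairFunction

variable {μ L I J K : ℝ} {v : ℝ → ℝ≥0∞}

lemma measurable_pairWeight (H : IsPairFunction μ v L F I J K) (S : Finset (Fin N)) :
    Measurable (pairWeight F S) := by
  obtain ⟨C, hC⟩ := exists_lipschitz_pairWeight H.lipschitz H.nonneg H.le_one H.even S
  exact hC.continuous.measurable

lemma measurable (H : IsPairFunction μ v L F I J K) : Measurable F := by
  obtain ⟨C, hC⟩ := H.lipschitz
  exact hC.continuous.measurable

lemma fderiv_periodic (H : IsPairFunction μ v L F I J K) (n : Fin 2 → ℤ) (x : Plane) :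
    fderiv ℝ F (x + latticeVec L n) = fderiv ℝ F x := by
  rw [← fderiv_comp_add_right, funext (H.periodic n)]

lemma enorm_fderiv_neg (H : IsPairFunction μ v L F I J K) (x : Plane) :
    ‖fderiv ℝ F (-x)‖ₑ = ‖fderiv ℝ F x‖ₑ := by
  have h := (ContinuousLinearEquiv.neg ℝ (M := Plane)).comp_right_fderiv (f := F) (x := x)
  have h1 : F ∘ (ContinuousLinearEquiv.neg ℝ (M := Plane)) = F := funext H.even
  rw [h1] at h
  have h2 : fderiv ℝ F x = -fderiv ℝ F (-x) := by
    rw [h]; ext y; simp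
  rw [h2, enorm_neg]

lemma weightIntegral_ne_top (H : IsPairFunction μ v L F I J K) (hL : 0 < L) (S : Finset (Fin N)) :
    weightIntegral F L S ≠ ⊤ := by
  refine ne_top_of_le_ne_top (b := ∫⁻ _ in box N L, 1) ?_ (lintegral_mono fun x => ?_)
  · rw [lintegral_one, Measure.restrict_apply_univ, volume_box hL]
    exact ENNReal.pow_ne_top ENNReal.ofReal_ne_top
  · rw [ENNReal.ofReal_le_one]
    exact pow_le_one₀ (pairWeight_nonneg _ _) (pairWeight_le_one H.nonneg H.le_one S x)

/-- Adding a particle costs at most a factor `1 - N I / L²`. -/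
lemma mul_weightIntegral_le_insert (H : IsPairFunction μ v L F I J K) (hL : 0 < L) (hI : 0 ≤ I)
    (ht : 0 ≤ 1 - N * I / L ^ 2) {S : Finset (Fin N)} {i : Fin N} (hi : i ∉ S) :
    ENNReal.ofReal (1 - N * I / L ^ 2) * weightIntegral F L S
      ≤ weightIntegral F L (insert i S) := by
  have hWm : Measurable fun x : Config N => ENNReal.ofReal (pairWeight F S x ^ 2) :=
    ((H.measurable_pairWeight S).pow_const 2).ennreal_ofReal
  have hAm : Measurable fun y : Plane => ENNReal.ofReal (1 - F y ^ 2) :=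
    (measurable_const.sub (H.measurable.pow_const 2)).ennreal_ofReal
  -- The union bound is applied to the factors containing particle i. In each error term x i occurs
  -- only in the defect, so integrating over it costs I/L².
  have hpt : ∀ x : Config N, ENNReal.ofReal (pairWeight F S x ^ 2)
      ≤ ENNReal.ofReal (pairWeight F (insert i S) x ^ 2)
        + ∑ j ∈ S, ENNReal.ofReal (pairWeight F S x ^ 2) * ENNReal.ofReal (1 - F (x i - x j) ^ 2) := by
    intro x
    have hF2 : ∀ y, F y ^ 2 ≤ 1 := fun y => pow_le_one₀ (H.nonneg y) (H.le_one y)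
    have h := one_le_prod_add_sum S (fun j => F (x i - x j) ^ 2) (fun j => sq_nonneg _)
      fun j => hF2 _
    rw [pairWeight_insert H.nonneg H.even hi, ← Finset.mul_sum,
      ← ENNReal.ofReal_sum_of_nonneg fun j _ => sub_nonneg.2 (hF2 _),
      ← ENNReal.ofReal_mul (sq_nonneg _), ← ENNReal.ofReal_add (sq_nonneg _)
        (mul_nonneg (sq_nonneg _) (Finset.sum_nonneg fun j _ => sub_nonneg.2 (hF2 _)))]
    apply ENNReal.ofReal_le_ofReal
    rw [mul_pow, ← Finset.prod_pow, ← mul_add]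
    exact le_mul_of_one_le_right (sq_nonneg _) h
  have hWle : weightIntegral F L S ≤ weightIntegral F L (insert i S)
      + ENNReal.ofReal (N * I / L ^ 2) * weightIntegral F L S := by
    have h1 := lintegral_mono (μ := volume.restrict (box N L)) hpt
    have hm : ∀ j, Measurable fun x : Config N =>
        ENNReal.ofReal (pairWeight F S x ^ 2) * ENNReal.ofReal (1 - F (x i - x j) ^ 2) :=
      fun j => hWm.mul (hAm.comp ((measurable_pi_apply i).sub (measurable_pi_apply j)))
    rw [lintegral_add_right _ (Finset.measurable_sum _ fun j _ => hm j),
      lintegral_finsetSum _ fun j _ => hm j] at h1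
    refine h1.trans (add_le_add le_rfl ?_)
    calc ∑ j ∈ S, ∫⁻ x in box N L,
          ENNReal.ofReal (pairWeight F S x ^ 2) * ENNReal.ofReal (1 - F (x i - x j) ^ 2)
        ≤ ∑ j ∈ S, ENNReal.ofReal (I / L ^ 2) * weightIntegral F L S := by
          refine Finset.sum_le_sum fun j hj => ?_
          refine lintegral_box_mul_le hL hAm (fun n x => by rw [H.periodic]) H.defect_le hWm
            (fun h => hi (h ▸ hj)) fun x y => by rw [pairWeight_update hi]
      _ ≤ _ := by
          rw [Finset.sum_const, nsmul_eq_mul, ← mul_assoc]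
          gcongr
          rw [mul_div_assoc, ENNReal.ofReal_mul (Nat.cast_nonneg N), ENNReal.ofReal_natCast]
          gcongr
          simpa using Finset.card_le_univ S
  have hs : 0 ≤ N * I / L ^ 2 := by positivity
  have hsplit : weightIntegral F L S = ENNReal.ofReal (1 - N * I / L ^ 2) * weightIntegral F L S
      + ENNReal.ofReal (N * I / L ^ 2) * weightIntegral F L S := by
    rw [← add_mul, ← ENNReal.ofReal_add ht hs]; simp
  rw [hsplit] at hWle
  refine (ENNReal.add_le_add_iff_right ?_).1 (hWle.trans (le_of_eq ?_))
  · exact ENNReal.mul_ne_top ENNReal.ofReal_ne_top (H.weightIntegral_ne_top hL S)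
  · rw [← hsplit]

lemma mul_weightIntegral_erase_le (H : IsPairFunction μ v L F I J K) (hL : 0 < L) (hI : 0 ≤ I)
    (ht : 0 ≤ 1 - N * I / L ^ 2) {S : Finset (Fin N)} {i : Fin N} (hi : i ∈ S) :
    ENNReal.ofReal (1 - N * I / L ^ 2) * weightIntegral F L (S.erase i)
      ≤ weightIntegral F L S := by
  have := H.mul_weightIntegral_le_insert hL hI ht (Finset.notMem_erase i S)
  rwa [Finset.insert_erase hi] at this

lemma weightIntegral_ne_zero (H : IsPairFunction μ v L F I J K) (hL : 0 < L) (hI : 0 ≤ I)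
    (ht : 0 < 1 - N * I / L ^ 2) (S : Finset (Fin N)) : weightIntegral F L S ≠ 0 := by
  induction S using Finset.induction with
  | empty =>
    simp only [weightIntegral, pairWeight_empty]
    simp [volume_box hL, hL.ne']
  | insert i S hi ih =>
    intro h0
    have h := H.mul_weightIntegral_le_insert hL hI ht.le hi
    rw [h0, nonpos_iff_eq_zero, mul_eq_zero, ENNReal.ofReal_eq_zero] at h
    rcases h with h | h
    · exact absurd h (not_le.2 ht)
    · exact ih h

/-! ### The gradient of the wave function -/

/-- Rademacher's theorem for F, together with the fact that preimages of null sets under a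
surjective linear map are null. -/
lemma ae_differentiableAt_sub (H : IsPairFunction μ v L F I J K) {i j : Fin N} (hij : i ≠ j) :
    ∀ᵐ x : Config N, DifferentiableAt ℝ F (x i - x j) := by
  obtain ⟨C, hC⟩ := H.lipschitz
  set T : Config N →ₗ[ℝ] Plane :=
    LinearMap.proj (R := ℝ) (φ := fun _ : Fin N => Plane) i - LinearMap.proj j with hT
  have hsurj : Function.Surjective T := by
    intro y
    refine ⟨Pi.single i y, ?_⟩
    simp [hT, Pi.single_eq_of_ne hij.symm]
  exact (ae_comp_linearMap_mem_iff T
    volume volume hsurj (measurableSet_of_differentiableAt ℝ F)).2 hC.ae_differentiableAt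

lemma lineDeriv_pairWeight (H : IsPairFunction μ v L F I J K) {i : Fin N} {x : Config N}
    (hx : ∀ j, j ≠ i → DifferentiableAt ℝ F (x i - x j)) (e : Plane) :
    lineDeriv ℝ (pairWeight F Finset.univ) x (Pi.single i e)
      = pairWeight F (Finset.univ.erase i) x *
        (∑ j ∈ Finset.univ.erase i, (∏ l ∈ (Finset.univ.erase i).erase j, F (x i - x l)) •
          fderiv ℝ F (x i - x j)) e := by
  have hupd : ∀ s : ℝ, x + s • (Pi.single i e : Config N) = Function.update x i (x i + s • e) := by
    intro s; funext j
    by_cases h : j = i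
    · subst h; simp
    · simp [h]
  have hline : ∀ s : ℝ, pairWeight F Finset.univ (x + s • (Pi.single i e : Config N))
      = pairWeight F (Finset.univ.erase i) x * ∏ j ∈ Finset.univ.erase i, F (x i + s • e - x j) := by
    intro s
    rw [hupd, pairWeight_erase H.nonneg H.even (Finset.mem_univ i),
      pairWeight_update (Finset.notMem_erase i _)]
    congr 1
    refine Finset.prod_congr rfl fun j hj => ?_
    rw [Function.update_self, Function.update_of_ne (Finset.ne_of_mem_erase hj)]
  have hd : ∀ j ∈ Finset.univ.erase i, HasDerivAt (fun s : ℝ => F (x i + s • e - x j))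
      (fderiv ℝ F (x i - x j) e) 0 := by
    intro j hj
    have h1 : HasDerivAt (fun s : ℝ => x i + s • e - x j) e 0 := by
      have := (((hasDerivAt_id (0 : ℝ)).smul_const e).const_add (x i)).sub_const (x j)
      simpa using this
    have h2 : HasFDerivAt F (fderiv ℝ F (x i - x j)) (x i + (0 : ℝ) • e - x j) := by
      simpa using (hx j (Finset.ne_of_mem_erase hj)).hasFDerivAt
    exact h2.comp_hasDerivAt (0 : ℝ) h1
  have h3 := (HasDerivAt.fun_finsetProd hd).const_mul (pairWeight F (Finset.univ.erase i) x)
  rw [lineDeriv, funext hline, h3.deriv]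
  simp

end IsPairFunction

/-- The functional is tested on the vector of its own components. -/
lemma sum_enorm_apply_unitVec_le (ℒ : Plane →L[ℝ] ℝ) :
    ∑ k, ‖ℒ (unitVec k)‖ₑ ^ 2 ≤ ‖ℒ‖ₑ ^ 2 := by
  have h : ∑ k, (ℒ (unitVec k)) ^ 2 ≤ ‖ℒ‖ ^ 2 := by
    set y : Plane := ∑ k, ℒ (unitVec k) • unitVec k with hy
    have h1 : ℒ y = ∑ k, (ℒ (unitVec k)) ^ 2 := by
      rw [hy, map_sum]; simp [sq]
    have h2 : ‖y‖ ^ 2 = ∑ k, (ℒ (unitVec k)) ^ 2 := by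
      rw [norm_sq_plane, Fin.sum_univ_two, hy]
      simp [unitVec]
    have h3 : ℒ y ≤ ‖ℒ‖ * ‖y‖ := (le_abs_self _).trans (ℒ.le_opNorm y)
    rw [h1, ← h2] at h3
    rw [← h2]
    rcases (norm_nonneg y).eq_or_lt with h0 | h0
    · rw [← h0]; simp
    · have : ‖y‖ ≤ ‖ℒ‖ := le_of_mul_le_mul_right (by rwa [← sq]) h0
      gcongr
  calc ∑ k, ‖ℒ (unitVec k)‖ₑ ^ 2 = ∑ k, ENNReal.ofReal ((ℒ (unitVec k)) ^ 2) := by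
        simp only [enorm_sq_eq_ofReal]
    _ = ENNReal.ofReal (∑ k, (ℒ (unitVec k)) ^ 2) :=
        (ENNReal.ofReal_sum_of_nonneg fun _ _ => sq_nonneg _).symm
    _ ≤ ENNReal.ofReal (‖ℒ‖ ^ 2) := ENNReal.ofReal_le_ofReal h
    _ = ‖ℒ‖ₑ ^ 2 := by rw [ENNReal.ofReal_pow (norm_nonneg _), ofReal_norm]

lemma prod_le_of_mem {ι : Type*} {S : Finset ι} {f : ι → ℝ} (h0 : ∀ i, 0 ≤ f i)
    (h1 : ∀ i, f i ≤ 1) {i : ι} (hi : i ∈ S) : ∏ j ∈ S, f j ≤ f i := by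
  classical
  rw [← Finset.mul_prod_erase S f hi]
  exact mul_le_of_le_one_right (h0 i) (Finset.prod_le_one (fun _ _ => h0 _) fun _ _ => h1 _)

/-- Half of each interaction is assigned to either particle of the pair, which matches the factor
v/2 in the two-body functional. -/
lemma sum_Ioi_eq_sum_erase_div_two (V : Fin N → Fin N → ℝ≥0∞) (hV : ∀ i j, V i j = V j i) :
    ∑ i, ∑ j ∈ Finset.Ioi i, V i j = ∑ i, ∑ j ∈ Finset.univ.erase i, V i j / 2 := by
  have h1 : ∀ i : Fin N, ∑ j ∈ Finset.univ.erase i, V i j / 2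
      = ∑ j ∈ Finset.Ioi i, V i j / 2 + ∑ j ∈ Finset.Iio i, V i j / 2 := by
    intro i
    rw [← Finset.sum_union]
    · congr 1
      ext j
      simp only [Finset.mem_erase, Finset.mem_univ, and_true, Finset.mem_union, Finset.mem_Ioi,
        Finset.mem_Iio]
      exact ⟨fun h => (lt_or_gt_of_ne h).symm, fun h => h.elim ne_of_gt ne_of_lt⟩
    · rw [Finset.disjoint_left]
      intro j h2 h3
      exact lt_asymm (Finset.mem_Ioi.1 h2) (Finset.mem_Iio.1 h3)
  have h2 : ∑ i, ∑ j ∈ Finset.Iio i, V i j / 2 = ∑ i, ∑ j ∈ Finset.Ioi i, V i j / 2 := by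
    rw [Finset.sum_comm' (t' := Finset.univ) (s' := fun i => Finset.Ioi i) (by simp)]
    exact Finset.sum_congr rfl fun i _ => Finset.sum_congr rfl fun j _ => by rw [hV]
  simp_rw [h1]
  rw [Finset.sum_add_distrib, h2, ← Finset.sum_add_distrib]
  refine Finset.sum_congr rfl fun i _ => ?_
  rw [← Finset.sum_add_distrib]
  exact Finset.sum_congr rfl fun j _ => (ENNReal.add_halves _).symm

/-! ### Energy of the product state -/

/-- The product wave function. -/
def productState (F : Plane → ℝ) (x : Config N) : ℂ := (pairWeight F Finset.univ x : ℝ)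

/-- The gradient of the product wave function. -/
def productGradient (F : Plane → ℝ) (i : Fin N) (k : Fin 2) (x : Config N) : ℂ :=
  (lineDeriv ℝ (pairWeight F Finset.univ) x (Pi.single i (unitVec k)) : ℝ)

lemma enorm_ofReal_sq (r : ℝ) : ‖(r : ℂ)‖ₑ ^ 2 = ENNReal.ofReal (r ^ 2) := by
  rw [← enorm_sq_eq_ofReal, ← ofReal_norm, ← ofReal_norm, Complex.norm_real]

/-- The weight of a function of the pair separation: `F |∇F|`. -/
def pairGradient (F : Plane → ℝ) (x : Plane) : ℝ≥0∞ := ENNReal.ofReal (F x) * ‖fderiv ℝ F x‖ₑ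

/-- The two-body energy density of the pair function. -/
def pairEnergy (μ : ℝ) (v : ℝ → ℝ≥0∞) (L : ℝ) (F : Plane → ℝ) (x : Plane) : ℝ≥0∞ :=
  ENNReal.ofReal μ * ‖fderiv ℝ F x‖ₑ ^ 2 + periodicPotential v L x / 2 * ENNReal.ofReal (F x ^ 2)

namespace IsPairFunction

variable {μ L I J K : ℝ} {v : ℝ → ℝ≥0∞}

lemma isPeriodicBoseFunction (H : IsPairFunction μ v L F I J K) (hL : 0 < L) :
    IsPeriodicBoseFunction N L (productState F) (productGradient F) := by
  obtain ⟨C, hC⟩ := exists_lipschitz_pairWeight (N := N) H.lipschitz H.nonneg H.le_one H.even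
    Finset.univ
  have hfin : IsFiniteMeasure ((volume : Measure (Config N)).restrict (box N L)) := by
    refine ⟨?_⟩
    rw [Measure.restrict_apply_univ, volume_box hL]
    exact (ENNReal.pow_ne_top ENNReal.ofReal_ne_top).lt_top
  refine ⟨fun σ x => ?_, fun i k x => ?_, fun i k => ?_, ?_, fun i k => ?_⟩
  · simp only [productState, pairWeight_perm]
  · simp only [productState]
    rw [← latticeVec_single, pairWeight_add_latticeVec H.periodic]
  · exact hasWeakDeriv_ofReal_of_lipschitz hC _
  · refine MemLp.of_bound (C := 1)
      (Complex.continuous_ofReal.comp hC.continuous).aestronglyMeasurable (.of_forall fun x => ?_)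
    rw [productState, Complex.norm_real, Real.norm_of_nonneg (pairWeight_nonneg _ _)]
    exact pairWeight_le_one H.nonneg H.le_one _ x
  · exact (MemLp.ofReal (K := ℂ)
      ((hC.memLp_lineDeriv (μ := volume) (Pi.single i (unitVec k))).restrict _)).mono_exponent le_top

/-- Only the factors containing x i are differentiated. Expanding the square, the diagonal terms are
bounded by dropping the remaining factors F ≤ 1. In the term (j, l) the product belonging to j still
contains the factor of l, and conversely; keeping these two gives the product of two weights F|∇F|.
-/
lemma sum_enorm_productGradient_le (H : IsPairFunction μ v L F I J K) {i : Fin N} {x : Config N}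
    (hx : ∀ j, j ≠ i → DifferentiableAt ℝ F (x i - x j)) :
    ∑ k, ‖productGradient F i k x‖ₑ ^ 2 ≤ ∑ j ∈ Finset.univ.erase i,
      (ENNReal.ofReal (pairWeight F (Finset.univ.erase i) x ^ 2) * ‖fderiv ℝ F (x i - x j)‖ₑ ^ 2
        + ∑ l ∈ (Finset.univ.erase i).erase j,
          ENNReal.ofReal (pairWeight F ((Finset.univ.erase i).erase j) x ^ 2) *
            pairGradient F (x i - x l) * pairGradient F (x j - x i)) := by
  set S := Finset.univ.erase i with hS
  set W := ENNReal.ofReal (pairWeight F S x ^ 2) with hW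
  set c : Fin N → ℝ := fun j => ∏ l ∈ S.erase j, F (x i - x l) with hc
  set ℒ : Plane →L[ℝ] ℝ := ∑ j ∈ S, c j • fderiv ℝ F (x i - x j) with hℒ
  set d : Fin N → ℝ≥0∞ := fun j => ‖fderiv ℝ F (x i - x j)‖ₑ with hd
  have hc0 : ∀ j, 0 ≤ c j := fun j => Finset.prod_nonneg fun _ _ => H.nonneg _
  have hc1 : ∀ j, c j ≤ 1 := fun j => Finset.prod_le_one (fun _ _ => H.nonneg _) fun _ _ => H.le_one _
  have h1 : ∑ k, ‖productGradient F i k x‖ₑ ^ 2 ≤ W * ‖ℒ‖ₑ ^ 2 := by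
    refine le_trans (le_of_eq ?_) (mul_le_mul' le_rfl (sum_enorm_apply_unitVec_le ℒ))
    rw [Finset.mul_sum]
    refine Finset.sum_congr rfl fun k _ => ?_
    rw [productGradient, H.lineDeriv_pairWeight hx, enorm_ofReal_sq, mul_pow,
      ENNReal.ofReal_mul (sq_nonneg _), enorm_sq_eq_ofReal]
  have h2 : ‖ℒ‖ₑ ≤ ∑ j ∈ S, ENNReal.ofReal (c j) * d j := by
    rw [hℒ]
    refine (enorm_sum_le S fun j => c j • fderiv ℝ F (x i - x j)).trans (le_of_eq ?_)
    refine Finset.sum_congr rfl fun j _ => ?_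
    rw [enorm_smul, Real.enorm_of_nonneg (hc0 j)]
  refine h1.trans ((mul_le_mul' le_rfl (pow_le_pow_left' h2 2)).trans ?_)
  rw [sq, Finset.sum_mul_sum, Finset.mul_sum]
  refine Finset.sum_le_sum fun j hj => ?_
  rw [← Finset.add_sum_erase _ _ hj, mul_add]
  refine add_le_add (mul_le_mul' le_rfl ?_) ?_
  · rw [sq]
    have : ENNReal.ofReal (c j) * d j ≤ d j :=
      mul_le_of_le_one_left' (ENNReal.ofReal_le_one.2 (hc1 j))
    exact mul_le_mul' this this
  · rw [Finset.mul_sum]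
    refine Finset.sum_le_sum fun l hl => ?_
    have hjl : j ≠ l := (Finset.ne_of_mem_erase hl).symm
    have hcj : c j ≤ F (x i - x l) :=
      prod_le_of_mem (f := fun l => F (x i - x l)) (fun _ => H.nonneg _) (fun _ => H.le_one _) hl
    have hcl : c l ≤ F (x i - x j) :=
      prod_le_of_mem (f := fun l => F (x i - x l)) (fun _ => H.nonneg _) (fun _ => H.le_one _)
        (Finset.mem_erase.2 ⟨hjl, hj⟩)
    have hg : pairGradient F (x j - x i) = ENNReal.ofReal (F (x i - x j)) * d j := by
      rw [pairGradient, ← neg_sub (x i) (x j), H.even, H.enorm_fderiv_neg]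
    -- The factors containing particle j are dropped from the weight, so that x j survives in a
    -- single factor and can be integrated out.
    have hWle : W ≤ ENNReal.ofReal (pairWeight F (S.erase j) x ^ 2) := by
      apply ENNReal.ofReal_le_ofReal
      gcongr
      · exact pairWeight_nonneg _ _
      · exact pairWeight_le_erase H.nonneg H.le_one H.even S j x
    rw [hg, pairGradient]
    calc W * (ENNReal.ofReal (c j) * d j * (ENNReal.ofReal (c l) * d l))
        ≤ ENNReal.ofReal (pairWeight F (S.erase j) x ^ 2) *
          (ENNReal.ofReal (F (x i - x l)) * d j * (ENNReal.ofReal (F (x i - x j)) * d l)) := by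
          gcongr
      _ = _ := by ring

lemma enorm_productState_sq_le (H : IsPairFunction μ v L F I J K) {i j : Fin N} (hij : j ≠ i)
    (x : Config N) :
    ‖productState F x‖ₑ ^ 2 ≤ ENNReal.ofReal (pairWeight F (Finset.univ.erase i) x ^ 2) *
      ENNReal.ofReal (F (x i - x j) ^ 2) := by
  rw [productState, enorm_ofReal_sq, ← ENNReal.ofReal_mul (sq_nonneg _), ← mul_pow]
  apply ENNReal.ofReal_le_ofReal
  gcongr
  · exact pairWeight_nonneg _ _
  · rw [pairWeight_erase H.nonneg H.even (Finset.mem_univ i)]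
    gcongr
    · exact pairWeight_nonneg _ _
    · exact prod_le_of_mem (f := fun j => F (x i - x j)) (fun _ => H.nonneg _) (fun _ => H.le_one _)
        (Finset.mem_erase.2 ⟨hij, Finset.mem_univ j⟩)

lemma measurable_pairGradient (H : IsPairFunction μ v L F I J K) : Measurable (pairGradient F) :=
  H.measurable.ennreal_ofReal.mul (measurable_fderiv ℝ F).enorm

lemma measurable_pairEnergy (H : IsPairFunction μ v L F I J K) (hv : Measurable v) :
    Measurable (pairEnergy μ v L F) :=
  (((measurable_fderiv ℝ F).enorm.pow_const 2).const_mul _).add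
    (((measurable_periodicPotential hv L).div_const 2).mul (H.measurable.pow_const 2).ennreal_ofReal)

lemma pairGradient_periodic (H : IsPairFunction μ v L F I J K) (n : Fin 2 → ℤ) (x : Plane) :
    pairGradient F (x + latticeVec L n) = pairGradient F x := by
  simp only [pairGradient, H.periodic, H.fderiv_periodic]

lemma pairEnergy_periodic (H : IsPairFunction μ v L F I J K) (n : Fin 2 → ℤ) (x : Plane) :
    pairEnergy μ v L F (x + latticeVec L n) = pairEnergy μ v L F x := by
  simp only [pairEnergy, H.periodic, H.fderiv_periodic, periodicPotential_add]

/-- The diagonal kinetic terms and the halved potential combine into the two-body energy density of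
each ordered pair; the off-diagonal terms remain as three-body integrals. -/
lemma energyForm_le_sum (H : IsPairFunction μ v L F I J K) (hv : Measurable v) :
    energyForm μ v N L (productState F) (productGradient F)
      ≤ ∑ i, ∑ j ∈ Finset.univ.erase i,
        ((∫⁻ x in box N L, ENNReal.ofReal (pairWeight F (Finset.univ.erase i) x ^ 2) *
            pairEnergy μ v L F (x i - x j))
          + ENNReal.ofReal μ * ∑ l ∈ (Finset.univ.erase i).erase j, ∫⁻ x in box N L,
            ENNReal.ofReal (pairWeight F ((Finset.univ.erase i).erase j) x ^ 2) *
            pairGradient F (x i - x l) * pairGradient F (x j - x i)) := by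
  have hWm : ∀ S : Finset (Fin N), Measurable fun x => ENNReal.ofReal (pairWeight F S x ^ 2) :=
    fun S => ((H.measurable_pairWeight S).pow_const 2).ennreal_ofReal
  have hsub : ∀ i j : Fin N, Measurable fun x : Config N => x i - x j := fun i j =>
    (measurable_pi_apply i).sub (measurable_pi_apply j)
  have hE : ∀ i j : Fin N, Measurable fun x : Config N =>
      ENNReal.ofReal (pairWeight F (Finset.univ.erase i) x ^ 2) * pairEnergy μ v L F (x i - x j) :=
    fun i j => (hWm _).mul ((H.measurable_pairEnergy hv).comp (hsub i j))
  have hG : ∀ i j l : Fin N, Measurable fun x : Config N =>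
      ENNReal.ofReal (pairWeight F ((Finset.univ.erase i).erase j) x ^ 2) *
        pairGradient F (x i - x l) * pairGradient F (x j - x i) := fun i j l =>
    ((hWm _).mul (H.measurable_pairGradient.comp (hsub i l))).mul
      (H.measurable_pairGradient.comp (hsub j i))
  have hae : ∀ᵐ x : Config N, ∀ i j, j ≠ i → DifferentiableAt ℝ F (x i - x j) := by
    rw [ae_all_iff]; intro i
    rw [ae_all_iff]; intro j
    by_cases h : j = i
    · exact .of_forall fun x hx => absurd h hx
    · filter_upwards [H.ae_differentiableAt_sub (Ne.symm h)] with x hx _ using hx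
  have hGsum : ∀ i j : Fin N, Measurable fun x : Config N => ∑ l ∈ (Finset.univ.erase i).erase j,
      ENNReal.ofReal (pairWeight F ((Finset.univ.erase i).erase j) x ^ 2) *
        pairGradient F (x i - x l) * pairGradient F (x j - x i) := fun i j =>
    Finset.measurable_sum _ fun l _ => hG i j l
  have hT : ∀ i j : Fin N, Measurable fun x : Config N =>
      ENNReal.ofReal (pairWeight F (Finset.univ.erase i) x ^ 2) * pairEnergy μ v L F (x i - x j)
        + ENNReal.ofReal μ * ∑ l ∈ (Finset.univ.erase i).erase j,
          ENNReal.ofReal (pairWeight F ((Finset.univ.erase i).erase j) x ^ 2) *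
            pairGradient F (x i - x l) * pairGradient F (x j - x i) := fun i j =>
    (hE i j).add ((hGsum i j).const_mul _)
  calc energyForm μ v N L (productState F) (productGradient F)
      ≤ ∫⁻ x in box N L, ∑ i, ∑ j ∈ Finset.univ.erase i,
        (ENNReal.ofReal (pairWeight F (Finset.univ.erase i) x ^ 2) * pairEnergy μ v L F (x i - x j)
          + ENNReal.ofReal μ * ∑ l ∈ (Finset.univ.erase i).erase j,
            ENNReal.ofReal (pairWeight F ((Finset.univ.erase i).erase j) x ^ 2) *
            pairGradient F (x i - x l) * pairGradient F (x j - x i)) := by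
        refine lintegral_mono_ae (ae_restrict_of_ae (hae.mono fun x hx => ?_))
        rw [sum_Ioi_eq_sum_erase_div_two (fun i j => periodicPotential v L (x i - x j))
          (fun i j => by rw [← neg_sub, periodicPotential_neg]), Finset.mul_sum, Finset.sum_mul,
          ← Finset.sum_add_distrib]
        refine Finset.sum_le_sum fun i _ => ?_
        refine (add_le_add (mul_le_mul' le_rfl (H.sum_enorm_productGradient_le (hx i)))
          le_rfl).trans ?_
        rw [Finset.mul_sum, Finset.sum_mul, ← Finset.sum_add_distrib]
        refine Finset.sum_le_sum fun j hj => ?_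
        refine (add_le_add le_rfl (mul_le_mul' le_rfl
          (H.enorm_productState_sq_le (Finset.ne_of_mem_erase hj) x))).trans (le_of_eq ?_)
        rw [pairEnergy]
        ring
    _ = _ := by
        rw [lintegral_finsetSum _ fun i _ => Finset.measurable_sum _ fun j _ => hT i j]
        refine Finset.sum_congr rfl fun i _ => ?_
        rw [lintegral_finsetSum _ fun j _ => hT i j]
        refine Finset.sum_congr rfl fun j _ => ?_
        rw [lintegral_add_left (hE i j), lintegral_const_mul _ (hGsum i j),
          lintegral_finsetSum _ fun l _ => hG i j l]

/-- The energy per particle is bounded in terms of the pair function. -/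
lemma groundStateEnergy_div_le (H : IsPairFunction μ v L F I J K) (hμ : 0 < μ) (hv : Measurable v)
    (hL : 0 < L) (hI : 0 ≤ I) (hJ : 0 ≤ J) (hK : 0 ≤ K) (hN : 1 ≤ N) {t : ℝ}
    (ht : t = 1 - N * I / L ^ 2) (ht0 : 0 < t) :
    groundStateEnergy μ v N L / (N : ℝ≥0∞)
      ≤ ENNReal.ofReal (N * J / L ^ 2 / t + μ * (N * K / L ^ 2 / t) ^ 2) := by
  set Z := weightIntegral (N := N) F L Finset.univ with hZ
  have hZ0 : Z ≠ 0 := H.weightIntegral_ne_zero hL hI (ht ▸ ht0) _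
  have hnorm : normSq N L (productState F) = Z :=
    lintegral_congr fun x => by rw [productState, enorm_ofReal_sq]
  have hWm : ∀ S : Finset (Fin N), Measurable fun x => ENNReal.ofReal (pairWeight F S x ^ 2) :=
    fun S => ((H.measurable_pairWeight S).pow_const 2).ennreal_ofReal
  have hsub : ∀ i j : Fin N, Measurable fun x : Config N => x i - x j := fun i j =>
    (measurable_pi_apply i).sub (measurable_pi_apply j)
  -- The estimate for adding a particle, read backwards: a removed particle can be restored at the
  -- cost of a factor 1/t.
  have hrem : ∀ {S : Finset (Fin N)} {i}, i ∈ S →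
      weightIntegral F L (S.erase i) ≤ ENNReal.ofReal (1 / t) * weightIntegral F L S := by
    intro S i hi
    have h := H.mul_weightIntegral_erase_le hL hI (ht ▸ ht0.le) hi
    rw [← ht] at h
    calc weightIntegral F L (S.erase i)
        = ENNReal.ofReal (1 / t) * (ENNReal.ofReal t * weightIntegral F L (S.erase i)) := by
          rw [← mul_assoc, ← ENNReal.ofReal_mul (by positivity), one_div_mul_cancel ht0.ne']
          simp
      _ ≤ _ := by gcongr
  have hmain : ∀ i j : Fin N, j ∈ Finset.univ.erase i →
      ∫⁻ x in box N L, ENNReal.ofReal (pairWeight F (Finset.univ.erase i) x ^ 2) *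
        pairEnergy μ v L F (x i - x j) ≤ ENNReal.ofReal (J / L ^ 2 / t) * Z := by
    intro i j hj
    refine (lintegral_box_mul_le hL (H.measurable_pairEnergy hv) H.pairEnergy_periodic H.energy_le
      (hWm _) (Finset.ne_of_mem_erase hj)
      fun x y => by rw [pairWeight_update (Finset.notMem_erase i _)]).trans ?_
    refine (mul_le_mul' le_rfl (hrem (Finset.mem_univ i))).trans (le_of_eq ?_)
    rw [← mul_assoc, ← ENNReal.ofReal_mul (by positivity), mul_one_div]
  have hcross : ∀ i j l : Fin N, j ∈ Finset.univ.erase i → l ∈ (Finset.univ.erase i).erase j →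
      ∫⁻ x in box N L, ENNReal.ofReal (pairWeight F ((Finset.univ.erase i).erase j) x ^ 2) *
        pairGradient F (x i - x l) * pairGradient F (x j - x i)
        ≤ ENNReal.ofReal ((K / L ^ 2 / t) ^ 2) * Z := by
    intro i j l hj hl
    have hji : j ≠ i := Finset.ne_of_mem_erase hj
    have hlj : l ≠ j := Finset.ne_of_mem_erase hl
    have hli : l ≠ i := Finset.ne_of_mem_erase (Finset.mem_of_mem_erase hl)
    have hQm : Measurable fun x : Config N =>
        ENNReal.ofReal (pairWeight F ((Finset.univ.erase i).erase j) x ^ 2) *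
          pairGradient F (x i - x l) := (hWm _).mul (H.measurable_pairGradient.comp (hsub i l))
    -- First x j is integrated, as it occurs only in the last factor; then x i, since the weight
    -- contains neither i nor j. Restoring both particles costs 1/t², which completes the square
    -- (K/L²/t)².
    refine (lintegral_box_mul_le hL H.measurable_pairGradient H.pairGradient_periodic H.gradient_le
      hQm hji.symm fun x y => ?_).trans ?_
    · rw [pairWeight_update (Finset.notMem_erase j _), Function.update_of_ne hji.symm, Function.update_of_ne hlj]
    · have h2 := lintegral_box_mul_le hL H.measurable_pairGradient H.pairGradient_periodic
        H.gradient_le (hWm ((Finset.univ.erase i).erase j)) hli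
        fun x y => by rw [pairWeight_update fun h => Finset.notMem_erase i _ (Finset.mem_of_mem_erase h)]
      refine (mul_le_mul' le_rfl (h2.trans (mul_le_mul' le_rfl ((hrem hj).trans
        (mul_le_mul' le_rfl (hrem (Finset.mem_univ i))))))).trans (le_of_eq ?_)
      rw [← mul_assoc, ← mul_assoc, ← mul_assoc, ← ENNReal.ofReal_mul (by positivity),
        ← ENNReal.ofReal_mul (by positivity), ← ENNReal.ofReal_mul (by positivity)]
      congr 2
      field_simp
  have henergy : energyForm μ v N L (productState F) (productGradient F)
      ≤ (N : ℝ≥0∞) * (ENNReal.ofReal (N * J / L ^ 2 / t + μ * (N * K / L ^ 2 / t) ^ 2) * Z) := by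
    refine (H.energyForm_le_sum hv).trans ?_
    have hcard : ∀ S : Finset (Fin N), (S.card : ℝ≥0∞) ≤ N := fun S => by
      exact_mod_cast (Finset.card_le_univ S).trans_eq (Fintype.card_fin N)
    calc _ ≤ ∑ i : Fin N, ∑ j ∈ Finset.univ.erase i, (ENNReal.ofReal (J / L ^ 2 / t) * Z
          + ENNReal.ofReal μ * (N * (ENNReal.ofReal ((K / L ^ 2 / t) ^ 2) * Z))) := by
          refine Finset.sum_le_sum fun i _ => Finset.sum_le_sum fun j hj => ?_
          refine add_le_add (hmain i j hj) (mul_le_mul' le_rfl ?_)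
          refine (Finset.sum_le_sum fun l hl => hcross i j l hj hl).trans ?_
          rw [Finset.sum_const, nsmul_eq_mul]
          exact mul_le_mul' (hcard _) le_rfl
      _ ≤ ∑ i : Fin N, N * (ENNReal.ofReal (J / L ^ 2 / t) * Z
          + ENNReal.ofReal μ * (N * (ENNReal.ofReal ((K / L ^ 2 / t) ^ 2) * Z))) := by
          refine Finset.sum_le_sum fun i _ => ?_
          rw [Finset.sum_const, nsmul_eq_mul]
          exact mul_le_mul' (hcard _) le_rfl
      _ = _ := by
          rw [Finset.sum_const, nsmul_eq_mul, Finset.card_univ, Fintype.card_fin]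
          congr 1
          have e : N * J / L ^ 2 / t + μ * (N * K / L ^ 2 / t) ^ 2
              = N * (J / L ^ 2 / t + μ * (N * (K / L ^ 2 / t) ^ 2)) := by ring
          rw [e, ENNReal.ofReal_mul (by positivity), ENNReal.ofReal_add (by positivity)
            (by positivity), ENNReal.ofReal_mul hμ.le, ENNReal.ofReal_mul (by positivity),
            ENNReal.ofReal_natCast]
          ring
  have hle : groundStateEnergy μ v N L
      ≤ energyForm μ v N L (productState F) (productGradient F) / Z := by
    refine sInf_le ⟨_, _, H.isPeriodicBoseFunction hL, ?_, ?_⟩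
    · rw [hnorm]; exact hZ0
    · rw [hnorm]
  refine ENNReal.div_le_of_le_mul' (hle.trans (ENNReal.div_le_of_le_mul (henergy.trans_eq ?_)))
  ring

end IsPairFunction

end BoseGas

end

/-! ### Choice of the cutoff radius and numerical constants -/

theorem theorem2p1 :
    ∃ C δ : ℝ, 0 < C ∧ 0 < δ ∧
      ∀ (μ : ℝ) (v : ℝ → ℝ≥0∞) (R₀ R a : ℝ),
        0 < μ → Measurable v → (∀ r, R₀ < r → v r = 0) → R₀ < R →
        a = BoseGas.scatteringLength μ v R → 0 < a →
        ∀ (N : ℕ) (L ρ : ℝ), 1 ≤ N → 0 < L → ρ = N / L ^ 2 → ρ * a ^ 2 < δ →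
          BoseGas.groundStateEnergy μ v N L / (N : ℝ≥0∞) ≤
            ENNReal.ofReal (4 * Real.pi * μ * ρ / |Real.log (ρ * a ^ 2)| *
              (1 + C / |Real.log (ρ * a ^ 2)|)) := by
  refine ⟨1000, Real.exp (-100), by norm_num, Real.exp_pos _, ?_⟩
  intro μ v R₀ R a hμ hv hv0 hRR ha ha0 N L ρ hN hL hρ hsmall
  have hN0 : (0 : ℝ) < N := by exact_mod_cast hN
  have hρ0 : 0 < ρ := by rw [hρ]; positivity
  set s := |Real.log (ρ * a ^ 2)| with hs
  have hlog : Real.log (ρ * a ^ 2) < -100 := by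
    rw [Real.log_lt_iff_lt_exp (by positivity)]; exact hsmall
  have hs1 : s = -(Real.log ρ + 2 * Real.log a) := by
    rw [hs, abs_of_neg (by linarith), Real.log_mul hρ0.ne' (by positivity), Real.log_pow]
    push_cast; ring
  have hs100 : 100 < s := by rw [hs, abs_of_neg (by linarith)]; linarith
  -- At the mean interparticle distance, ρb² = 1 keeps all errors of relative order 1/ℓ, and ln
  -- (b/a) = s/2.
  set b := √(1 / ρ) with hb
  have hb0 : 0 < b := Real.sqrt_pos.2 (by positivity)
  have hb2 : b ^ 2 = 1 / ρ := Real.sq_sqrt (by positivity)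
  have hlogb : Real.log b = -Real.log ρ / 2 := by
    rw [hb, Real.log_sqrt (by positivity), one_div, Real.log_inv]
  set ℓ := Real.log b - Real.log a - 1 with hℓ
  have hℓs : ℓ = s / 2 - 1 := by rw [hℓ, hlogb, hs1]; ring
  have hℓ49 : 49 < ℓ := by rw [hℓs]; linarith
  have hℓ0 : 0 < ℓ := by linarith
  obtain ⟨U, hU⟩ := BoseGas.exists_scatteringProfile_of_scatteringLength hμ hv hv0 hRR ha ha0 hℓ0 hℓ
  obtain ⟨F, hF⟩ := BoseGas.exists_pairFunction (L := L) hμ hv hb0 hℓ0 hL hU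
  have hπ := Real.pi_pos
  have hπ4 := Real.pi_lt_d2
  have hNI : N * (4 * Real.pi * b ^ 2 / ℓ) / L ^ 2 = 4 * Real.pi / ℓ := by
    rw [hb2, hρ]; field_simp
  set t := 1 - 4 * Real.pi / ℓ with ht
  have hx : 4 * Real.pi / ℓ < 1 / 2 := by
    rw [div_lt_iff₀ hℓ0]; linarith
  have hx0 : 0 < 4 * Real.pi / ℓ := by positivity
  have ht0 : 1 / 2 < t := by rw [ht]; linarith
  refine (hF.groundStateEnergy_div_le (t := t) hμ hv hL (by positivity) (by positivity)
    (by positivity) hN (by rw [hNI]) (by linarith)).trans (ENNReal.ofReal_le_ofReal ?_)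
  have e1 : N * (2 * Real.pi * μ / ℓ) / L ^ 2 = 2 * Real.pi * μ * ρ / ℓ := by
    rw [hρ]; field_simp
  have e2 : (N * (2 * Real.pi * b / ℓ) / L ^ 2 / t) ^ 2
      = 4 * Real.pi ^ 2 * ρ / (ℓ * t) ^ 2 := by
    have : N * (2 * Real.pi * b / ℓ) / L ^ 2 / t = ρ * b * (2 * Real.pi) / (ℓ * t) := by
      rw [hρ]; field_simp
    rw [this, div_pow, mul_pow, mul_pow, hb2]
    field_simp; ring
  rw [e1, e2]
  have hℓt : ℓ * t = ℓ - 4 * Real.pi := by rw [ht]; field_simp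
  have e3 : 2 * Real.pi * μ * ρ / ℓ / t = 2 * Real.pi * μ * ρ / (ℓ * t) := by rw [div_div]
  obtain ⟨m, hm⟩ : ∃ m, m = ℓ * t := ⟨_, rfl⟩
  rw [← hm] at hℓt e3 ⊢
  -- Here m = s/2 - 1 - 4π, and 1 + 4π < 14.
  have hmlow : s / 2 - 14 ≤ m := by rw [hℓt, hℓs]; linarith
  have hm0 : 0 < m := by linarith
  have hm36 : s ≤ 3 * m := by linarith
  -- Expansion of 1/(s/2 - 14) = (2/s)/(1 - 28/s): the product (1 + 84/s)(1 - 28/s) = 1 + 56/s -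
  -- 2352/s² is at least 1 once s ≥ 42.
  have hinv : 1 / m ≤ 2 / s * (1 + 84 / s) := by
    rw [div_le_iff₀ hm0]
    have : 2 / s * (1 + 84 / s) * (s / 2 - 14) ≤ 2 / s * (1 + 84 / s) * m := by gcongr
    refine le_trans ?_ this
    have : 2 / s * (1 + 84 / s) * (s / 2 - 14) = 1 + (56 - 2352 / s) / s := by
      field_simp; ring
    rw [this]
    have : 2352 / s ≤ 56 := by rw [div_le_iff₀ (by linarith)]; linarith
    have : 0 ≤ (56 - 2352 / s) / s := div_nonneg (by linarith) (by linarith)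
    linarith
  have hs0 : 0 < s := by linarith
  have hinv2 : 1 / m ^ 2 ≤ 9 / s ^ 2 := by
    rw [div_le_div_iff₀ (by positivity) (by positivity)]
    nlinarith
  rw [e3]
  calc 2 * Real.pi * μ * ρ / m + μ * (4 * Real.pi ^ 2 * ρ / m ^ 2)
      = 2 * Real.pi * μ * ρ * (1 / m) + 4 * Real.pi * μ * ρ * Real.pi * (1 / m ^ 2) := by
        ring
    _ ≤ 2 * Real.pi * μ * ρ * (2 / s * (1 + 84 / s)) + 4 * Real.pi * μ * ρ * Real.pi * (9 / s ^ 2) := by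
        gcongr
    _ = 4 * Real.pi * μ * ρ / s * (1 + (84 + 9 * Real.pi) / s) := by field_simp; ring
    _ ≤ _ := by
        gcongr
        linarith
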